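/- All topological groups are Hausdorff. For a locally compact group $G$ with left Haar measure $dx$ and modular function $\Delta$ (so that $\int_G f(xs)\,dx=\Delta(s)^{-1}\int_G f(x)\,dx$), let $\lambda$ and $\rho$ be the left and right regular representations of $G$ on $L^2(G)$, $(\lambda(s)f)(t)=f(s^{-1}t)$ and $(\rho(s)f)(t)=\Delta(s)^{1/2}f(ts)$. The group $G$ has the *factorization property* if the representation $(s,t)\mapsto\lambda(s)\rho(t)$ of $G\times G$ on $L^2(G)$ extends to a $*$-representation of the minimal tensor product $C^*(G)\otimes_{\min}C^*(G)$ of the full group C*-algebra with itself, i.e. if there is a $*$-representation of $C^*(G)\otimes_{\min}C^*(G)$ on $L^2(G)$ with $a\otimes b\mapsto\lambda(a)\rho(b)$ for $a,b\in C^*(G)$. A locally compact group is *amenable* if there is a left invariant mean on its bounded continuous functions. A locally compact group $G$ is *residually amenably embeddable* if for every $x\in G\setminus\{e\}$ there is a closed normal subgroup $N$ of $G$ with $x\notin N$ such that $G/N$ admits a continuous injective homomorphism into an amenable locally compact group. It is *residually amenable* if for every $x\in G\setminus\{e\}$ there is a closed normal subgroup $N$ of $G$ with $x\notin N$ such that $G/N$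 is amenable. **Corollary.** Let $G$ be a locally compact group. 1. If $G$ is residually amenably embeddable, then $G$ has the factorization property. 2. $G$ is residually amenably embeddable if and only if for every $x\in G\setminus\{e\}$ there is a continuous homomorphism $\varphi\colon G\to G'$ into an amenable locally compact group $G'$ with $\varphi(x)\ne e$. 3. In particular, if $G$ is residually amenable, then $G$ has the factorization property. -/

import Mathlib

universe u v

section FactorizationDefs

open MeasureTheory MeasureTheory.Measure Filter Topology
open scoped ENNReal NNReal CompactlySupported BoundedContinuousFunction TensorProduct

/-- A (strongly continuous) unitary representation of a topological group `G` on `H`. -/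
structure UnitaryRep (G : Type*) [Group G] [TopologicalSpace G]
    (H : Type*) [NormedAddCommGroup H] [InnerProductSpace ℂ H] where
  toHom : G →* (H ≃ₗᵢ[ℂ] H)
  continuous_orbit : ∀ ξ : H, Continuous fun g : G => toHom g ξ

namespace UnitaryRep

section Integrated

variable {G : Type*} [Group G] [TopologicalSpace G] [IsTopologicalGroup G]
  [LocallyCompactSpace G] [MeasurableSpace G] [BorelSpace G]
  {H : Type*} [NormedAddCommGroup H] [InnerProductSpace ℂ H]

theorem integrable_smul_orbit (π : UnitaryRep G H) (f : C_c(G, ℂ)) (ξ : H) :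
    Integrable (fun x => f x • π.toHom x ξ) (haar : Measure G) :=
  (f.continuous.smul (π.continuous_orbit ξ)).integrable_of_hasCompactSupport
    (f.hasCompactSupport.smul_right)

/-- The integrated form: `π(f) ξ = ∫ f(x) π(x) ξ dx`, integration with respect to left Haar
measure. -/
noncomputable def integrated (π : UnitaryRep G H) (f : C_c(G, ℂ)) : H →L[ℂ] H :=
  LinearMap.mkContinuous
    { toFun := fun ξ => ∫ x, f x • π.toHom x ξ ∂(haar : Measure G)
      map_add' := fun ξ η => by
        simp only [map_add, smul_add]
        exact integral_add (π.integrable_smul_orbit f ξ) (π.integrable_smul_orbit f η)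
      map_smul' := fun c ξ => by
        simp only [map_smul, RingHom.id_apply]
        rw [← integral_smul]
        simp only [smul_comm c] }
    (∫ x, ‖f x‖ ∂(haar : Measure G))
    (fun ξ => by
      refine (norm_integral_le_integral_norm _).trans (le_of_eq ?_)
      simp only [norm_smul, LinearIsometryEquiv.norm_map]
      exact integral_mul_const _ _)

end Integrated

section DirectSum

variable {G : Type*} [Group G] [TopologicalSpace G]
  {ι : Type*} {H : ι → Type*} [∀ i, NormedAddCommGroup (H i)] [∀ i, InnerProductSpace ℂ (H i)]

theorem memlp_map (U : ∀ i, H i ≃ₗᵢ[ℂ] H i) (ξ : lp H 2) : Memℓp (fun i => U i (ξ i)) 2 := by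
  have h := lp.memℓp ξ
  rw [memℓp_gen_iff (by norm_num)] at h ⊢
  simpa using h

/-- The unitary `⨁ᵢ Uᵢ` on the Hilbert direct sum, for a family of unitaries `Uᵢ`. -/
noncomputable def directSumUnitary : (∀ i, H i ≃ₗᵢ[ℂ] H i) →* (lp H 2 ≃ₗᵢ[ℂ] lp H 2) where
  toFun U :=
    { toFun := fun ξ => ⟨fun i => U i (ξ i), memlp_map U ξ⟩
      invFun := fun ξ => ⟨fun i => (U i).symm (ξ i), memlp_map (fun i => (U i).symm) ξ⟩
      left_inv := fun ξ => by ext i; simp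
      right_inv := fun ξ => by ext i; simp
      map_add' := fun ξ η => by ext i; exact map_add (U i) (ξ i) (η i)
      map_smul' := fun c ξ => by ext i; simp
      norm_map' := fun ξ => by
        rw [lp.norm_eq_tsum_rpow (by norm_num), lp.norm_eq_tsum_rpow (by norm_num)]
        simp }
  map_one' := by ext ξ i; rfl
  map_mul' U V := by ext ξ i; rfl

@[simp]
theorem directSumUnitary_apply (U : ∀ i, H i ≃ₗᵢ[ℂ] H i) (ξ : lp H 2) (i : ι) :
    directSumUnitary U ξ i = U i (ξ i) := rfl

/-- If the orbit maps of a family of isometries are continuous for vectors spanning a dense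
subspace, then all orbit maps are continuous. -/
theorem continuous_orbit_of_dense {X E : Type*} [TopologicalSpace X] [NormedAddCommGroup E]
    [InnerProductSpace ℂ E] (T : X → (E ≃ₗᵢ[ℂ] E)) (D : Set E) (hD : Dense D)
    (h : ∀ ξ ∈ D, Continuous fun x => T x ξ) (ξ : E) : Continuous fun x => T x ξ := by
  have := continuous_prod_of_dense_continuous_lipschitzWith
    (fun p : E × X => T p.2 p.1) 1 hD h (fun x => (T x).isometry.lipschitz)
  exact this.comp (by fun_prop : Continuous fun x : X => (ξ, x))

/-- The Hilbert direct sum of a family of unitary representations. -/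
noncomputable def directSum (π : ∀ i, UnitaryRep G (H i)) : UnitaryRep G (lp H 2) where
  toHom := directSumUnitary.comp (MonoidHom.pi fun i => (π i).toHom)
  continuous_orbit := by
    classical
    refine continuous_orbit_of_dense
      (fun g => directSumUnitary (fun i => (π i).toHom g))
      {ξ | Continuous fun g => directSumUnitary (fun i => (π i).toHom g) ξ} ?_ (fun ξ hξ => hξ)
    intro ξ
    have hs := lp.hasSum_single (p := 2) (by norm_num) ξ
    refine mem_closure_of_tendsto hs (Eventually.of_forall fun s => ?_)
    change Continuous fun g => directSumUnitary (fun i => (π i).toHom g) _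
    simp only [_root_.map_sum]
    refine continuous_finsetSum _ fun i _ => ?_
    have : (fun g => directSumUnitary (fun i => (π i).toHom g) (lp.single 2 i (ξ i))) =
        fun g => lp.single 2 i ((π i).toHom g (ξ i)) := by
      ext g j
      rcases eq_or_ne j i with rfl | hj
      · simp
      · simp [hj]
    rw [this]
    exact (lp.singleContinuousLinearMap ℂ H 2 i).continuous.comp ((π i).continuous_orbit _)

end DirectSum

section Regular

open scoped Pointwise

variable {G : Type*} [Group G] [TopologicalSpace G] [IsTopologicalGroup G]
  [LocallyCompactSpace G]

/-- The modular function `Δ` of `G`, normalised by `∫ f(x s) dx = Δ(s)⁻¹ ∫ f(x) dx` for left Haar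
measure `dx` (Mathlib's `modularCharacter` is the inverse of this one). -/
noncomputable def modularFn (s : G) : ℝ := ((modularCharacter s : ℝ≥0) : ℝ)⁻¹

theorem modularFn_pos (s : G) : 0 < modularFn s :=
  inv_pos.2 (NNReal.coe_pos.2 (modularCharacterFun_pos s))

theorem modularFn_one : modularFn (1 : G) = 1 := by simp [modularFn]

theorem modularFn_mul (s t : G) : modularFn (s * t) = modularFn s * modularFn t := by
  simp [modularFn, mul_comm]

variable [MeasurableSpace G] [BorelSpace G]

theorem map_mul_right_haar (s : G) :
    Measure.map (· * s) (haar : Measure G) = modularCharacter s • (haar : Measure G) := by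
  have : (Measure.map (· * s) (haar : Measure G)).Regular :=
    Measure.Regular.map (Homeomorph.mulRight s)
  have h : modularCharacter s = modularCharacterFun s := rfl
  rw [h, modularCharacterFun_eq_haarScalarFactor (haar : Measure G) s]
  exact isMulLeftInvariant_eq_smul_of_regular _ _

theorem integral_mul_right_haar (f : G → ℂ) (s : G) :
    ∫ x, f (x * s) ∂(haar : Measure G) = ((modularFn s)⁻¹ : ℝ) • ∫ x, f x ∂(haar : Measure G) := by
  have h := (Homeomorph.mulRight s).measurableEmbedding.integral_map (μ := haar) f
  simp only [Homeomorph.coe_mulRight] at h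
  rw [← h]
  change ∫ y, f y ∂(Measure.map (· * s) (haar : Measure G)) = _
  rw [map_mul_right_haar, integral_smul_nnreal_measure]
  simp [modularFn, NNReal.smul_def]

theorem continuous_integral_mul_right {g : G → ℂ} (hg : Continuous g) (hc : HasCompactSupport g) :
    Continuous fun s : G => ∫ x, g (x * s) ∂(haar : Measure G) := by
  refine continuous_iff_continuousAt.2 fun s₀ => ?_
  obtain ⟨t, ht, hts⟩ := exists_compact_mem_nhds s₀
  have hk : IsCompact (tsupport g * t⁻¹) := hc.isCompact.mul ht.inv
  have : ContinuousOn (fun s : G => ∫ x, g (x * s) ∂(haar : Measure G)) t := by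
    refine continuousOn_integral_of_compact_support hk
      (f := fun s x => g (x * s)) (by fun_prop) fun s x hs hx => ?_
    contrapose! hx
    exact ⟨x * s, subset_tsupport _ hx, s⁻¹, Set.inv_mem_inv.2 hs, by simp⟩
  exact this.continuousAt hts

theorem continuous_modularFn : Continuous (modularFn : G → ℝ) := by
  obtain ⟨⟨f, f_cont⟩, f_comp, f_nonneg, f_one⟩ :
    ∃ f : C(G, ℝ), HasCompactSupport f ∧ 0 ≤ f ∧ f 1 ≠ 0 := exists_continuous_nonneg_pos 1
  have hpos : 0 < ∫ x, f x ∂(haar : Measure G) :=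
    f_cont.integral_pos_of_hasCompactSupport_nonneg_nonzero f_comp f_nonneg f_one
  have hf : Continuous fun x => (f x : ℂ) := by fun_prop
  have hfc : HasCompactSupport fun x => (f x : ℂ) :=
    HasCompactSupport.comp_left (g := fun r : ℝ => (r : ℂ)) f_comp (by simp)
  have key := continuous_integral_mul_right hf hfc
  have e : (fun s : G => (modularFn s)⁻¹) = fun s =>
      (∫ x, (f (x * s) : ℂ) ∂(haar : Measure G)).re / ∫ x, f x ∂(haar : Measure G) := by
    funext s
    rw [integral_mul_right_haar (fun x => (f x : ℂ)), integral_complex_ofReal]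
    simp only [Complex.real_smul, Complex.re_ofReal_mul, Complex.ofReal_re]
    field_simp
  have h2 : Continuous fun s : G => (modularFn s)⁻¹ := by
    rw [e]; exact (Complex.continuous_re.comp key).div_const _
  have h3 := h2.inv₀ (fun s => (inv_pos.2 (modularFn_pos s)).ne')
  exact h3.congr fun s => inv_inv _

theorem memLp_mul_right {f : G → ℂ} (hf : MemLp f 2 (haar : Measure G)) (s : G) :
    MemLp (fun t => f (t * s)) 2 (haar : Measure G) := by
  have h : MemLp f 2 (Measure.map (· * s) (haar : Measure G)) := by
    rw [map_mul_right_haar]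
    exact hf.smul_measure (c := (modularCharacter s : ℝ≥0∞)) ENNReal.coe_ne_top
  exact (memLp_map_measure_iff h.1 (measurable_mul_const s).aemeasurable).1 h

theorem ae_mul_right {p : G → Prop} (h : ∀ᵐ x ∂(haar : Measure G), p x) (s : G) :
    ∀ᵐ x ∂(haar : Measure G), p (x * s) := by
  have : ∀ᵐ x ∂(Measure.map (· * s) (haar : Measure G)), p x := by
    rw [map_mul_right_haar]
    exact Measure.ae_smul_measure h _
  exact ae_of_ae_map (measurable_mul_const s).aemeasurable this

theorem eLpNorm_mul_right {f : G → ℂ} (hf : MemLp f 2 (haar : Measure G)) (s : G) :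
    (eLpNorm (fun t => f (t * s)) 2 (haar : Measure G)).toReal =
      (√(modularFn s))⁻¹ * (eLpNorm f 2 (haar : Measure G)).toReal := by
  have hm : AEStronglyMeasurable f (Measure.map (· * s) (haar : Measure G)) := by
    rw [map_mul_right_haar]; exact hf.1.smul_measure _
  have := eLpNorm_map_measure (p := 2) hm (measurable_mul_const s).aemeasurable
  change _ = eLpNorm (fun t => f (t * s)) 2 haar at this
  rw [← this, map_mul_right_haar]
  change (eLpNorm f 2 ((modularCharacter s : ℝ≥0∞) • (haar : Measure G))).toReal = _
  rw [eLpNorm_smul_measure_of_ne_top (by norm_num), smul_eq_mul, ENNReal.toReal_mul,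
    ← ENNReal.toReal_rpow]
  congr 1
  simp only [ENNReal.coe_toReal, modularFn, Real.sqrt_inv, inv_inv]
  rw [Real.sqrt_eq_rpow]
  norm_num

variable (G) in
/-- The Hilbert space `L²(G)` with respect to left Haar measure. -/
abbrev L2 : Type _ := Lp ℂ 2 (haar : Measure G)

/-- A group homomorphism into unitaries from a multiplicative family of linear isometries. -/
def unitaryHomOfIsometries {E : Type*} [NormedAddCommGroup E] [InnerProductSpace ℂ E]
    (T : G → (E →ₗᵢ[ℂ] E)) (h1 : ∀ ξ, T 1 ξ = ξ) (hm : ∀ s t ξ, T (s * t) ξ = T s (T t ξ)) :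
    G →* (E ≃ₗᵢ[ℂ] E) where
  toFun s :=
    { (T s) with
      invFun := T s⁻¹
      left_inv := fun ξ => by
        change T s⁻¹ (T s ξ) = ξ
        rw [← hm, inv_mul_cancel, h1]
      right_inv := fun ξ => by
        change T s (T s⁻¹ ξ) = ξ
        rw [← hm, mul_inv_cancel, h1] }
  map_one' := by ext ξ; exact h1 ξ
  map_mul' s t := by ext ξ; exact hm s t ξ

/-- The operator `λ(s)` on `L²(G)`, `(λ(s) f)(t) = f(s⁻¹ t)`. -/
noncomputable def leftOp (s : G) : L2 G →ₗᵢ[ℂ] L2 G :=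
  Lp.compMeasurePreservingₗᵢ ℂ (fun t => s⁻¹ * t) (measurePreserving_mul_left haar s⁻¹)

theorem leftOp_coeFn (s : G) (f : L2 G) : leftOp s f =ᵐ[haar] fun t => f (s⁻¹ * t) :=
  Lp.coeFn_compMeasurePreserving f (measurePreserving_mul_left haar s⁻¹)

/-- The left regular representation `λ`. -/
noncomputable def leftRegular : UnitaryRep G (L2 G) where
  toHom := unitaryHomOfIsometries leftOp
    (fun f => by
      ext1
      filter_upwards [leftOp_coeFn 1 f] with t ht
      simpa using ht)
    (fun s t f => by
      ext1
      filter_upwards [leftOp_coeFn (s * t) f, leftOp_coeFn s (leftOp t f),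
        (measurePreserving_mul_left haar s⁻¹).quasiMeasurePreserving.ae (leftOp_coeFn t f)]
        with x h1 h2 h3
      rw [h1, h2, h3]
      simp [mul_assoc])
  continuous_orbit f := by
    let g : C(G, C(G, G)) :=
      ContinuousMap.curry ⟨fun p : G × G => p.1⁻¹ * p.2, by fun_prop⟩
    exact (continuous_const (y := f)).compMeasurePreservingLp (μ := (haar : Measure G))
      (ν := (haar : Measure G)) g.continuous
      (fun s => measurePreserving_mul_left haar s⁻¹) (by norm_num)

/-- The operator `ρ(s)` on `L²(G)`, `(ρ(s) f)(t) = Δ(s)^{1/2} f(t s)`. -/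
noncomputable def rightOp (s : G) : L2 G →ₗᵢ[ℂ] L2 G where
  toFun f := ((memLp_mul_right (Lp.memLp f) s).const_smul ((√(modularFn s) : ℝ) : ℂ)).toLp _
  map_add' f g := by
    rw [← MemLp.toLp_add]
    refine MemLp.toLp_congr _ _ ?_
    filter_upwards [ae_mul_right (Lp.coeFn_add f g) s] with t ht
    change _ * (f + g : L2 G) (t * s) = _ * f (t * s) + _ * g (t * s)
    rw [ht, Pi.add_apply, mul_add]
  map_smul' c f := by
    rw [RingHom.id_apply, ← MemLp.toLp_const_smul]
    refine MemLp.toLp_congr _ _ ?_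
    filter_upwards [ae_mul_right (Lp.coeFn_smul c f) s] with t ht
    simp [ht, mul_left_comm]
  norm_map' f := by
    have hs : 0 < √(modularFn s) := Real.sqrt_pos.2 (modularFn_pos s)
    change ‖((memLp_mul_right (Lp.memLp f) s).const_smul
      ((√(modularFn s) : ℝ) : ℂ)).toLp _‖ = ‖f‖
    rw [Lp.norm_toLp, eLpNorm_const_smul, ENNReal.toReal_mul, eLpNorm_mul_right (Lp.memLp f),
      Lp.norm_def]
    simp only [toReal_enorm, Complex.norm_real, Real.norm_of_nonneg hs.le]
    field_simp

theorem rightOp_coeFn (s : G) (f : L2 G) :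
    rightOp s f =ᵐ[haar] fun t => ((√(modularFn s) : ℝ) : ℂ) * f (t * s) :=
  ((memLp_mul_right (Lp.memLp f) s).const_smul ((√(modularFn s) : ℝ) : ℂ)).coeFn_toLp

/-- The homomorphism underlying the right regular representation. -/
noncomputable def rightHom : G →* (L2 G ≃ₗᵢ[ℂ] L2 G) :=
  unitaryHomOfIsometries rightOp
    (fun f => by
      ext1
      filter_upwards [rightOp_coeFn 1 f] with t ht
      simpa [modularFn_one] using ht)
    (fun s t f => by
      ext1
      filter_upwards [rightOp_coeFn (s * t) f, rightOp_coeFn s (rightOp t f),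
        ae_mul_right (rightOp_coeFn t f) s] with x h1 h2 h3
      rw [h1, h2, h3, modularFn_mul, Real.sqrt_mul (modularFn_pos s).le]
      simp [mul_assoc])

theorem rightHom_coeFn (s : G) (f : L2 G) :
    rightHom s f =ᵐ[haar] fun t => ((√(modularFn s) : ℝ) : ℂ) * f (t * s) :=
  rightOp_coeFn s f

theorem continuous_rightHom_of_compactSupport {f : G → ℂ} (hf : Continuous f)
    (hc : HasCompactSupport f) (hm : MemLp f 2 (haar : Measure G)) :
    Continuous fun s : G => rightHom s (hm.toLp f) := by
  set ξ : L2 G := hm.toLp f with hξ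
  have key : ∀ s₀ : G, Continuous fun s : G => inner ℂ (rightHom s ξ) (rightHom s₀ ξ) := by
    intro s₀
    have e : (fun s : G => inner ℂ (rightHom s ξ) (rightHom s₀ ξ)) = fun s : G =>
        ((√(modularFn s) * √(modularFn s₀) : ℝ) : ℂ) *
          ∫ x, (starRingEnd ℂ) (f (x * s)) * f (x * s₀) ∂(haar : Measure G) := by
      funext s
      rw [L2.inner_def, ← integral_const_mul]
      refine integral_congr_ae ?_
      filter_upwards [rightHom_coeFn s ξ, rightHom_coeFn s₀ ξ,
        ae_mul_right hm.coeFn_toLp s, ae_mul_right hm.coeFn_toLp s₀] with x h1 h2 h3 h4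
      rw [h1, h2, hξ, h3, h4]
      simp
      ring
    rw [e]
    refine Continuous.mul ?_ ?_
    · have := continuous_modularFn (G := G)
      fun_prop
    · have hk : IsCompact (tsupport f * {s₀⁻¹}) := hc.isCompact.mul isCompact_singleton
      rw [← continuousOn_univ]
      refine continuousOn_integral_of_compact_support hk
        (f := fun s x => (starRingEnd ℂ) (f (x * s)) * f (x * s₀)) ?_ fun s x _ hx => ?_
      · have : Continuous (starRingEnd ℂ) := Complex.continuous_conj
        fun_prop
      · contrapose! hx
        exact ⟨x * s₀, subset_tsupport _ (right_ne_zero_of_mul hx), s₀⁻¹, rfl, by simp⟩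
  refine continuous_iff_continuousAt.2 fun s₀ => ?_
  rw [ContinuousAt, tendsto_iff_norm_sub_tendsto_zero]
  have e : (fun s : G => ‖rightHom s ξ - rightHom s₀ ξ‖) = fun s =>
      √(‖ξ‖ ^ 2 - 2 * (inner ℂ (rightHom s ξ) (rightHom s₀ ξ)).re + ‖ξ‖ ^ 2) := by
    funext s
    have := norm_sub_sq (𝕜 := ℂ) (rightHom s ξ) (rightHom s₀ ξ)
    simp only [LinearIsometryEquiv.norm_map, RCLike.re_eq_complex_re] at this
    rw [← this, Real.sqrt_sq (norm_nonneg _)]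
  rw [e]
  have hcont : Continuous fun s : G =>
      √(‖ξ‖ ^ 2 - 2 * (inner ℂ (rightHom s ξ) (rightHom s₀ ξ)).re + ‖ξ‖ ^ 2) := by
    have := Complex.continuous_re.comp (key s₀)
    simp only [Function.comp_def] at this
    fun_prop
  have h0 := hcont.tendsto s₀
  have : √(‖ξ‖ ^ 2 - 2 * (inner ℂ (rightHom s₀ ξ) (rightHom s₀ ξ)).re + ‖ξ‖ ^ 2) = 0 := by
    have e' := congrFun e s₀
    simp only [sub_self, norm_zero] at e'
    exact e'.symm
  rwa [this] at h0

/-- Indicators of sets of finite measure are `L²`-limits of compactly supported continuous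
functions. -/
theorem exists_continuous_approx_indicator (c : ℂ) {A : Set G} (hA : MeasurableSet A)
    (hfin : (haar : Measure G) A < ∞) {ε : ℝ≥0∞} (hε : ε ≠ 0) :
    ∃ f : G → ℂ, Continuous f ∧ HasCompactSupport f ∧
      eLpNorm (f - A.indicator fun _ => c) 2 (haar : Measure G) ≤ ε := by
  obtain ⟨η, hη, hηs⟩ := exists_eLpNorm_indicator_le (μ := (haar : Measure G)) (p := 2)
    (by norm_num) c hε
  have hη2 : ((η / 2 : ℝ≥0) : ℝ≥0∞) ≠ 0 := by simpa using hη.ne'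
  obtain ⟨K, hKA, hK, hKcl, hKm⟩ := hA.exists_isCompact_isClosed_sdiff_lt hfin.ne hη2
  obtain ⟨U, hKU, hU, hUm⟩ := hK.exists_isOpen_lt_add (μ := (haar : Measure G)) hη2
  have hUK := measure_sdiff_lt_of_lt_add hKcl.measurableSet.nullMeasurableSet hKU
    hK.measure_lt_top.ne hUm
  obtain ⟨φ, hφ1, hφ0, hφc, hφ⟩ := exists_continuous_one_zero_of_isCompact hK
    hU.isClosed_compl (Set.disjoint_compl_right_iff_subset.2 hKU)
  refine ⟨fun x => (φ x : ℂ) * c, by fun_prop, ?_, ?_⟩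
  · exact HasCompactSupport.comp_left (g := fun r : ℝ => (r : ℂ) * c) hφc (by simp)
  · refine le_trans ?_ (hηs ((A \ K) ∪ (U \ K)) ?_)
    · refine eLpNorm_mono fun x => ?_
      by_cases hxK : x ∈ K
      · simp [hφ1 hxK, hKA hxK]
      · by_cases hxU : x ∈ U
        · have hx := hφ x
          by_cases hxA : x ∈ A
          · have : (φ x : ℂ) * c - c = ((φ x - 1 : ℝ) : ℂ) * c := by push_cast; ring
            simp only [Pi.sub_apply, Set.indicator_of_mem hxA, this, norm_mul, Complex.norm_real]
            rw [Set.indicator_of_mem (show x ∈ (A \ K) ∪ (U \ K) from Or.inl ⟨hxA, hxK⟩)]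
            refine mul_le_of_le_one_left (norm_nonneg _) ?_
            rw [Real.norm_eq_abs, abs_le]
            constructor <;> linarith [hx.1, hx.2]
          · simp only [Pi.sub_apply, Set.indicator_of_notMem hxA, sub_zero, norm_mul,
              Complex.norm_real]
            rw [Set.indicator_of_mem (show x ∈ (A \ K) ∪ (U \ K) from Or.inr ⟨hxU, hxK⟩)]
            refine mul_le_of_le_one_left (norm_nonneg _) ?_
            rw [Real.norm_eq_abs, abs_le]
            constructor <;> linarith [hx.1, hx.2]
        · have h0 : φ x = 0 := hφ0 hxU
          by_cases hxA : x ∈ A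
          · simp [h0, hxA, hxK]
          · simp [h0, hxA, hxU]
    · refine (measure_union_le _ _).trans ((add_le_add hKm.le hUK.le).trans (le_of_eq ?_))
      rw [← ENNReal.coe_add, add_halves]

/-- The right regular representation `ρ`. -/
noncomputable def rightRegular : UnitaryRep G (L2 G) where
  toHom := rightHom
  continuous_orbit := by
    let D : Submodule ℂ (L2 G) :=
      { carrier := {ξ | Continuous fun s : G => rightHom s ξ}
        add_mem' := fun {ξ η} hξ hη => by
          change Continuous fun s : G => rightHom s (ξ + η)
          simp only [_root_.map_add]
          exact Continuous.add hξ hη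
        zero_mem' := by
          change Continuous fun s : G => rightHom s (0 : L2 G)
          simpa only [map_zero] using continuous_const
        smul_mem' := fun c ξ hξ => by
          change Continuous fun s : G => rightHom s (c • ξ)
          simp only [_root_.map_smul]
          exact Continuous.const_smul hξ c }
    refine continuous_orbit_of_dense (fun s : G => rightHom s) (D : Set (L2 G)) ?_
      (fun ξ hξ => hξ)
    suffices h : ∀ ξ : L2 G, ξ ∈ D.topologicalClosure from fun ξ => h ξ
    intro ξ
    refine Lp.induction (by norm_num) (fun ξ : L2 G => ξ ∈ D.topologicalClosure) ?_ ?_ ?_ ξ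
    · intro c A hA hfin
      refine EMetric.mem_closure_iff.2 fun ε hε => ?_
      obtain ⟨δ, hδ, hδε⟩ := exists_between hε
      obtain ⟨f, hf, hfc, hle⟩ := exists_continuous_approx_indicator c hA hfin hδ.ne'
      have hm : MemLp f 2 (haar : Measure G) := hf.memLp_of_hasCompactSupport hfc
      refine ⟨hm.toLp f, continuous_rightHom_of_compactSupport hf hfc hm, ?_⟩
      refine lt_of_le_of_lt ?_ hδε
      rw [edist_comm, Lp.simpleFunc.coe_indicatorConst]
      unfold indicatorConstLp
      rw [Lp.edist_toLp_toLp]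
      exact hle
    · intro f g hf hg _ h1 h2
      exact add_mem h1 h2
    · exact D.isClosed_topologicalClosure

end Regular

section UniversalRep

variable (G : Type u) [Group G] [TopologicalSpace G]

/-- The universal representation `π_u` of `G`: the Hilbert direct sum of all unitary
representations of `G` on the Hilbert space `ℓ²(G × ℕ)`. Every cyclic representation of `G` lives on
a Hilbert space of dimension at most `|G × ℕ|`, hence is (after adding a trivial representation to
fill up the dimension) a subrepresentation of one of the summands. So every unitary representation
of `G` is a direct sum of subrepresentations of `π_u`, and `f ↦ ‖π_u(f)‖` is the supremum of
`‖π(f)‖` over all unitary representations `π` of `G`. -/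
noncomputable def universal :
    UnitaryRep G (lp (fun _ : UnitaryRep G (lp (fun _ : G × ℕ => ℂ) 2) =>
      lp (fun _ : G × ℕ => ℂ) 2) 2) :=
  directSum fun π => π

/-- The Hilbert space of the universal representation. -/
abbrev UniversalSpace : Type u :=
  lp (fun _ : UnitaryRep G (lp (fun _ : G × ℕ => ℂ) 2) => lp (fun _ : G × ℕ => ℂ) 2) 2

end UniversalRep
end UnitaryRep

section SpatialTensor

variable {H K : Type*} [NormedAddCommGroup H] [InnerProductSpace ℂ H]
  [NormedAddCommGroup K] [InnerProductSpace ℂ K]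

variable (H K) in
/-- The Hilbert space tensor product: the completion of the algebraic tensor product with its
canonical inner product. -/
def HilbertTensor : Type _ := UniformSpace.Completion (H ⊗[ℂ] K)

noncomputable instance : NormedAddCommGroup (HilbertTensor H K) :=
  inferInstanceAs (NormedAddCommGroup (UniformSpace.Completion (H ⊗[ℂ] K)))

noncomputable instance : InnerProductSpace ℂ (HilbertTensor H K) :=
  inferInstanceAs (InnerProductSpace ℂ (UniformSpace.Completion (H ⊗[ℂ] K)))

instance : CompleteSpace (HilbertTensor H K) :=
  inferInstanceAs (CompleteSpace (UniformSpace.Completion (H ⊗[ℂ] K)))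

/-- The canonical isometry from the algebraic tensor product. -/
noncomputable def HilbertTensor.of : H ⊗[ℂ] K →ₗᵢ[ℂ] HilbertTensor H K :=
  (UniformSpace.Completion.toComplₗᵢ : H ⊗[ℂ] K →ₗᵢ[ℂ] UniformSpace.Completion (H ⊗[ℂ] K))

theorem HilbertTensor.denseRange_of :
    DenseRange (HilbertTensor.of : H ⊗[ℂ] K →ₗᵢ[ℂ] HilbertTensor H K) :=
  UniformSpace.Completion.denseRange_coe (α := H ⊗[ℂ] K)

/-- The bounded operator `a ⊗ b` on the Hilbert space tensor product. -/
noncomputable def tensorOp (a : H →L[ℂ] H) (b : K →L[ℂ] K) :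
    HilbertTensor H K →L[ℂ] HilbertTensor H K :=
  ((TensorProduct.mapL a b).completion :
    UniformSpace.Completion (H ⊗[ℂ] K) →L[ℂ] UniformSpace.Completion (H ⊗[ℂ] K))

theorem tensorOp_tmul (a : H →L[ℂ] H) (b : K →L[ℂ] K) (ξ : H) (η : K) :
    tensorOp a b (HilbertTensor.of (ξ ⊗ₜ η)) = HilbertTensor.of (a ξ ⊗ₜ b η) :=
  UniformSpace.Completion.map_coe (TensorProduct.mapL a b).uniformContinuous (ξ ⊗ₜ η)

/-- The minimal (spatial) tensor product of two concrete C*-algebras `A ⊆ B(H)`, `B ⊆ B(K)`: the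
norm-closed *-subalgebra of `B(H ⊗ K)` generated by the operators `a ⊗ b`, `a ∈ A`, `b ∈ B`. -/
noncomputable def minTensor [CompleteSpace H] [CompleteSpace K]
    (A : NonUnitalStarSubalgebra ℂ (H →L[ℂ] H)) (B : NonUnitalStarSubalgebra ℂ (K →L[ℂ] K)) :
    NonUnitalStarSubalgebra ℂ (HilbertTensor H K →L[ℂ] HilbertTensor H K) :=
  (NonUnitalStarAlgebra.adjoin ℂ {T | ∃ a ∈ A, ∃ b ∈ B, T = tensorOp a b}).topologicalClosure

theorem tensorOp_mem_minTensor [CompleteSpace H] [CompleteSpace K]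
    {A : NonUnitalStarSubalgebra ℂ (H →L[ℂ] H)} {B : NonUnitalStarSubalgebra ℂ (K →L[ℂ] K)}
    {a : H →L[ℂ] H} {b : K →L[ℂ] K} (ha : a ∈ A) (hb : b ∈ B) : tensorOp a b ∈ minTensor A B :=
  NonUnitalStarSubalgebra.le_topologicalClosure _
    (NonUnitalStarAlgebra.subset_adjoin ℂ _ ⟨a, ha, b, hb, rfl⟩)

end SpatialTensor

section FactorizationProperty

variable (G : Type u) [Group G] [TopologicalSpace G] [IsTopologicalGroup G]
  [LocallyCompactSpace G] [MeasurableSpace G] [BorelSpace G]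

/-- The full group C*-algebra `C*(G)`, realised faithfully on the space of the universal
representation: the norm-closed *-subalgebra generated by the operators `π_u(f)`, `f ∈ C_c(G)`. -/
noncomputable def groupCStar :
    NonUnitalStarSubalgebra ℂ
      (UnitaryRep.UniversalSpace G →L[ℂ] UnitaryRep.UniversalSpace G) :=
  (NonUnitalStarAlgebra.adjoin ℂ
    (Set.range fun f : C_c(G, ℂ) => (UnitaryRep.universal G).integrated f)).topologicalClosure

variable {G} in
/-- The canonical map `C_c(G) → C*(G)`. -/
noncomputable def toGroupCStar (f : C_c(G, ℂ)) : groupCStar G :=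
  ⟨(UnitaryRep.universal G).integrated f,
    NonUnitalStarSubalgebra.le_topologicalClosure _
      (NonUnitalStarAlgebra.subset_adjoin ℂ _ ⟨f, rfl⟩)⟩

variable {G} in
/-- The elementary tensor `a ⊗ b` in `C*(G) ⊗_min C*(G)`. -/
noncomputable def elemTensor (a b : groupCStar G) : minTensor (groupCStar G) (groupCStar G) :=
  ⟨tensorOp (a : UnitaryRep.UniversalSpace G →L[ℂ] UnitaryRep.UniversalSpace G) b,
    tensorOp_mem_minTensor a.2 b.2⟩

/-- The factorization property: the representation `λ·ρ`, `(s, t) ↦ λ(s)ρ(t)`, of `G × G` on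
`L²(G)` extends to a *-representation of `C*(G) ⊗_min C*(G)`, i.e. there is a *-representation of
`C*(G) ⊗_min C*(G)` on `L²(G)` with `f ⊗ g ↦ λ(f)ρ(g)`. As the image of `C_c(G)` is dense in
`C*(G)`, this condition for `f, g ∈ C_c(G)` is the same as `a ⊗ b ↦ λ(a)ρ(b)` for all
`a, b ∈ C*(G)`. -/
def HasFactorizationProperty : Prop :=
  ∃ Φ : minTensor (groupCStar G) (groupCStar G) →⋆ₙₐ[ℂ]
      (UnitaryRep.L2 G →L[ℂ] UnitaryRep.L2 G),
    ∀ f g : C_c(G, ℂ), Φ (elemTensor (toGroupCStar f) (toGroupCStar g)) =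
      (UnitaryRep.leftRegular.integrated f).comp (UnitaryRep.rightRegular.integrated g)

end FactorizationProperty

section Amenability

/-- Amenability of a topological group: there is a left invariant mean on the space of bounded
continuous functions. -/
def IsAmenable (G : Type*) [Group G] [TopologicalSpace G] [IsTopologicalGroup G] : Prop :=
  ∃ m : (G →ᵇ ℝ) →ₗ[ℝ] ℝ, (∀ f, 0 ≤ f → 0 ≤ m f) ∧ m 1 = 1 ∧
    ∀ (s : G) (f : G →ᵇ ℝ), m (f.compContinuous (Homeomorph.mulLeft s : C(G, G))) = m f

/-- `H` is amenably embeddable: it embeds continuously (that is, by a continuous injective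
homomorphism) into an amenable locally compact Hausdorff group. -/
def AmenablyEmbeddable (H : Type u) [Group H] [TopologicalSpace H] : Prop :=
  ∃ (G' : Type v) (_ : Group G') (_ : TopologicalSpace G') (_ : IsTopologicalGroup G')
    (_ : LocallyCompactSpace G') (_ : T2Space G'),
    IsAmenable G' ∧ ∃ ι : H →* G', Continuous ι ∧ Function.Injective ι

/-- Residual amenability. -/
def ResiduallyAmenable (G : Type u) [Group G] [TopologicalSpace G] [IsTopologicalGroup G] : Prop :=
  ∀ x : G, x ≠ 1 → ∃ (N : Subgroup G) (_ : N.Normal),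
    IsClosed (N : Set G) ∧ x ∉ N ∧ IsAmenable (G ⧸ N)

/-- Residual amenable embeddability. -/
def ResiduallyAmenablyEmbeddable (G : Type u) [Group G] [TopologicalSpace G]
    [IsTopologicalGroup G] : Prop :=
  ∀ x : G, x ≠ 1 → ∃ (N : Subgroup G) (_ : N.Normal),
    IsClosed (N : Set G) ∧ x ∉ N ∧ AmenablyEmbeddable.{u, v} (G ⧸ N)

end Amenability

end FactorizationDefs

/-! The factorization property reduces to the norm estimate `‖∑ λ(fᵢ)ρ(gᵢ)‖ ≤ ‖∑ π_u(fᵢ) ⊗ π_u(gᵢ)‖`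
for finitely many `fᵢ, gᵢ ∈ C_c(G)` (`norm_sum_leftRegular_rightRegular_le`). Indeed `λ` and `ρ`
commute, so the pairs `(π_u(f) ⊗ π_u(g), λ(f)ρ(g))` span a *-algebra, and the estimate makes its
closure the graph of a *-homomorphism whose domain contains the minimal tensor product
(`exists_starHom_of_graph`).

The right-hand side dominates `‖∑ σ(fᵢ) ⊗ τ(gᵢ)‖` for all unitary representations `σ`, `τ`, because
the part of a representation generated by finitely many vectors embeds into `π_u`
(`norm_sum_tensorOp_le_universal`). It therefore suffices to find `σ`, `τ` and a vector `v` such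
that `F ↦ (σ(F) ⊗ 1)v` almost preserves the `L²`-norm of the relevant `F` and almost carries `ρ(t)`
to `1 ⊗ τ(t)` (`exists_approximating_vector`).

For `φ : G → G'` with `G'` amenable, take `σ = τ = λ_{G'} ∘ φ` and `v = ∫ w(z) λ(z)b ⊗ λ(z)e dz`. If
the coefficient `⟨e, λ(·)e⟩` is an approximate identity, then `‖(σ(F) ⊗ 1)v‖²` is close to `∫ w(z)²
‖σ(F)λ(z)b‖² dz`. If `k = ⟨b, λ(·)b⟩` has small support, then `‖σ(F)λ(z)b‖² = ∫ (F* ∗ F)(u)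
k(z⁻¹φ(u)z) du` is close to `(F* ∗ F)(1) N(z) = ‖F‖² N(z)`, where `N(z) = ∫ θ(u) k(z⁻¹φ(u)z) du` for
a cutoff `θ` equal to 1 near the identity. So one puts `w = χ/√N` with `∫ χ² = 1`. Injectivity of
`φ` is not needed: `φ(u) ≠ 1` on one compact set of `u` is enough.

Replacing `z` by `φ(t)⁻¹z` multiplies `N` by `Δ(t)`, since conjugation by `t` scales Haar measure of
`G`; this accounts exactly for the factor `Δ(t)^{1/2}` in `ρ(t)`. What remains is `χ(φ(t)⁻¹z) -
χ(z)`, which is small in `L²` by Reiter's property (`IsAmenable.exists_almost_invariant`), a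
consequence of the invariant mean by Day's convexity argument and uniqueness of Haar measure.

A compact set avoiding 1 is mapped off 1 by combining finitely many homomorphisms into a product,
which is amenable by `IsAmenable.prod`. The equivalence in the second assertion is passage between
`N` and the kernel of `φ`. -/

section FactorizationProof

open MeasureTheory MeasureTheory.Measure Filter Topology
open scoped ENNReal NNReal CompactlySupported BoundedContinuousFunction TensorProduct

/-! ### Uniqueness of the Haar functional and inversion of Haar measure -/

section HaarFunctionals

/-- Continuity is local in the parameter, so a support bound that is uniform only over compact sets
of parameters suffices. -/
theorem continuous_integral_of_locally_compact_support {X Y E : Type*} [TopologicalSpace X]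
    [WeaklyLocallyCompactSpace X] [TopologicalSpace Y] [MeasurableSpace Y]
    [OpensMeasurableSpace Y] {μ : Measure Y} [IsFiniteMeasureOnCompacts μ]
    [NormedAddCommGroup E] [NormedSpace ℝ E] {f : X → Y → E} (hf : Continuous f.uncurry)
    (hs : ∀ K : Set X, IsCompact K → ∃ k : Set Y, IsCompact k ∧ ∀ x ∈ K, ∀ y ∉ k, f x y = 0) :
    Continuous fun x => ∫ y, f x y ∂μ := by
  refine continuous_iff_continuousAt.2 fun x₀ => ?_
  obtain ⟨t, ht, hts⟩ := exists_compact_mem_nhds x₀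
  obtain ⟨k, hk, hkf⟩ := hs t ht
  have : ContinuousOn (fun x => ∫ y, f x y ∂μ) t :=
    continuousOn_integral_of_compact_support hk hf.continuousOn fun x y hx hy => hkf x hx y hy
  exact this.continuousAt hts

/-- A continuous function with compact support as a bundled map. -/
def ccOf {X E : Type*} [TopologicalSpace X] [TopologicalSpace E] [Zero E] (f : X → E)
    (hf : Continuous f) (hc : HasCompactSupport f) : C_c(X, E) := ⟨⟨f, hf⟩, hc⟩

@[simp]
theorem ccOf_apply {X E : Type*} [TopologicalSpace X] [TopologicalSpace E] [Zero E] (f : X → E)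
    (hf : Continuous f) (hc : HasCompactSupport f) (x : X) : ccOf f hf hc x = f x := rfl

variable {G : Type*} [Group G] [TopologicalSpace G] [IsTopologicalGroup G]

theorem hasCompactSupport_mul_left {E : Type*} [Zero E] {f : G → E} (hc : HasCompactSupport f)
    (a : G) : HasCompactSupport fun x => f (a * x) :=
  hc.comp_homeomorph (Homeomorph.mulLeft a)

theorem hasCompactSupport_mul_right {E : Type*} [Zero E] {f : G → E} (hc : HasCompactSupport f)
    (a : G) : HasCompactSupport fun x => f (x * a) :=
  hc.comp_homeomorph (Homeomorph.mulRight a)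

theorem hasCompactSupport_inv {E : Type*} [Zero E] {f : G → E} (hc : HasCompactSupport f) :
    HasCompactSupport fun x => f x⁻¹ :=
  hc.comp_homeomorph (Homeomorph.inv G)

/-- Left translation of compactly supported functions. -/
def leftCc {E : Type*} [TopologicalSpace E] [Zero E] (a : G) (f : C_c(G, E)) : C_c(G, E) :=
  ccOf (fun x => f (a * x)) (by fun_prop) (hasCompactSupport_mul_left f.hasCompactSupport a)

@[simp]
theorem leftCc_apply {E : Type*} [TopologicalSpace E] [Zero E] (a : G) (f : C_c(G, E)) (x : G) :
    leftCc a f x = f (a * x) := rfl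

variable [LocallyCompactSpace G]

theorem UnitaryRep.modularFn_inv (s : G) :
    UnitaryRep.modularFn s⁻¹ = (UnitaryRep.modularFn s)⁻¹ := by
  simp [UnitaryRep.modularFn]

variable [MeasurableSpace G] [BorelSpace G]

/-- Uniqueness of the Haar functional: a positive left invariant functional on `C_c(G)` is a
multiple of the Haar integral. -/
theorem exists_eq_const_mul_integral_haar [T2Space G] (J : C_c(G, ℝ) →ₗ[ℝ] ℝ)
    (hpos : ∀ f, 0 ≤ f → 0 ≤ J f) (hinv : ∀ a f, J (leftCc a f) = J f) :
    ∃ c : ℝ, ∀ f, J f = c * ∫ x, f x ∂(haar : Measure G) := by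
  let Λ : C_c(G, ℝ) →ₚ[ℝ] ℝ := PositiveLinearMap.mk₀ J hpos
  have hΛ : ∀ f, ∫ x, f x ∂(RealRMK.rieszMeasure Λ) = J f := RealRMK.integral_rieszMeasure Λ
  have hreg : (RealRMK.rieszMeasure Λ).Regular := inferInstance
  have : IsMulLeftInvariant (RealRMK.rieszMeasure Λ) := by
    refine ⟨fun a => ?_⟩
    have : (Measure.map (a * ·) (RealRMK.rieszMeasure Λ)).Regular :=
      Measure.Regular.map (Homeomorph.mulLeft a)
    refine Measure.ext_of_integral_eq_on_compactlySupported fun f => ?_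
    have h := (Homeomorph.mulLeft a).measurableEmbedding.integral_map
      (μ := RealRMK.rieszMeasure Λ) f
    simp only [Homeomorph.coe_mulLeft] at h
    rw [h, hΛ f, ← hinv a f, ← hΛ]
    rfl
  refine ⟨haarScalarFactor (RealRMK.rieszMeasure Λ) (haar : Measure G), fun f => ?_⟩
  have h := congrArg (fun ν => ∫ x, f x ∂ν)
    (isMulLeftInvariant_eq_smul_of_regular (RealRMK.rieszMeasure Λ) (haar : Measure G))
  simp only [integral_smul_nnreal_measure] at h
  rw [← hΛ f, h]
  simp [NNReal.smul_def]

open UnitaryRep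

theorem integral_mul_right_haar_real (f : G → ℝ) (s : G) :
    ∫ x, f (x * s) ∂(haar : Measure G) = (modularFn s)⁻¹ * ∫ x, f x ∂(haar : Measure G) := by
  have h := integral_mul_right_haar (fun x => (f x : ℂ)) s
  simp only [integral_complex_ofReal] at h
  rw [Complex.real_smul] at h
  exact_mod_cast h

/-- The inversion on `C_c(G)` preserving the Haar integral. -/
noncomputable def invCc (f : C_c(G, ℝ)) : C_c(G, ℝ) :=
  ccOf (fun x => (modularFn x)⁻¹ * f x⁻¹)
    ((continuous_modularFn.inv₀ fun x => (modularFn_pos x).ne').mul (by fun_prop))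
    (hasCompactSupport_inv f.hasCompactSupport).mul_left

@[simp]
theorem invCc_apply (f : C_c(G, ℝ)) (x : G) : invCc f x = (modularFn x)⁻¹ * f x⁻¹ := rfl

theorem invCc_invCc (f : C_c(G, ℝ)) : invCc (invCc f) = f := by
  ext x
  have := (modularFn_pos x).ne'
  simp [modularFn_inv]
  field_simp

theorem integral_cc_add (f g : C_c(G, ℝ)) : ∫ x, (f + g) x ∂(haar : Measure G) =
    ∫ x, f x ∂(haar : Measure G) + ∫ x, g x ∂(haar : Measure G) :=
  integral_add f.integrable g.integrable

variable (G) in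
theorem exists_cc_integral_pos : ∃ g : C_c(G, ℝ), 0 ≤ g ∧ 0 < ∫ x, g x ∂(haar : Measure G) := by
  obtain ⟨⟨f, f_cont⟩, f_comp, f_nonneg, f_one⟩ :
    ∃ f : C(G, ℝ), HasCompactSupport f ∧ 0 ≤ f ∧ f 1 ≠ 0 := exists_continuous_nonneg_pos 1
  exact ⟨ccOf f f_cont f_comp, f_nonneg,
    f_cont.integral_pos_of_hasCompactSupport_nonneg_nonzero f_comp f_nonneg f_one⟩

/-- The functional `f ↦ ∫ invCc f` is positive and left invariant, hence `c` times the Haar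
integral. As `invCc` is an involution, `c² = 1`, and positivity selects `c = 1`. -/
theorem integral_invCc [T2Space G] (f : C_c(G, ℝ)) :
    ∫ x, invCc f x ∂(haar : Measure G) = ∫ x, f x ∂(haar : Measure G) := by
  let J : C_c(G, ℝ) →ₗ[ℝ] ℝ :=
    { toFun := fun f => ∫ x, invCc f x ∂(haar : Measure G)
      map_add' := fun f g => by
        rw [← integral_cc_add]
        congr 1; ext x
        simp [mul_add]
      map_smul' := fun c f => by
        simp only [RingHom.id_apply, smul_eq_mul]
        rw [← integral_const_mul]
        congr 1; ext x
        simp [mul_left_comm] }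
  obtain ⟨c, hc⟩ := exists_eq_const_mul_integral_haar J
    (fun f hf => integral_nonneg fun x => mul_nonneg (inv_nonneg.2 (modularFn_pos x).le) (hf _))
    (fun a f => by
      change ∫ x, invCc (leftCc a f) x ∂(haar : Measure G) = ∫ x, invCc f x ∂(haar : Measure G)
      have h := integral_mul_right_haar_real (invCc f) a⁻¹
      have ha := (modularFn_pos a).ne'
      rw [modularFn_inv, inv_inv] at h
      have e : ∫ x, invCc (leftCc a f) x ∂(haar : Measure G) =
          (modularFn a)⁻¹ * ∫ x, invCc f (x * a⁻¹) ∂(haar : Measure G) := by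
        rw [← integral_const_mul]
        congr 1; ext x
        simp [modularFn_mul, modularFn_inv]
        field_simp
      rw [e, h]
      field_simp)
  obtain ⟨g, hg, hgpos⟩ := exists_cc_integral_pos G
  have hJ : ∀ f, J (invCc f) = ∫ x, f x ∂(haar : Measure G) := fun f => by
    change ∫ x, invCc (invCc f) x ∂(haar : Measure G) = _
    rw [invCc_invCc]
  have hJ' : ∀ f, J f = ∫ x, invCc f x ∂(haar : Measure G) := fun f => rfl
  have h0 : 0 ≤ J g :=
    integral_nonneg fun x => mul_nonneg (inv_nonneg.2 (modularFn_pos x).le) (hg _)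
  have h1 := hc g
  have h2 := hc (invCc g)
  rw [hJ, ← hJ', h1] at h2
  have hcc : c * c = 1 := by
    have : (c * c - 1) * ∫ x, g x ∂(haar : Measure G) = 0 := by linarith
    rcases mul_eq_zero.1 this with h | h
    · linarith
    · exact absurd h hgpos.ne'
  have hc0 : 0 ≤ c := by
    by_contra hneg
    push Not at hneg
    have := mul_neg_of_neg_of_pos hneg hgpos
    linarith
  have hc1 : c = 1 := by nlinarith
  rw [← hJ' f, hc f, hc1, one_mul]

end HaarFunctionals

/-! ### Reiter's property from an invariant mean -/

section Reiter

open UnitaryRep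
open scoped Pointwise

variable {G : Type*} [Group G] [TopologicalSpace G] [IsTopologicalGroup G]

@[simp]
theorem leftCc_add (a : G) (f g : C_c(G, ℝ)) : leftCc a (f + g) = leftCc a f + leftCc a g := rfl

@[simp]
theorem leftCc_smul (a : G) (c : ℝ) (f : C_c(G, ℝ)) : leftCc a (c • f) = c • leftCc a f := rfl

variable [LocallyCompactSpace G]

/-- Right translation of compactly supported functions, normalised to preserve the Haar
integral. -/
noncomputable def rightCc (y : G) (f : C_c(G, ℝ)) : C_c(G, ℝ) :=
  ccOf (fun x => (modularFn y)⁻¹ * f (x * y⁻¹)) (by fun_prop)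
    (hasCompactSupport_mul_right f.hasCompactSupport y⁻¹).mul_left

@[simp]
theorem rightCc_apply (y : G) (f : C_c(G, ℝ)) (x : G) :
    rightCc y f x = (modularFn y)⁻¹ * f (x * y⁻¹) := rfl

theorem rightCc_add (a : G) (f g : C_c(G, ℝ)) : rightCc a (f + g) = rightCc a f + rightCc a g := by
  ext x; simp [mul_add]

theorem rightCc_sub (a : G) (f g : C_c(G, ℝ)) : rightCc a (f - g) = rightCc a f - rightCc a g := by
  ext x; simp [mul_sub]

theorem rightCc_smul (a : G) (c : ℝ) (f : C_c(G, ℝ)) : rightCc a (c • f) = c • rightCc a f := by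
  ext x; simp [mul_left_comm]

theorem leftCc_rightCc (a y : G) (f : C_c(G, ℝ)) :
    leftCc a (rightCc y f) = rightCc y (leftCc a f) := by
  ext x; simp [mul_assoc]

/-- The reversed order `y * a` is what lets a left invariant mean in the parameter of `rightCc`
produce a functional invariant under right translation. -/
theorem rightCc_rightCc (a y : G) (f : C_c(G, ℝ)) :
    rightCc a (rightCc y f) = rightCc (y * a) f := by
  ext x; simp [mul_assoc, modularFn_mul]

variable [MeasurableSpace G] [BorelSpace G]

theorem integral_leftCc (a : G) (f : C_c(G, ℝ)) :
    ∫ x, leftCc a f x ∂(haar : Measure G) = ∫ x, f x ∂(haar : Measure G) :=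
  integral_mul_left_eq_self (fun x => f x) a

/-- Positive homogeneity of `F` covers both the integral (`F = id`) and the `L¹`-norm (`F = |·|`).
-/
theorem integral_rightCc_comp (F : ℝ → ℝ) (hF : ∀ c : ℝ, 0 < c → ∀ x, F (c * x) = c * F x) (y : G)
    (f : C_c(G, ℝ)) :
    ∫ x, F (rightCc y f x) ∂(haar : Measure G) = ∫ x, F (f x) ∂(haar : Measure G) := by
  simp only [rightCc_apply]
  simp_rw [hF _ (inv_pos.2 (modularFn_pos y))]
  rw [integral_const_mul, integral_mul_right_haar_real (fun x => F (f x)), modularFn_inv, inv_inv]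
  have := (modularFn_pos y).ne'
  field_simp

theorem integral_rightCc (y : G) (f : C_c(G, ℝ)) :
    ∫ x, rightCc y f x ∂(haar : Measure G) = ∫ x, f x ∂(haar : Measure G) :=
  integral_rightCc_comp id (fun _ _ _ => rfl) y f

/-- Conjugation by `invCc` turns right invariance into left invariance, and adding `C` times the
Haar integral makes an `L¹`-bounded functional positive. Uniqueness of the positive left invariant
functional then applies. -/
theorem exists_eq_const_mul_integral_of_right [T2Space G] (J : C_c(G, ℝ) →ₗ[ℝ] ℝ) (C : ℝ)
    (hb : ∀ f, |J f| ≤ C * ∫ x, |f x| ∂(haar : Measure G)) (hinv : ∀ a f, J (rightCc a f) = J f) :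
    ∃ c : ℝ, ∀ f, J f = c * ∫ x, f x ∂(haar : Measure G) := by
  let J' : C_c(G, ℝ) →ₗ[ℝ] ℝ :=
    { toFun := fun f => C * (∫ x, invCc f x ∂(haar : Measure G)) + J (invCc f)
      map_add' := fun f g => by
        have : invCc (f + g) = invCc f + invCc g := by ext x; simp [mul_add]
        rw [this, integral_cc_add, map_add]
        ring
      map_smul' := fun c f => by
        have : invCc (c • f) = c • invCc f := by ext x; simp [mul_left_comm]
        rw [this, map_smul]
        simp only [CompactlySupportedContinuousMap.coe_smul, Pi.smul_apply, smul_eq_mul,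
          RingHom.id_apply, integral_const_mul]
        ring }
  have hJ' : ∀ f, J' f = C * (∫ x, invCc f x ∂(haar : Measure G)) + J (invCc f) := fun f => rfl
  obtain ⟨c, hc⟩ := exists_eq_const_mul_integral_haar J'
    (fun f hf => by
      have h := hb (invCc f)
      have hi : ∀ x, 0 ≤ invCc f x := fun x => mul_nonneg (inv_nonneg.2 (modularFn_pos x).le) (hf _)
      simp only [abs_of_nonneg (hi _)] at h
      have := (abs_le.1 h).1
      rw [hJ']
      linarith)
    (fun a f => by
      have e : invCc (leftCc a f) = rightCc a (invCc f) := by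
        ext x
        have ha := (modularFn_pos a).ne'
        simp [modularFn_mul, modularFn_inv]
        field_simp
      rw [hJ', hJ', e, integral_rightCc, hinv])
  refine ⟨c - C, fun f => ?_⟩
  have h1 := hc (invCc f)
  rw [hJ', invCc_invCc, integral_invCc] at h1
  linarith

variable (G) in
/-- The inclusion of `C_c(G)` in `L¹(G)`. -/
noncomputable def ccL1 : C_c(G, ℝ) →ₗ[ℝ] Lp ℝ 1 (haar : Measure G) where
  toFun f := (f.continuous.memLp_of_hasCompactSupport f.hasCompactSupport : MemLp f 1 haar).toLp f
  map_add' f g := by rw [← MemLp.toLp_add]; rfl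
  map_smul' c f := by rw [RingHom.id_apply, ← MemLp.toLp_const_smul]; rfl

theorem norm_ccL1 (f : C_c(G, ℝ)) : ‖ccL1 G f‖ = ∫ x, |f x| ∂(haar : Measure G) := by
  have hm : MemLp f 1 (haar : Measure G) :=
    f.continuous.memLp_of_hasCompactSupport f.hasCompactSupport
  rw [L1.norm_eq_integral_norm]
  refine integral_congr_ae ?_
  filter_upwards [hm.coeFn_toLp] with x hx
  rw [← Real.norm_eq_abs, ← hx]
  rfl

theorem norm_ccL1_rightCc (y : G) (f : C_c(G, ℝ)) : ‖ccL1 G (rightCc y f)‖ = ‖ccL1 G f‖ := by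
  rw [norm_ccL1, norm_ccL1]
  exact integral_rightCc_comp (fun x => |x|) (fun c hc x => by rw [abs_mul, abs_of_pos hc]) y f

theorem continuous_ccL1_of_forall {X : Type*} [TopologicalSpace X] [WeaklyLocallyCompactSpace X]
    (F : X → C_c(G, ℝ)) (hF : Continuous fun p : X × G => F p.1 p.2)
    (hs : ∀ K : Set X, IsCompact K → ∃ k : Set G, IsCompact k ∧ ∀ x ∈ K, ∀ y ∉ k, F x y = 0) :
    Continuous fun x => ccL1 G (F x) := by
  refine continuous_iff_continuousAt.2 fun x₀ => ?_
  rw [ContinuousAt, tendsto_iff_norm_sub_tendsto_zero]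
  have e : ∀ x, ‖ccL1 G (F x) - ccL1 G (F x₀)‖ = ∫ y, |F x y - F x₀ y| ∂(haar : Measure G) := by
    intro x
    rw [← map_sub, norm_ccL1]
    rfl
  simp only [e]
  have hc : Continuous fun x => ∫ y, |F x y - F x₀ y| ∂(haar : Measure G) := by
    refine continuous_integral_of_locally_compact_support (f := fun x y => |F x y - F x₀ y|)
      ?_ fun K hK => ?_
    · have h2 : Continuous fun p : X × G => F x₀ p.2 := by fun_prop
      exact (hF.sub h2).abs
    · obtain ⟨k, hk, hkF⟩ := hs K hK
      refine ⟨k ∪ tsupport (F x₀), hk.union (F x₀).hasCompactSupport, fun x hx y hy => ?_⟩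
      rw [Set.mem_union, not_or] at hy
      simp [hkF x hx y hy.1, image_eq_zero_of_notMem_tsupport hy.2]
  simpa using hc.tendsto x₀

theorem continuous_ccL1_rightCc (f : C_c(G, ℝ)) : Continuous fun y => ccL1 G (rightCc y f) := by
  refine continuous_ccL1_of_forall _ ?_ fun K hK => ?_
  · have := (continuous_modularFn (G := G)).inv₀ fun x => (modularFn_pos x).ne'
    simp only [rightCc_apply]
    exact (this.comp continuous_fst).mul (by fun_prop)
  · refine ⟨tsupport f * K, f.hasCompactSupport.isCompact.mul hK, fun y hy x hx => ?_⟩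
    rw [rightCc_apply, image_eq_zero_of_notMem_tsupport (f := f), mul_zero]
    exact fun h => hx ⟨_, h, y, hy, by simp⟩

theorem continuous_ccL1_leftCc (f : C_c(G, ℝ)) : Continuous fun y => ccL1 G (leftCc y f) := by
  refine continuous_ccL1_of_forall _ (by simp only [leftCc_apply]; fun_prop) fun K hK => ?_
  refine ⟨K⁻¹ * tsupport f, hK.inv.mul f.hasCompactSupport.isCompact, fun y hy x hx => ?_⟩
  rw [leftCc_apply, image_eq_zero_of_notMem_tsupport (f := f)]
  exact fun h => hx ⟨y⁻¹, Set.inv_mem_inv.2 hy, _, h, by simp⟩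

/-- For an amenable group, convex combinations of right translates of a given density can be made
almost invariant under finitely many left translations. -/
theorem exists_convexHull_almost_invariant [T2Space G] (hG : IsAmenable G) (h : C_c(G, ℝ)) {n : ℕ}
    (a : Fin n → G) {ε : ℝ} (hε : 0 < ε) :
    ∃ f ∈ convexHull ℝ (Set.range fun y => rightCc y h),
      ∀ i, ‖ccL1 G (leftCc (a i) f - f)‖ < ε := by
  obtain ⟨m, mpos, m1, minv⟩ := hG
  let T : C_c(G, ℝ) →ₗ[ℝ] (Fin n → Lp ℝ 1 (haar : Measure G)) :=
    { toFun := fun f i => ccL1 G (leftCc (a i) f - f)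
      map_add' := fun f g => by
        ext1 i
        simp only [leftCc_add, Pi.add_apply, ← map_add]
        congr 1
        abel
      map_smul' := fun c f => by
        ext1 i
        rw [leftCc_smul, ← smul_sub (M := ℝ) (A := C_c(G, ℝ)) c, map_smul]
        rfl }
  -- Day's argument: if every `f` fails, the open `ε`-ball misses the convex image under `T`, and
  -- Hahn–Banach separates the two.
  by_contra! hcon
  have hdisj : Disjoint (Metric.ball (0 : Fin n → Lp ℝ 1 (haar : Measure G)) ε)
      (T '' convexHull ℝ (Set.range fun y => rightCc y h)) := by
    rw [Set.disjoint_right]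
    rintro _ ⟨f, hf, rfl⟩ hb
    obtain ⟨i, hi⟩ := hcon f hf
    rw [mem_ball_zero_iff] at hb
    exact absurd ((norm_le_pi_norm (T f) i).trans_lt hb) (not_lt.2 hi)
  obtain ⟨φ, u, h1, h2⟩ := geometric_hahn_banach_open (convex_ball _ _) Metric.isOpen_ball
    ((convex_convexHull ℝ _).linear_image T) hdisj
  have hu : 0 < u := by simpa using h1 0 (Metric.mem_ball_self hε)
  let ψ (i : Fin n) : Lp ℝ 1 (haar : Measure G) →L[ℝ] ℝ :=
    φ.comp (ContinuousLinearMap.single ℝ (fun _ => Lp ℝ 1 (haar : Measure G)) i)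
  have hφ : ∀ v, φ v = ∑ i, ψ i (v i) := fun v => by
    conv_lhs => rw [← Finset.univ_sum_single v]
    rw [_root_.map_sum]
    rfl
  let Ψ (i : Fin n) (f : C_c(G, ℝ)) : G →ᵇ ℝ :=
    BoundedContinuousFunction.ofNormedAddCommGroup (fun y => ψ i (ccL1 G (rightCc y f)))
      ((ψ i).continuous.comp (continuous_ccL1_rightCc f)) (‖ψ i‖ * ‖ccL1 G f‖)
      (fun y => ((ψ i).le_opNorm _).trans_eq (by rw [norm_ccL1_rightCc]))
  have hΨ : ∀ i f y, Ψ i f y = ψ i (ccL1 G (rightCc y f)) := fun _ _ _ => rfl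
  have mmono : ∀ f g : G →ᵇ ℝ, f ≤ g → m f ≤ m g := fun f g hfg => by
    have := mpos (g - f) (sub_nonneg.2 hfg)
    rw [map_sub] at this
    linarith
  let J (i : Fin n) : C_c(G, ℝ) →ₗ[ℝ] ℝ :=
    { toFun := fun f => m (Ψ i f)
      map_add' := fun f g => by
        rw [← map_add]
        congr 1; ext y
        simp [hΨ, rightCc_add]
      map_smul' := fun c f => by
        rw [RingHom.id_apply, ← map_smul]
        congr 1; ext y
        simp [hΨ, rightCc_smul] }
  have hJ : ∀ i f, J i f = m (Ψ i f) := fun _ _ => rfl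
  -- Averaging `ψ i` over right translates with the mean gives an `L¹`-bounded right invariant
  -- functional. It is a multiple of the Haar integral, hence also blind to left translation.
  have hJinv : ∀ i, J i (leftCc (a i) h) = J i h := by
    intro i
    obtain ⟨c, hc⟩ := exists_eq_const_mul_integral_of_right (J i) ‖ψ i‖
      (fun f => by
        rw [← norm_ccL1, hJ]
        have hb : ∀ y, |Ψ i f y| ≤ ‖ψ i‖ * ‖ccL1 G f‖ := fun y =>
          ((ψ i).le_opNorm _).trans_eq (by rw [norm_ccL1_rightCc])
        rw [abs_le]
        constructor
        · have := mmono ((-(‖ψ i‖ * ‖ccL1 G f‖)) • 1) (Ψ i f)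
            (fun y => by simpa using (abs_le.1 (hb y)).1)
          rwa [map_smul, m1, smul_eq_mul, mul_one] at this
        · have := mmono (Ψ i f) ((‖ψ i‖ * ‖ccL1 G f‖) • 1)
            (fun y => by simpa using (abs_le.1 (hb y)).2)
          rwa [map_smul, m1, smul_eq_mul, mul_one] at this)
      (fun r f => by
        rw [hJ, hJ, ← minv r (Ψ i f)]
        congr 1; ext y
        change Ψ i _ y = Ψ i f (r * y)
        rw [hΨ, hΨ, rightCc_rightCc])
    rw [hc, hc, integral_leftCc]
  -- The separation inequality at all right translates of `h` at once. Its right-hand side has mean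
  -- 0 by `hJinv`, while `u > 0`.
  have key : (u • 1 : G →ᵇ ℝ) ≤ ∑ i, (Ψ i (leftCc (a i) h) - Ψ i h) := by
    intro y
    have := h2 (T (rightCc y h)) ⟨_, subset_convexHull ℝ _ ⟨y, rfl⟩, rfl⟩
    rw [hφ] at this
    change (u • 1 : G →ᵇ ℝ) y ≤ (∑ i, (Ψ i (leftCc (a i) h) - Ψ i h) : G →ᵇ ℝ) y
    rw [BoundedContinuousFunction.coe_sum, Finset.sum_apply]
    refine le_trans (le_of_eq ?_) (this.trans (le_of_eq ?_))
    · simp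
    · refine Finset.sum_congr rfl fun i _ => ?_
      change ψ i (ccL1 G _) = Ψ i (leftCc (a i) h) y - Ψ i h y
      rw [hΨ, hΨ, ← map_sub, ← map_sub, leftCc_rightCc]
  have := mmono _ _ key
  rw [map_smul, m1, _root_.map_sum, smul_eq_mul, mul_one] at this
  have h0 : ∑ i, m (Ψ i (leftCc (a i) h) - Ψ i h) = 0 :=
    Finset.sum_eq_zero fun i _ => by rw [map_sub, ← hJ, ← hJ, hJinv, sub_self]
  linarith

/-- Reiter's property `(P₂)` for amenable groups. -/
theorem IsAmenable.exists_almost_invariant [T2Space G] (hG : IsAmenable G) {S : Set G}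
    (hS : IsCompact S) {ε : ℝ} (hε : 0 < ε) :
    ∃ χ : C_c(G, ℝ), ∫ z, χ z ^ 2 ∂(haar : Measure G) = 1 ∧
      ∀ a ∈ S, ∫ z, (χ (a * z) - χ z) ^ 2 ∂(haar : Measure G) ≤ ε := by
  obtain ⟨g, hg, hgpos⟩ := exists_cc_integral_pos G
  set h : C_c(G, ℝ) := (∫ x, g x ∂(haar : Measure G))⁻¹ • g with hdef
  have h0 : ∀ x, 0 ≤ h x := fun x => mul_nonneg (inv_nonneg.2 hgpos.le) (hg x)
  have h1 : ∫ x, h x ∂(haar : Measure G) = 1 := by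
    simp only [hdef, CompactlySupportedContinuousMap.coe_smul, Pi.smul_apply, smul_eq_mul,
      integral_const_mul]
    exact inv_mul_cancel₀ hgpos.ne'
  -- Finitely many translations, an `ε/2`-net of `S` for the orbit of `h`, are to control all of
  -- `S`.
  have hcov : ∀ x ∈ S, {a | ‖ccL1 G (leftCc a h) - ccL1 G (leftCc x h)‖ < ε / 2} ∈ 𝓝[S] x := by
    intro x _
    refine mem_nhdsWithin_of_mem_nhds ?_
    have := Metric.continuous_iff'.1 (continuous_ccL1_leftCc h) x (ε / 2) (half_pos hε)
    simp only [dist_eq_norm] at this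
    exact this
  obtain ⟨t, htS, ht⟩ := hS.elim_nhdsWithin_subcover _ hcov
  obtain ⟨f, hf, hfa⟩ := exists_convexHull_almost_invariant hG h
    (fun i => (t.equivFin.symm i : G)) (half_pos hε)
  have hfa' : ∀ b ∈ t, ‖ccL1 G (leftCc b f - f)‖ < ε / 2 := fun b hb => by
    simpa using hfa (t.equivFin ⟨b, hb⟩)
  have f0 : ∀ x, 0 ≤ f x := by
    have : convexHull ℝ (Set.range fun y => rightCc y h) ⊆ {f : C_c(G, ℝ) | ∀ x, 0 ≤ f x} := by
      refine convexHull_min ?_ ?_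
      · rintro _ ⟨y, rfl⟩ x
        exact mul_nonneg (inv_nonneg.2 (modularFn_pos y).le) (h0 _)
      · intro p hp q hq α β hα hβ _ x
        exact add_nonneg (mul_nonneg hα (hp x)) (mul_nonneg hβ (hq x))
    exact this hf
  have f1 : ∫ x, f x ∂(haar : Measure G) = 1 := by
    have : convexHull ℝ (Set.range fun y => rightCc y h) ⊆
        {f : C_c(G, ℝ) | ∫ x, f x ∂(haar : Measure G) = 1} := by
      refine convexHull_min ?_ ?_
      · rintro _ ⟨y, rfl⟩
        exact (integral_rightCc y h).trans h1
      · intro p hp q hq α β hα hβ hαβ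
        simp only [Set.mem_ofPred_eq] at hp hq ⊢
        rw [integral_cc_add]
        simp only [CompactlySupportedContinuousMap.coe_smul, Pi.smul_apply, smul_eq_mul,
          integral_const_mul, hp, hq]
        linarith
    exact this hf
  -- Right translations are isometric in `L¹` and commute with left ones, so `f` inherits the
  -- modulus of continuity of `h`. Hence the net chosen for `h` also serves `f`, although `f` is
  -- found later.
  have fe : ∀ a b : G, ‖ccL1 G (leftCc a f) - ccL1 G (leftCc b f)‖ ≤
      ‖ccL1 G (leftCc a h) - ccL1 G (leftCc b h)‖ := by
    intro a b
    have : convexHull ℝ (Set.range fun y => rightCc y h) ⊆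
        {f : C_c(G, ℝ) | ‖ccL1 G (leftCc a f) - ccL1 G (leftCc b f)‖ ≤
          ‖ccL1 G (leftCc a h) - ccL1 G (leftCc b h)‖} := by
      refine convexHull_min ?_ ?_
      · rintro _ ⟨y, rfl⟩
        simp only [Set.mem_ofPred_eq, leftCc_rightCc]
        rw [← map_sub, ← map_sub, ← rightCc_sub, norm_ccL1_rightCc]
      · intro p hp q hq α β hα hβ hαβ
        simp only [Set.mem_ofPred_eq, leftCc_add, leftCc_smul, map_add, map_smul] at hp hq ⊢
        rw [add_sub_add_comm, ← smul_sub, ← smul_sub]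
        refine (norm_add_le _ _).trans ?_
        rw [norm_smul, norm_smul, Real.norm_of_nonneg hα, Real.norm_of_nonneg hβ]
        calc _ ≤ α * ‖ccL1 G (leftCc a h) - ccL1 G (leftCc b h)‖ +
              β * ‖ccL1 G (leftCc a h) - ccL1 G (leftCc b h)‖ := by gcongr
          _ = _ := by rw [← add_mul, hαβ, one_mul]
    exact this hf
  have fa : ∀ a ∈ S, ∫ z, |f (a * z) - f z| ∂(haar : Measure G) ≤ ε := by
    intro a ha
    obtain ⟨b, hb, hab⟩ := Set.mem_iUnion₂.1 (ht ha)
    have e : ∫ z, |f (a * z) - f z| ∂(haar : Measure G) = ‖ccL1 G (leftCc a f) - ccL1 G f‖ := by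
      rw [← map_sub, norm_ccL1]; rfl
    have h3 := hfa' b hb
    rw [map_sub] at h3
    have h4 : ‖ccL1 G (leftCc a h) - ccL1 G (leftCc b h)‖ < ε / 2 := hab
    have := norm_sub_le_norm_sub_add_norm_sub (ccL1 G (leftCc a f)) (ccL1 G (leftCc b f)) (ccL1 G f)
    rw [e]
    linarith [fe a b]
  -- Passing from `L¹` to `L²` uses `(√x - √y)² ≤ |x - y|`.
  refine ⟨ccOf (fun x => √(f x)) (by fun_prop)
    (f.hasCompactSupport.comp_left Real.sqrt_zero), ?_, fun a ha => ?_⟩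
  · simp only [ccOf_apply, Real.sq_sqrt (f0 _)]
    exact f1
  · refine le_trans (integral_mono_of_nonneg (ae_of_all _ fun z => sq_nonneg _) ?_
      (ae_of_all _ fun z => ?_)) (fa a ha)
    · exact ((leftCc a f - f).integrable (μ := (haar : Measure G))).abs
    · simp only [ccOf_apply]
      have h1 := Real.sq_sqrt (f0 (a * z))
      have h2 := Real.sq_sqrt (f0 z)
      have h3 := Real.sqrt_nonneg (f (a * z))
      have h4 := Real.sqrt_nonneg (f z)
      rcases le_total (√(f z)) (√(f (a * z))) with h5 | h5
      · refine le_trans ?_ (le_abs_self _)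
        nlinarith
      · refine le_trans ?_ (neg_abs_le _ |> neg_le.1)
        nlinarith

end Reiter

/-! ### Amenability of products -/

section ProductAmenable

open UnitaryRep
open scoped Pointwise

/-- Adding `C` times the Haar integral makes the functional positive without affecting left
invariance. -/
theorem exists_eq_const_mul_integral_of_left {G : Type*} [Group G] [TopologicalSpace G]
    [IsTopologicalGroup G] [LocallyCompactSpace G] [MeasurableSpace G] [BorelSpace G] [T2Space G]
    (J : C_c(G, ℝ) →ₗ[ℝ] ℝ) (C : ℝ) (hb : ∀ f, |J f| ≤ C * ∫ x, |f x| ∂(haar : Measure G))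
    (hinv : ∀ a f, J (leftCc a f) = J f) :
    ∃ c : ℝ, ∀ f, J f = c * ∫ x, f x ∂(haar : Measure G) := by
  let J' : C_c(G, ℝ) →ₗ[ℝ] ℝ :=
    { toFun := fun f => C * (∫ x, f x ∂(haar : Measure G)) + J f
      map_add' := fun f g => by
        rw [integral_cc_add, map_add]
        ring
      map_smul' := fun c f => by
        rw [map_smul]
        simp only [CompactlySupportedContinuousMap.coe_smul, Pi.smul_apply, smul_eq_mul,
          RingHom.id_apply, integral_const_mul]
        ring }
  have hJ' : ∀ f, J' f = C * (∫ x, f x ∂(haar : Measure G)) + J f := fun f => rfl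
  obtain ⟨c, hc⟩ := exists_eq_const_mul_integral_haar J'
    (fun f hf => by
      have h := hb f
      have hf' : ∀ x, 0 ≤ f x := hf
      simp only [abs_of_nonneg (hf' _)] at h
      have := (abs_le.1 h).1
      rw [hJ']
      linarith)
    (fun a f => by rw [hJ', hJ', integral_leftCc, hinv])
  refine ⟨c - C, fun f => ?_⟩
  have h1 := hc f
  rw [hJ'] at h1
  linarith

theorem abs_mean_le {X : Type*} [TopologicalSpace X] {m : (X →ᵇ ℝ) →ₗ[ℝ] ℝ}
    (mpos : ∀ f, 0 ≤ f → 0 ≤ m f) (m1 : m 1 = 1) {f : X →ᵇ ℝ} {C : ℝ} (h : ∀ x, |f x| ≤ C) :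
    |m f| ≤ C := by
  have h1 := mpos (C • 1 - f) fun x => by simpa using (abs_le.1 (h x)).2
  have h2 := mpos (f - (-C) • 1) fun x => by
    simpa [neg_le_iff_add_nonneg] using (abs_le.1 (h x)).1
  rw [map_sub, map_smul, m1, smul_eq_mul] at h1 h2
  rw [abs_le]
  constructor <;> linarith

variable {G₁ G₂ : Type*} [Group G₁] [TopologicalSpace G₁] [IsTopologicalGroup G₁]
  [LocallyCompactSpace G₁] [MeasurableSpace G₁] [BorelSpace G₁] [TopologicalSpace G₂]

theorem abs_integral_mul_le {h : C_c(G₁, ℝ)} {f : (G₁ × G₂) →ᵇ ℝ} (y : G₂) :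
    |∫ s, h s * f (s⁻¹, y) ∂(haar : Measure G₁)| ≤ ‖f‖ * ‖ccL1 G₁ h‖ := by
  rw [norm_ccL1, ← integral_const_mul]
  refine abs_integral_le_integral_abs.trans ?_
  refine integral_mono_of_nonneg (ae_of_all _ fun s => abs_nonneg _)
    (h.integrable.abs.const_mul _) (ae_of_all _ fun s => ?_)
  change |_ * _| ≤ _
  rw [abs_mul, mul_comm]
  exact mul_le_mul_of_nonneg_right (f.norm_coe_le_norm _) (abs_nonneg _)

theorem integrable_cc_mul_bcf (h : C_c(G₁, ℝ)) (f : (G₁ × G₂) →ᵇ ℝ) (y : G₂) :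
    Integrable (fun s => h s * f (s⁻¹, y)) (haar : Measure G₁) :=
  (by fun_prop : Continuous fun s => h s * f (s⁻¹, y)).integrable_of_hasCompactSupport
    h.hasCompactSupport.mul_right

theorem norm_ccL1_leftCc (x : G₁) (h : C_c(G₁, ℝ)) : ‖ccL1 G₁ (leftCc x h)‖ = ‖ccL1 G₁ h‖ := by
  rw [norm_ccL1, norm_ccL1]
  exact integral_mul_left_eq_self (fun s => |h s|) x

variable [LocallyCompactSpace G₂]

/-- The function `y ↦ ∫ h(s) f(s⁻¹, y) ds`. -/
noncomputable def smearFst (h : C_c(G₁, ℝ)) (f : (G₁ × G₂) →ᵇ ℝ) : G₂ →ᵇ ℝ :=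
  BoundedContinuousFunction.ofNormedAddCommGroup
    (fun y => ∫ s, h s * f (s⁻¹, y) ∂(haar : Measure G₁))
    (continuous_integral_of_locally_compact_support
      (f := fun (y : G₂) (s : G₁) => h s * f (s⁻¹, y)) (by fun_prop)
      fun _ _ => ⟨tsupport h, h.hasCompactSupport, fun y _ s hs => by
        rw [image_eq_zero_of_notMem_tsupport hs, zero_mul]⟩)
    (‖f‖ * ‖ccL1 G₁ h‖) (fun y => abs_integral_mul_le y)

theorem smearFst_apply (h : C_c(G₁, ℝ)) (f : (G₁ × G₂) →ᵇ ℝ) (y : G₂) :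
    smearFst h f y = ∫ s, h s * f (s⁻¹, y) ∂(haar : Measure G₁) := rfl

theorem smearFst_add_left (h k : C_c(G₁, ℝ)) (f : (G₁ × G₂) →ᵇ ℝ) :
    smearFst (h + k) f = smearFst h f + smearFst k f := by
  ext y
  simp only [BoundedContinuousFunction.coe_add, Pi.add_apply, smearFst_apply]
  rw [← integral_add (integrable_cc_mul_bcf h f y) (integrable_cc_mul_bcf k f y)]
  congr 1; ext s
  simp [add_mul]

theorem smearFst_smul_left (c : ℝ) (h : C_c(G₁, ℝ)) (f : (G₁ × G₂) →ᵇ ℝ) :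
    smearFst (c • h) f = c • smearFst h f := by
  ext y
  simp only [BoundedContinuousFunction.coe_smul, smul_eq_mul, smearFst_apply]
  rw [← integral_const_mul]
  congr 1; ext s
  simp [mul_assoc]

theorem smearFst_add_right (h : C_c(G₁, ℝ)) (f g : (G₁ × G₂) →ᵇ ℝ) :
    smearFst h (f + g) = smearFst h f + smearFst h g := by
  ext y
  simp only [BoundedContinuousFunction.coe_add, Pi.add_apply, smearFst_apply]
  rw [← integral_add (integrable_cc_mul_bcf h f y) (integrable_cc_mul_bcf h g y)]
  congr 1; ext s
  simp [mul_add]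

theorem smearFst_smul_right (c : ℝ) (h : C_c(G₁, ℝ)) (f : (G₁ × G₂) →ᵇ ℝ) :
    smearFst h (c • f) = c • smearFst h f := by
  ext y
  simp only [BoundedContinuousFunction.coe_smul, smul_eq_mul, smearFst_apply]
  rw [← integral_const_mul]
  congr 1; ext s
  simp [mul_left_comm]

theorem smearFst_sub_left (h k : C_c(G₁, ℝ)) (f : (G₁ × G₂) →ᵇ ℝ) :
    smearFst (h - k) f = smearFst h f - smearFst k f := by
  rw [eq_sub_iff_add_eq, ← smearFst_add_left, sub_add_cancel]

/-- The function `x ↦ m(y ↦ ∫ h(x s) f(s⁻¹, y) ds)` for a mean `m` on the second factor. -/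
noncomputable def smearMean {m : (G₂ →ᵇ ℝ) →ₗ[ℝ] ℝ} (mpos : ∀ f, 0 ≤ f → 0 ≤ m f) (m1 : m 1 = 1)
    (h : C_c(G₁, ℝ)) (f : (G₁ × G₂) →ᵇ ℝ) : G₁ →ᵇ ℝ :=
  BoundedContinuousFunction.ofNormedAddCommGroup (fun x => m (smearFst (leftCc x h) f))
    (by
      refine continuous_iff_continuousAt.2 fun x₀ => ?_
      rw [ContinuousAt, tendsto_iff_norm_sub_tendsto_zero]
      have hc : Continuous fun x => ‖f‖ * ‖ccL1 G₁ (leftCc x h) - ccL1 G₁ (leftCc x₀ h)‖ :=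
        continuous_const.mul ((continuous_ccL1_leftCc h).sub continuous_const).norm
      have h0 := hc.tendsto x₀
      rw [sub_self, norm_zero, mul_zero] at h0
      refine squeeze_zero (fun x => norm_nonneg _) (fun x => ?_) h0
      rw [← map_sub, ← smearFst_sub_left, ← map_sub]
      exact abs_mean_le mpos m1 fun y => abs_integral_mul_le y)
    (‖f‖ * ‖ccL1 G₁ h‖)
    (fun x => by
      rw [← norm_ccL1_leftCc x]
      exact abs_mean_le mpos m1 fun y => abs_integral_mul_le y)

/-- Applying the mean `n` of `G₂` in the second variable and then the mean `m` of `G₁` is not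
immediately possible, since `x ↦ n (f (x, ·))` need not be continuous. Smearing `f` in the first
variable by `g ∈ C_c(G₁)` restores continuity, and dividing by `∫ g` normalises the result. -/
theorem IsAmenable.prod [T2Space G₁] [Group G₂] [IsTopologicalGroup G₂] (h₁ : IsAmenable G₁) (h₂ : IsAmenable G₂) :
    IsAmenable (G₁ × G₂) := by
  obtain ⟨m, mpos, m1, minv⟩ := h₁
  obtain ⟨n, npos, n1, ninv⟩ := h₂
  obtain ⟨g, hg, hgpos⟩ := exists_cc_integral_pos G₁
  set I : ℝ := ∫ x, g x ∂(haar : Measure G₁) with hI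
  let B := smearMean (G₁ := G₁) npos n1
  have hB : ∀ h f x, B h f x = n (smearFst (leftCc x h) f) := fun _ _ _ => rfl
  let J (f : (G₁ × G₂) →ᵇ ℝ) : C_c(G₁, ℝ) →ₗ[ℝ] ℝ :=
    { toFun := fun h => m (B h f)
      map_add' := fun h k => by
        rw [← map_add]
        congr 1; ext x
        simp [hB, smearFst_add_left]
      map_smul' := fun c h => by
        rw [RingHom.id_apply, ← map_smul]
        congr 1; ext x
        simp [hB, smearFst_smul_left] }
  have hJ : ∀ f h, J f h = m (B h f) := fun _ _ => rfl
  -- The smeared mean depends on the smearing function only through its integral.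
  have hJc : ∀ f, ∃ c : ℝ, ∀ h, J f h = c * ∫ x, h x ∂(haar : Measure G₁) := by
    intro f
    refine exists_eq_const_mul_integral_of_left (J f) ‖f‖ (fun h => ?_) (fun a h => ?_)
    · rw [← norm_ccL1, hJ]
      refine abs_mean_le mpos m1 fun x => ?_
      rw [hB, ← norm_ccL1_leftCc x]
      exact abs_mean_le npos n1 fun y => abs_integral_mul_le y
    · rw [hJ, hJ, ← minv a (B h f)]
      congr 1; ext x
      change B _ f x = B h f (a * x)
      rw [hB, hB]
      congr 2; ext s
      simp [mul_assoc]
  refine ⟨{ toFun := fun f => I⁻¹ * m (B g f), map_add' := fun f f' => ?_,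
            map_smul' := fun c f => ?_ }, fun f hf => ?_, ?_, fun s f => ?_⟩
  · rw [← mul_add, ← map_add]
    congr 2; ext x
    simp [hB, smearFst_add_right]
  · rw [RingHom.id_apply, smul_eq_mul, mul_left_comm, ← smul_eq_mul c, ← map_smul]
    congr 2; ext x
    simp [hB, smearFst_smul_right]
  · refine mul_nonneg (inv_nonneg.2 hgpos.le) (mpos _ fun x => npos _ fun y => ?_)
    exact integral_nonneg fun s => mul_nonneg (hg _) (hf _)
  · have e : B g 1 = I • 1 := by
      ext x
      rw [hB]
      have e' : smearFst (leftCc x g) (1 : (G₁ × G₂) →ᵇ ℝ) = I • 1 := by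
        ext y
        rw [smearFst_apply]
        simp only [BoundedContinuousFunction.coe_one, Pi.one_apply, mul_one, integral_leftCc]
        simp [hI]
      rw [e', map_smul, n1]
      rfl
    change I⁻¹ * m (B g 1) = 1
    rw [e, map_smul, m1, smul_eq_mul, mul_one, inv_mul_cancel₀ hgpos.ne']
  · change I⁻¹ * m (B g _) = I⁻¹ * m (B g f)
    congr 1
    obtain ⟨c, hc⟩ := hJc f
    -- The mean `n` absorbs `s.2`; substituting `t * s.1⁻¹` for `t` moves `s.1` onto `g` as an
    -- integral-preserving right translation.
    have e : B g (f.compContinuous (Homeomorph.mulLeft s : C(G₁ × G₂, G₁ × G₂))) =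
        B (rightCc s.1⁻¹ g) f := by
      ext x
      rw [hB, hB, ← ninv s.2 (smearFst (leftCc x (rightCc s.1⁻¹ g)) f)]
      congr 1; ext y
      change ∫ t, _ ∂_ = ∫ t, _ ∂_
      have h := integral_mul_right_haar_real
        (fun t => g (x * (t * s.1)) * f (t⁻¹, s.2 * y)) s.1⁻¹
      simp only [modularFn_inv, inv_inv] at h
      have e1 : ∫ t, (leftCc x g) t * (f.compContinuous
          (Homeomorph.mulLeft s : C(G₁ × G₂, G₁ × G₂))) (t⁻¹, y) ∂(haar : Measure G₁) =
          ∫ t, g (x * (t * s.1⁻¹ * s.1)) * f ((t * s.1⁻¹)⁻¹, s.2 * y) ∂(haar : Measure G₁) := by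
        congr 1; ext t
        simp only [leftCc_apply, inv_mul_cancel_right, mul_inv_rev, inv_inv]
        rfl
      rw [e1, h, ← integral_const_mul]
      congr 1; ext t
      simp [modularFn_inv, mul_assoc]
    rw [e, ← hJ, ← hJ, hc, hc, integral_rightCc]

end ProductAmenable

/-! ### Separating compact sets from the identity -/

section Separation

theorem isAmenable_punit : IsAmenable PUnit.{v + 1} :=
  ⟨{ toFun := fun f => f 1, map_add' := fun _ _ => rfl, map_smul' := fun _ _ => rfl },
    fun _ hf => hf 1, rfl, fun _ _ => rfl⟩

/-- If homomorphisms to amenable groups separate the points of `G` from the identity, then each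
compact set avoiding the identity is mapped off the identity by one such homomorphism. -/
theorem exists_amenable_hom_of_isCompact {G : Type u} [Group G] [TopologicalSpace G]
    (hG : ∀ x : G, x ≠ 1 →
      ∃ (G' : Type v) (_ : Group G') (_ : TopologicalSpace G') (_ : IsTopologicalGroup G')
        (_ : LocallyCompactSpace G') (_ : T2Space G'),
        IsAmenable G' ∧ ∃ φ : G →* G', Continuous φ ∧ φ x ≠ 1)
    {C : Set G} (hC : IsCompact C) (h1 : 1 ∉ C) :
    ∃ (G' : Type v) (_ : Group G') (_ : TopologicalSpace G') (_ : IsTopologicalGroup G')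
        (_ : LocallyCompactSpace G') (_ : T2Space G'),
        IsAmenable G' ∧ ∃ φ : G →* G', Continuous φ ∧ ∀ x ∈ C, φ x ≠ 1 := by
  refine hC.induction_on (p := fun C => ∃ (G' : Type v) (_ : Group G') (_ : TopologicalSpace G')
    (_ : IsTopologicalGroup G') (_ : LocallyCompactSpace G') (_ : T2Space G'),
    IsAmenable G' ∧ ∃ φ : G →* G', Continuous φ ∧ ∀ x ∈ C, φ x ≠ 1) ?_ ?_ ?_ ?_
  · exact ⟨PUnit, inferInstance, inferInstance, inferInstance, inferInstance, inferInstance,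
      isAmenable_punit, 1, continuous_const, fun x hx => hx.elim⟩
  · intro s t hst ih
    obtain ⟨G', i1, i2, i3, i4, i5, h, φ, hφ, hs⟩ := ih
    exact ⟨G', i1, i2, i3, i4, i5, h, φ, hφ, fun x hx => hs x (hst hx)⟩
  · intro s t ihs iht
    obtain ⟨G₁, i1, i2, i3, i4, i5, h, φ, hφ, hs⟩ := ihs
    obtain ⟨G₂, j1, j2, j3, j4, j5, h', φ', hφ', ht⟩ := iht
    let _ : MeasurableSpace G₁ := borel G₁
    have : BorelSpace G₁ := ⟨rfl⟩
    refine ⟨G₁ × G₂, inferInstance, inferInstance, inferInstance, inferInstance, inferInstance,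
      h.prod h', φ.prod φ', hφ.prodMk hφ', ?_⟩
    rintro x (hx | hx) he
    · exact hs x hx (congrArg Prod.fst he)
    · exact ht x hx (congrArg Prod.snd he)
  · intro x hx
    obtain ⟨G', i1, i2, i3, i4, i5, h, φ, hφ, hs⟩ := hG x fun e => h1 (e ▸ hx)
    exact ⟨{y | φ y ≠ 1},
      mem_nhdsWithin_of_mem_nhds ((isOpen_ne_fun hφ continuous_const).mem_nhds hs),
      G', i1, i2, i3, i4, i5, h, φ, hφ, fun x hx => hx⟩

end Separation

/-! ### Coefficients of the left regular representation with small support -/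

section Bump

open UnitaryRep
open scoped Pointwise

variable {G : Type*} [Group G] [TopologicalSpace G] [IsTopologicalGroup G]
  [LocallyCompactSpace G] [MeasurableSpace G] [BorelSpace G]

theorem memLp_two_cc (f : C_c(G, ℂ)) : MemLp f 2 (haar : Measure G) :=
  f.continuous.memLp_of_hasCompactSupport f.hasCompactSupport

/-- The class in `L²(G)` of a compactly supported continuous function. -/
noncomputable def ccL2 (f : C_c(G, ℂ)) : L2 G := (memLp_two_cc f).toLp f

theorem ccL2_coeFn (f : C_c(G, ℂ)) : ccL2 f =ᵐ[haar] f := (memLp_two_cc f).coeFn_toLp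

theorem inner_ccL2_left (f : C_c(G, ℂ)) (ξ : L2 G) :
    inner ℂ (ccL2 f) ξ = ∫ x, starRingEnd ℂ (f x) * ξ x ∂(haar : Measure G) := by
  rw [L2.inner_def]
  refine integral_congr_ae ?_
  filter_upwards [ccL2_coeFn f] with x hx
  rw [hx, RCLike.inner_apply, mul_comm]

theorem inner_ccL2 (f g : C_c(G, ℂ)) :
    inner ℂ (ccL2 f) (ccL2 g) = ∫ x, starRingEnd ℂ (f x) * g x ∂(haar : Measure G) := by
  rw [inner_ccL2_left]
  refine integral_congr_ae ?_
  filter_upwards [ccL2_coeFn g] with x hx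
  rw [hx]

theorem leftRegular_coeFn (s : G) (ξ : L2 G) :
    leftRegular.toHom s ξ =ᵐ[haar] fun t => ξ (s⁻¹ * t) := leftOp_coeFn s ξ

theorem leftRegular_ccL2 (s : G) (f : C_c(G, ℂ)) :
    leftRegular.toHom s (ccL2 f) = ccL2 (leftCc s⁻¹ f) := by
  ext1
  filter_upwards [leftRegular_coeFn s (ccL2 f), ccL2_coeFn (leftCc s⁻¹ f),
    (measurePreserving_mul_left haar s⁻¹).quasiMeasurePreserving.ae (ccL2_coeFn f)] with x h1 h2 h3
  rw [h1, h2, h3, leftCc_apply]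

/-- The left regular representation has positive definite coefficients with arbitrarily small
support. -/
theorem exists_leftRegular_coefficient_support_subset {V : Set G} (hV : V ∈ 𝓝 (1 : G)) :
    ∃ (b : L2 G) (k : C_c(G, ℝ)), 0 ≤ k ∧ 0 < k 1 ∧ (∀ w, k w ≠ 0 → w ∈ V) ∧
      ∀ w, inner ℂ b (leftRegular.toHom w b) = (k w : ℂ) := by
  -- For `f` vanishing off `W`, the coefficient `∫ f(x) f(w⁻¹x) dx` can be nonzero only if some `x`
  -- and `w⁻¹x` both lie in `W`, so that `w ∈ W W⁻¹`.
  obtain ⟨W, hW, hWV⟩ : ∃ W ∈ 𝓝 (1 : G), ∀ x ∈ W, ∀ y ∈ W, x * y⁻¹ ∈ V := by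
    have hc : Tendsto (fun p : G × G => p.1 * p.2⁻¹) (𝓝 (1, 1)) (𝓝 1) := by
      have : ContinuousAt (fun p : G × G => p.1 * p.2⁻¹) (1, 1) := by fun_prop
      simpa [ContinuousAt] using this
    obtain ⟨W₁, h₁, W₂, h₂, h⟩ := mem_nhds_prod_iff.1 (hc hV)
    exact ⟨W₁ ∩ W₂, inter_mem h₁ h₂, fun x hx y hy => h (Set.mk_mem_prod hx.1 hy.2)⟩
  obtain ⟨f, f1, f0, fc, f01⟩ := exists_continuous_one_zero_of_isCompact
    (isCompact_singleton (x := (1 : G))) (isOpen_interior (s := W)).isClosed_compl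
    (by simpa using mem_interior_iff_mem_nhds.2 hW)
  have f1 : f 1 = 1 := f1 rfl
  have fW : ∀ x, f x ≠ 0 → x ∈ W := fun x hx => by
    by_contra h
    exact hx (f0 fun h' => h (interior_subset h'))
  have fnn : ∀ x, 0 ≤ f x := fun x => (f01 x).1
  let fC : C_c(G, ℂ) := ccOf (fun x => (f x : ℂ)) (by fun_prop)
    (fc.comp_left (g := fun r : ℝ => (r : ℂ)) Complex.ofReal_zero)
  have kcont : Continuous fun w => ∫ x, f x * f (w⁻¹ * x) ∂(haar : Measure G) :=
    continuous_integral_of_locally_compact_support (f := fun w x => f x * f (w⁻¹ * x))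
      (by fun_prop) fun _ _ => ⟨tsupport f, fc, fun w _ x hx => by
        rw [image_eq_zero_of_notMem_tsupport hx, zero_mul]⟩
  have kne : ∀ w, ∫ x, f x * f (w⁻¹ * x) ∂(haar : Measure G) ≠ 0 →
      ∃ x, f x ≠ 0 ∧ f (w⁻¹ * x) ≠ 0 := by
    intro w hw
    by_contra! h
    refine hw ?_
    rw [← integral_zero G ℝ (μ := haar)]
    congr 1; ext x
    by_cases hx : f x = 0
    · simp [hx]
    · simp [h x hx]
  have kc : HasCompactSupport fun w => ∫ x, f x * f (w⁻¹ * x) ∂(haar : Measure G) := by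
    refine HasCompactSupport.intro (fc.isCompact.mul fc.isCompact.inv) fun w hw => ?_
    by_contra h
    obtain ⟨x, h1, h2⟩ := kne w h
    exact hw ⟨x, subset_tsupport _ h1, (w⁻¹ * x)⁻¹, Set.inv_mem_inv.2 (subset_tsupport _ h2),
      by simp⟩
  refine ⟨ccL2 fC, ccOf _ kcont kc, fun w => integral_nonneg fun x => mul_nonneg (fnn _) (fnn _),
    ?_, fun w hw => ?_, fun w => ?_⟩
  · have hcont : Continuous fun x => f x * f (1⁻¹ * x) := by fun_prop
    refine hcont.integral_pos_of_hasCompactSupport_nonneg_nonzero (x := 1) fc.mul_right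
      (fun x => mul_nonneg (fnn _) (fnn _)) ?_
    simp [f1]
  · obtain ⟨x, h1, h2⟩ := kne w hw
    simpa using hWV x (fW x h1) _ (fW _ h2)
  · rw [leftRegular_ccL2, inner_ccL2, ccOf_apply, ← integral_complex_ofReal]
    congr 1; ext x
    simp [fC]

end Bump

/-! ### Convolution, involution and integrated forms on `C_c(G)` -/

section Integrated

open UnitaryRep
open scoped Pointwise

variable {G : Type*} [Group G] [TopologicalSpace G]

section Rep

variable {H : Type*} [NormedAddCommGroup H] [InnerProductSpace ℂ H]

theorem UnitaryRep.toHom_mul_apply (π : UnitaryRep G H) (s t : G) (ξ : H) :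
    π.toHom (s * t) ξ = π.toHom s (π.toHom t ξ) := by
  rw [map_mul]; rfl

theorem UnitaryRep.toHom_inv_apply_self (π : UnitaryRep G H) (s : G) (ξ : H) :
    π.toHom s⁻¹ (π.toHom s ξ) = ξ := by
  rw [← π.toHom_mul_apply, inv_mul_cancel, map_one]; rfl

theorem UnitaryRep.toHom_self_apply_inv (π : UnitaryRep G H) (s : G) (ξ : H) :
    π.toHom s (π.toHom s⁻¹ ξ) = ξ := by
  rw [← π.toHom_mul_apply, mul_inv_cancel, map_one]; rfl

theorem UnitaryRep.inner_toHom_left (π : UnitaryRep G H) (s : G) (ξ η : H) :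
    inner ℂ (π.toHom s ξ) η = inner ℂ ξ (π.toHom s⁻¹ η) := by
  rw [← (π.toHom s⁻¹).inner_map_map, π.toHom_inv_apply_self]

end Rep

variable [IsTopologicalGroup G]

theorem continuous_leftCc_uncurry (F : C_c(G, ℂ)) :
    Continuous fun p : G × G => leftCc p.1⁻¹ F p.2 := by
  simp only [leftCc_apply]; fun_prop

theorem leftCc_support (f F : C_c(G, ℂ)) :
    ∃ k : Set G, IsCompact k ∧ ∀ t ∈ tsupport f, ∀ x ∉ k, leftCc t⁻¹ F x = 0 := by
  refine ⟨tsupport f * tsupport F, f.hasCompactSupport.isCompact.mul F.hasCompactSupport,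
    fun t ht x hx => ?_⟩
  rw [leftCc_apply]
  by_contra h
  exact hx ⟨t, ht, _, subset_tsupport _ h, by simp⟩

variable [LocallyCompactSpace G]

/-- The operator `ρ(t)` on `C_c(G)`. -/
noncomputable def rhoCc (t : G) (F : C_c(G, ℂ)) : C_c(G, ℂ) :=
  ccOf (fun x => ((√(modularFn t) : ℝ) : ℂ) * F (x * t)) (by fun_prop)
    (hasCompactSupport_mul_right F.hasCompactSupport t).mul_left

@[simp]
theorem rhoCc_apply (t : G) (F : C_c(G, ℂ)) (x : G) :
    rhoCc t F x = ((√(modularFn t) : ℝ) : ℂ) * F (x * t) := rfl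

theorem rhoCc_support (g F : C_c(G, ℂ)) :
    ∃ k : Set G, IsCompact k ∧ ∀ t ∈ tsupport g, ∀ x ∉ k, rhoCc t F x = 0 := by
  refine ⟨tsupport F * (tsupport g)⁻¹, F.hasCompactSupport.isCompact.mul
    g.hasCompactSupport.isCompact.inv, fun t ht x hx => ?_⟩
  rw [rhoCc_apply]
  by_contra h
  exact hx ⟨_, subset_tsupport _ (right_ne_zero_of_mul h), t⁻¹, Set.inv_mem_inv.2 ht, by simp⟩

variable [MeasurableSpace G] [BorelSpace G]

theorem integral_mul_right_haar_smul {E : Type*} [NormedAddCommGroup E] [NormedSpace ℝ E]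
    (f : G → E) (s : G) : ∫ x, f (x * s) ∂(haar : Measure G) =
      ((modularFn s)⁻¹ : ℝ) • ∫ x, f x ∂(haar : Measure G) := by
  have h := (Homeomorph.mulRight s).measurableEmbedding.integral_map (μ := haar) f
  simp only [Homeomorph.coe_mulRight] at h
  rw [← h]
  change ∫ y, f y ∂(Measure.map (· * s) (haar : Measure G)) = _
  rw [map_mul_right_haar, integral_smul_nnreal_measure]
  simp [modularFn, NNReal.smul_def]

theorem integral_inversion [T2Space G] (f : C_c(G, ℂ)) :
    ∫ x, ((modularFn x)⁻¹ : ℂ) * f x⁻¹ ∂(haar : Measure G) = ∫ x, f x ∂(haar : Measure G) := by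
  have hre := integral_invCc
    (ccOf (fun x => (f x).re) (by fun_prop) (f.hasCompactSupport.comp_left Complex.zero_re))
  have him := integral_invCc
    (ccOf (fun x => (f x).im) (by fun_prop) (f.hasCompactSupport.comp_left Complex.zero_im))
  have hc := (continuous_modularFn (G := G)).inv₀ fun x => (modularFn_pos x).ne'
  have hi : Integrable (fun x => ((modularFn x)⁻¹ : ℂ) * f x⁻¹) (haar : Measure G) := by
    refine Continuous.integrable_of_hasCompactSupport ?_
      (hasCompactSupport_inv f.hasCompactSupport).mul_left
    have : Continuous fun x : G => (((modularFn x)⁻¹ : ℝ) : ℂ) := Complex.continuous_ofReal.comp hc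
    simp only [Complex.ofReal_inv] at this
    exact this.mul (by fun_prop)
  have e1 := fun x : G => Complex.re_ofReal_mul (modularFn x)⁻¹ (f x⁻¹)
  have e2 := fun x : G => Complex.im_ofReal_mul (modularFn x)⁻¹ (f x⁻¹)
  simp only [Complex.ofReal_inv] at e1 e2
  apply Complex.ext
  · rw [← RCLike.re_eq_complex_re, ← integral_re hi, ← integral_re f.integrable]
    simp only [RCLike.re_eq_complex_re, e1]
    exact hre
  · rw [← RCLike.im_eq_complex_im, ← integral_im hi, ← integral_im f.integrable]
    simp only [RCLike.im_eq_complex_im, e2]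
    exact him

theorem denseRange_ccL2 : DenseRange (ccL2 : C_c(G, ℂ) → L2 G) := by
  let D : Submodule ℂ (L2 G) := LinearMap.range
    ({ toFun := ccL2 (G := G)
       map_add' := fun f g => (MemLp.toLp_add (memLp_two_cc f) (memLp_two_cc g)).symm
       map_smul' := fun c f => MemLp.toLp_const_smul c (memLp_two_cc f) } : C_c(G, ℂ) →ₗ[ℂ] L2 G)
  suffices h : ∀ ξ : L2 G, ξ ∈ D.topologicalClosure from fun ξ => h ξ
  intro ξ
  refine Lp.induction (by norm_num) (fun ξ : L2 G => ξ ∈ D.topologicalClosure) ?_ ?_ ?_ ξ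
  · intro c A hA hfin
    refine EMetric.mem_closure_iff.2 fun ε hε => ?_
    obtain ⟨δ, hδ, hδε⟩ := exists_between hε
    obtain ⟨f, hf, hfc, hle⟩ := exists_continuous_approx_indicator c hA hfin hδ.ne'
    refine ⟨ccL2 (ccOf f hf hfc), ⟨_, rfl⟩, lt_of_le_of_lt ?_ hδε⟩
    rw [edist_comm, Lp.simpleFunc.coe_indicatorConst]
    unfold indicatorConstLp ccL2
    rw [Lp.edist_toLp_toLp]
    exact hle
  · intro f g hf hg _ h1 h2
    exact add_mem h1 h2
  · exact D.isClosed_topologicalClosure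

theorem ext_inner_ccL2 {ξ η : L2 G} (h : ∀ f, inner ℂ (ccL2 f) ξ = inner ℂ (ccL2 f) η) : ξ = η := by
  refine ext_inner_left ℂ fun v => ?_
  have h1 : Continuous fun v : L2 G => inner ℂ v ξ := by fun_prop
  have h2 : Continuous fun v : L2 G => inner ℂ v η := by fun_prop
  exact congrFun (DenseRange.equalizer denseRange_ccL2 h1 h2 (funext h)) v

/-- The superposition `x ↦ ∫ w(t) F(t, x) dt` of a continuous family in `C_c(G)`. -/
noncomputable def superpose (w : C_c(G, ℂ)) (F : G → C_c(G, ℂ))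
    (hF : Continuous fun p : G × G => F p.1 p.2)
    (hs : ∃ k : Set G, IsCompact k ∧ ∀ t ∈ tsupport w, ∀ x ∉ k, F t x = 0) : C_c(G, ℂ) :=
  ccOf (fun x => ∫ t, w t * F t x ∂(haar : Measure G))
    (continuous_integral_of_locally_compact_support (f := fun x t => w t * F t x)
      (by
        have : Continuous fun p : G × G => F p.2 p.1 := hF.comp continuous_swap
        exact (w.continuous.comp continuous_snd).mul this)
      fun _ _ => ⟨tsupport w, w.hasCompactSupport, fun x _ t ht => by
        rw [image_eq_zero_of_notMem_tsupport ht, zero_mul]⟩)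
    (by
      obtain ⟨k, hk, hkF⟩ := hs
      refine HasCompactSupport.intro hk fun x hx => ?_
      rw [← integral_zero G ℂ (μ := haar)]
      congr 1; ext t
      by_cases ht : t ∈ tsupport w
      · rw [hkF t ht x hx, mul_zero]
      · rw [image_eq_zero_of_notMem_tsupport ht, zero_mul])

theorem superpose_apply (w : C_c(G, ℂ)) (F : G → C_c(G, ℂ)) (hF hs) (x : G) :
    superpose w F hF hs x = ∫ t, w t * F t x ∂(haar : Measure G) := rfl

/-- Fubini for continuous compactly supported integrands needs no σ-finiteness of Haar measure, so
`G` may be arbitrarily large. -/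
theorem integral_superpose_smul {E : Type*} [NormedAddCommGroup E] [NormedSpace ℂ E]
    [CompleteSpace E] (w : C_c(G, ℂ)) (F : G → C_c(G, ℂ)) (hF hs) {v : G → E} (hv : Continuous v) :
    ∫ x, superpose w F hF hs x • v x ∂(haar : Measure G) =
      ∫ t, w t • ∫ x, F t x • v x ∂(haar : Measure G) ∂(haar : Measure G) := by
  have e : ∀ x, superpose w F hF hs x • v x =
      ∫ t, (w t * F t x) • v x ∂(haar : Measure G) := fun x => by
    rw [superpose_apply, integral_smul_const]
  simp_rw [e]
  rw [integral_integral_swap_of_hasCompactSupport]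
  · congr 1; ext t
    rw [← integral_smul]
    congr 1; ext x
    rw [mul_smul]
  · have : Continuous fun p : G × G => F p.2 p.1 := hF.comp continuous_swap
    exact ((w.continuous.comp continuous_snd).mul this).smul (hv.comp continuous_fst)
  · obtain ⟨k, hk, hkF⟩ := hs
    refine HasCompactSupport.intro (hk.prod w.hasCompactSupport) fun ⟨x, t⟩ hp => ?_
    change (w t * F t x) • v x = 0
    by_cases ht : t ∈ tsupport w
    · rw [hkF t ht x fun hx => hp ⟨hx, ht⟩, mul_zero, zero_smul]
    · rw [image_eq_zero_of_notMem_tsupport ht, zero_mul, zero_smul]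

/-- Identifies an `L²`-valued integral with a pointwise one by testing against the dense space
`C_c(G)`. -/
theorem ccL2_superpose (w : C_c(G, ℂ)) (F : G → C_c(G, ℂ)) (hF hs)
    (hc : Continuous fun t => ccL2 (F t)) :
    ccL2 (superpose w F hF hs) = ∫ t, w t • ccL2 (F t) ∂(haar : Measure G) := by
  refine ext_inner_ccL2 fun Ψ => ?_
  have hi : Integrable (fun t => w t • ccL2 (F t)) (haar : Measure G) :=
    (w.continuous.smul hc).integrable_of_hasCompactSupport w.hasCompactSupport.smul_right
  rw [← integral_inner hi]
  simp only [inner_smul_right, inner_ccL2]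
  have hv : Continuous fun x => starRingEnd ℂ (Ψ x) := Complex.continuous_conj.comp Ψ.continuous
  have := integral_superpose_smul w F hF hs hv
  simp only [smul_eq_mul] at this
  simp only [mul_comm (starRingEnd ℂ (Ψ _)), this]

section Rep

variable {H : Type*} [NormedAddCommGroup H] [InnerProductSpace ℂ H]

theorem UnitaryRep.integrated_apply (π : UnitaryRep G H) (f : C_c(G, ℂ)) (ξ : H) :
    π.integrated f ξ = ∫ x, f x • π.toHom x ξ ∂(haar : Measure G) := rfl

variable [CompleteSpace H]

theorem UnitaryRep.inner_integrated (π : UnitaryRep G H) (f : C_c(G, ℂ)) (η ξ : H) :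
    inner ℂ η (π.integrated f ξ) =
      ∫ x, f x * inner ℂ η (π.toHom x ξ) ∂(haar : Measure G) := by
  rw [integrated_apply, ← integral_inner (π.integrable_smul_orbit f ξ)]
  simp only [inner_smul_right]

/-- The involution of `C_c(G)`. -/
noncomputable def starCc (f : C_c(G, ℂ)) : C_c(G, ℂ) :=
  ccOf (fun x => ((modularFn x)⁻¹ : ℂ) * starRingEnd ℂ (f x⁻¹))
    (by
      have hc := (continuous_modularFn (G := G)).inv₀ fun x => (modularFn_pos x).ne'
      have : Continuous fun x : G => (((modularFn x)⁻¹ : ℝ) : ℂ) :=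
        Complex.continuous_ofReal.comp hc
      simp only [Complex.ofReal_inv] at this
      exact this.mul (Complex.continuous_conj.comp (by fun_prop)))
    (((hasCompactSupport_inv f.hasCompactSupport).comp_left (map_zero _)).mul_left)

theorem starCc_apply (f : C_c(G, ℂ)) (x : G) :
    starCc f x = ((modularFn x)⁻¹ : ℂ) * starRingEnd ℂ (f x⁻¹) := rfl

/-- The modular factor in `starCc` is the density appearing when Haar measure is inverted. -/
theorem UnitaryRep.integrated_starCc [T2Space G] (π : UnitaryRep G H) (f : C_c(G, ℂ)) :
    π.integrated (starCc f) = star (π.integrated f) := by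
  rw [ContinuousLinearMap.star_eq_adjoint, ContinuousLinearMap.eq_adjoint_iff]
  intro η ξ
  rw [← inner_conj_symm, π.inner_integrated, π.inner_integrated, ← integral_conj]
  have := integral_inversion (ccOf (fun x => f x * inner ℂ η (π.toHom x ξ))
    (f.continuous.mul (continuous_const.inner (π.continuous_orbit ξ)))
    f.hasCompactSupport.mul_right)
  simp only [ccOf_apply] at this
  rw [← this]
  congr 1; ext x
  rw [starCc_apply, map_mul, map_mul, inner_conj_symm, π.inner_toHom_left]
  simp [mul_assoc]

theorem UnitaryRep.integrated_superpose (π : UnitaryRep G H) (w : C_c(G, ℂ))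
    (F : G → C_c(G, ℂ)) (hF hs) (ξ : H) :
    π.integrated (superpose w F hF hs) ξ =
      ∫ t, w t • π.integrated (F t) ξ ∂(haar : Measure G) :=
  integral_superpose_smul w F hF hs (π.continuous_orbit ξ)

theorem UnitaryRep.integrated_leftCc (π : UnitaryRep G H) (s : G) (f : C_c(G, ℂ)) (ξ : H) :
    π.integrated (leftCc s⁻¹ f) ξ = π.toHom s (π.integrated f ξ) := by
  have h := ((π.toHom s).toContinuousLinearEquiv : H →L[ℂ] H).integral_comp_comm
    (π.integrable_smul_orbit f ξ)
  have h' := integral_mul_left_eq_self (μ := (haar : Measure G))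
    (fun x => f x • π.toHom (s * x) ξ) s⁻¹
  rw [integrated_apply, integrated_apply]
  refine Eq.trans ?_ (h'.trans (Eq.trans ?_ h))
  · congr 1; ext x
    simp
  · congr 1; ext x
    rw [π.toHom_mul_apply]
    exact ((π.toHom s).map_smul _ _).symm

end Rep

/-- The convolution of `C_c(G)`. -/
noncomputable def convCc (f F : C_c(G, ℂ)) : C_c(G, ℂ) :=
  superpose f (fun s => leftCc s⁻¹ F) (continuous_leftCc_uncurry F) (leftCc_support f F)

theorem leftRegular_integrated_ccL2 (f F : C_c(G, ℂ)) :
    leftRegular.integrated f (ccL2 F) = ccL2 (convCc f F) := by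
  rw [convCc, ccL2_superpose]
  · simp only [← leftRegular_ccL2]
    rfl
  · simp only [← leftRegular_ccL2]
    exact leftRegular.continuous_orbit _

theorem UnitaryRep.integrated_convCc {H : Type*} [NormedAddCommGroup H] [InnerProductSpace ℂ H]
    [CompleteSpace H] (π : UnitaryRep G H) (f F : C_c(G, ℂ)) :
    π.integrated (convCc f F) = π.integrated f * π.integrated F := by
  ext ξ
  rw [convCc, π.integrated_superpose]
  simp only [π.integrated_leftCc]
  rfl

theorem rightRegular_ccL2 (t : G) (F : C_c(G, ℂ)) :
    rightRegular.toHom t (ccL2 F) = ccL2 (rhoCc t F) := by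
  ext1
  filter_upwards [rightHom_coeFn t (ccL2 F), ccL2_coeFn (rhoCc t F),
    ae_mul_right (ccL2_coeFn F) t] with x h1 h2 h3
  exact h1.trans (by rw [h2, h3, rhoCc_apply])

theorem continuous_rhoCc_uncurry (F : C_c(G, ℂ)) :
    Continuous fun p : G × G => rhoCc p.1 F p.2 := by
  have := continuous_modularFn (G := G)
  have h : Continuous fun p : G × G => ((√(modularFn p.1) : ℝ) : ℂ) :=
    Complex.continuous_ofReal.comp (Real.continuous_sqrt.comp (this.comp continuous_fst))
  simp only [rhoCc_apply]
  exact h.mul (by fun_prop)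

/-- The superposition `∫ g(t) ρ(t) F dt` in `C_c(G)`. -/
noncomputable def rhoConvCc (g F : C_c(G, ℂ)) : C_c(G, ℂ) :=
  superpose g (fun t => rhoCc t F) (continuous_rhoCc_uncurry F) (rhoCc_support g F)

theorem rightRegular_integrated_ccL2 (g F : C_c(G, ℂ)) :
    rightRegular.integrated g (ccL2 F) = ccL2 (rhoConvCc g F) := by
  rw [rhoConvCc, ccL2_superpose]
  · simp only [← rightRegular_ccL2]
    rfl
  · simp only [← rightRegular_ccL2]
    exact rightRegular.continuous_orbit _

theorem UnitaryRep.integrated_rhoConvCc {H : Type*} [NormedAddCommGroup H]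
    [InnerProductSpace ℂ H] [CompleteSpace H] (π : UnitaryRep G H) (g F : C_c(G, ℂ)) (ξ : H) :
    π.integrated (rhoConvCc g F) ξ =
      ∫ t, g t • π.integrated (rhoCc t F) ξ ∂(haar : Measure G) :=
  π.integrated_superpose _ _ _ _ _

/-- The substitution `y = xt` contributes `Δ(t)⁻¹` against the factor `Δ(t)^{1/2}` of `ρ(t)`. Thus
right translation of `F` becomes `π(t⁻¹)` applied before `π(F)`, up to the scalar `Δ(t)^{-1/2}`. -/
theorem UnitaryRep.integrated_rhoCc {H : Type*} [NormedAddCommGroup H]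
    [InnerProductSpace ℂ H] [CompleteSpace H] (π : UnitaryRep G H) (t : G) (F : C_c(G, ℂ)) (ξ : H) :
    π.integrated (rhoCc t F) ξ =
      (((√(modularFn t))⁻¹ : ℝ) : ℂ) • π.integrated F (π.toHom t⁻¹ ξ) := by
  have h := integral_mul_right_haar_smul (fun y => F y • π.toHom (y * t⁻¹) ξ) t
  have ht : 0 < √(modularFn t) := Real.sqrt_pos.2 (modularFn_pos t)
  simp only [mul_inv_cancel_right] at h
  simp only [integrated_apply, rhoCc_apply, ← π.toHom_mul_apply]
  simp only [mul_smul, integral_smul, h]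
  rw [← Complex.coe_smul, smul_smul, ← Complex.ofReal_mul]
  congr 2
  nth_rw 2 [← Real.mul_self_sqrt (modularFn_pos t).le]
  field_simp

end Integrated

/-! ### Norms of diagonal vectors in the Hilbert tensor product -/

section DiagonalVectors

open UnitaryRep
open scoped Pointwise

theorem HilbertTensor.inner_of_tmul {H K : Type*} [NormedAddCommGroup H] [InnerProductSpace ℂ H]
    [NormedAddCommGroup K] [InnerProductSpace ℂ K] (x x' : H) (y y' : K) :
    inner ℂ (HilbertTensor.of (x ⊗ₜ[ℂ] y)) (HilbertTensor.of (x' ⊗ₜ[ℂ] y')) =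
      inner ℂ x x' * inner ℂ y y' := by
  rw [LinearIsometry.inner_map_map, TensorProduct.inner_tmul]

theorem HilbertTensor.continuous_of_tmul {X H K : Type*} [TopologicalSpace X]
    [NormedAddCommGroup H] [InnerProductSpace ℂ H] [NormedAddCommGroup K] [InnerProductSpace ℂ K]
    {f : X → H} {g : X → K} (hf : Continuous f) (hg : Continuous g) :
    Continuous fun x => HilbertTensor.of (f x ⊗ₜ[ℂ] g x) :=
  HilbertTensor.of.continuous.comp (TensorProduct.continuous_tmul.comp (hf.prodMk hg))

theorem inner_integral_integral {X E : Type*} [MeasurableSpace X] {μ : Measure X}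
    [NormedAddCommGroup E] [InnerProductSpace ℂ E] [CompleteSpace E] {f : X → E}
    (hf : Integrable f μ) :
    inner ℂ (∫ x, f x ∂μ) (∫ x, f x ∂μ) = ∫ x, ∫ y, inner ℂ (f x) (f y) ∂μ ∂μ := by
  rw [← inner_conj_symm, ← integral_inner hf, ← integral_conj]
  simp only [inner_conj_symm]
  congr 1; ext x
  rw [← integral_inner hf]

variable {G : Type*} [Group G] [TopologicalSpace G] [IsTopologicalGroup G]
  [LocallyCompactSpace G] [MeasurableSpace G] [BorelSpace G]
  {H : Type*} [NormedAddCommGroup H] [InnerProductSpace ℂ H]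

theorem integrable_ofReal_smul {E : Type*} [NormedAddCommGroup E] [NormedSpace ℂ E]
    (w : C_c(G, ℝ)) {f : G → E} (hf : Continuous f) :
    Integrable (fun z => (w z : ℂ) • f z) (haar : Measure G) := by
  have hw : Continuous fun z => (w z : ℂ) := by fun_prop
  refine (hw.smul hf).integrable_of_hasCompactSupport
    (HasCompactSupport.intro w.hasCompactSupport fun z hz => ?_)
  simp [image_eq_zero_of_notMem_tsupport hz]

/-- The vector `∫ w(z) α(z) ⊗ λ(z) e dz`. -/
noncomputable def diagVec (w : C_c(G, ℝ)) (α : G → H) (e : L2 G) : HilbertTensor H (L2 G) :=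
  ∫ z, (w z : ℂ) • HilbertTensor.of (α z ⊗ₜ[ℂ] leftRegular.toHom z e) ∂(haar : Measure G)

theorem integrable_diagVec (w : C_c(G, ℝ)) {α : G → H} (hα : Continuous α) (e : L2 G) :
    Integrable (fun z => (w z : ℂ) • HilbertTensor.of (α z ⊗ₜ[ℂ] leftRegular.toHom z e))
      (haar : Measure G) :=
  integrable_ofReal_smul w
    (HilbertTensor.continuous_of_tmul hα (leftRegular.continuous_orbit e))

/-- The second tensor factor contributes only the kernel `⟨λ(z)e, λ(z')e⟩ = q(z⁻¹z')`, which for `q`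
concentrated at the identity localises the double integral on the diagonal. -/
theorem inner_diagVec_self (w : C_c(G, ℝ)) {α : G → H} (hα : Continuous α) {e : L2 G} {q : G → ℝ}
    (hq : ∀ x, inner ℂ e (leftRegular.toHom x e) = (q x : ℂ)) :
    inner ℂ (diagVec w α e) (diagVec w α e) =
      ∫ z, ∫ z', (w z * w z' * q (z⁻¹ * z') : ℂ) * inner ℂ (α z) (α z')
        ∂(haar : Measure G) ∂(haar : Measure G) := by
  rw [diagVec, inner_integral_integral (integrable_diagVec w hα e)]
  congr 1; ext z
  congr 1; ext z'
  rw [inner_smul_left, inner_smul_right, HilbertTensor.inner_of_tmul, inner_toHom_left,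
    ← toHom_mul_apply, hq, Complex.conj_ofReal]
  ring

theorem coefficient_inv {e : L2 G} {q : G → ℝ}
    (hq : ∀ x, inner ℂ e (leftRegular.toHom x e) = (q x : ℂ)) (x : G) : q x⁻¹ = q x := by
  have h : ((q x⁻¹ : ℝ) : ℂ) = q x := by
    rw [← hq, ← inner_toHom_left, ← inner_conj_symm, hq, Complex.conj_ofReal]
  exact_mod_cast h

/-- The Schur test for the vectors `∫ w(z) α(z) ⊗ λ(z) e dz`. -/
theorem norm_sq_diagVec_le (w : C_c(G, ℝ)) {α : G → H} (hα : Continuous α) {e : L2 G}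
    {q : C_c(G, ℝ)} (hq : ∀ x, inner ℂ e (leftRegular.toHom x e) = (q x : ℂ)) (hq0 : 0 ≤ q)
    (hq1 : ∫ x, q x ∂(haar : Measure G) = 1) :
    ‖diagVec w α e‖ ^ 2 ≤ ∫ z, w z ^ 2 * ‖α z‖ ^ 2 ∂(haar : Measure G) := by
  have hq0' : ∀ x, 0 ≤ q x := hq0
  have hac : Continuous fun z => |w z| * ‖α z‖ := by fun_prop
  have hacs : HasCompactSupport fun z => |w z| * ‖α z‖ :=
    (w.hasCompactSupport.comp_left abs_zero).mul_right
  obtain ⟨a, ha⟩ : ∃ a : C_c(G, ℝ), ∀ z, a z = |w z| * ‖α z‖ := ⟨ccOf _ hac hacs, fun _ => rfl⟩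
  have ha0 : ∀ z, 0 ≤ a z := fun z => by rw [ha]; positivity
  have hint : ∀ z, Integrable (fun z' => a z' ^ 2 * q (z⁻¹ * z')) (haar : Measure G) := fun z =>
    Continuous.integrable_of_hasCompactSupport (by fun_prop)
      (hasCompactSupport_mul_left q.hasCompactSupport z⁻¹).mul_left
  have hint1 : ∀ z, Integrable (fun z' => a z ^ 2 * q (z⁻¹ * z')) (haar : Measure G) := fun z =>
    Continuous.integrable_of_hasCompactSupport (by fun_prop)
      (hasCompactSupport_mul_left q.hasCompactSupport z⁻¹).mul_left
  have hqz : ∀ z, ∫ z', q (z⁻¹ * z') ∂(haar : Measure G) = 1 := fun z => by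
    rw [integral_mul_left_eq_self (fun x => q x) z⁻¹, hq1]
  have hI1 : ∀ z, ∫ z', a z ^ 2 * q (z⁻¹ * z') ∂(haar : Measure G) = a z ^ 2 := fun z => by
    rw [integral_const_mul, hqz, mul_one]
  have ha2c : HasCompactSupport fun z => a z ^ 2 :=
    a.hasCompactSupport.comp_left (g := fun r => r ^ 2) (by norm_num)
  have hcs : HasCompactSupport
      (Function.uncurry fun z z' => a z' ^ 2 * q (z⁻¹ * z') : G × G → ℝ) := by
    refine HasCompactSupport.intro ((a.hasCompactSupport.isCompact.mul
      q.hasCompactSupport.isCompact.inv).prod a.hasCompactSupport.isCompact) fun p hp => ?_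
    by_contra h
    have h1 : a p.2 ≠ 0 := fun h' => h (by simp [Function.uncurry, h'])
    have h2 : q (p.1⁻¹ * p.2) ≠ 0 := fun h' => h (by simp [Function.uncurry, h'])
    exact hp ⟨⟨p.2, subset_tsupport _ h1, (p.1⁻¹ * p.2)⁻¹,
      Set.inv_mem_inv.2 (subset_tsupport _ h2), by simp⟩, subset_tsupport _ h1⟩
  have hcc : Continuous (Function.uncurry fun z z' => a z' ^ 2 * q (z⁻¹ * z') : G × G → ℝ) := by
    simp only [Function.uncurry_def]
    fun_prop
  -- Rows of the kernel `q(z⁻¹z')` integrate to 1 by left invariance, and columns do too because the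
  -- real coefficient `q` is symmetric under inversion.
  have hI2 : ∫ z, ∫ z', a z' ^ 2 * q (z⁻¹ * z') ∂(haar : Measure G) ∂(haar : Measure G) =
      ∫ z, a z ^ 2 ∂(haar : Measure G) := by
    rw [integral_integral_swap_of_hasCompactSupport hcc hcs]
    congr 1; ext z
    refine Eq.trans ?_ (hI1 z)
    congr 1; ext z'
    rw [← coefficient_inv hq (z⁻¹ * z'), mul_inv_rev, inv_inv]
  have hint2 : Integrable (fun z => ∫ z', a z' ^ 2 * q (z⁻¹ * z') ∂(haar : Measure G))
      (haar : Measure G) := by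
    have hk := a.hasCompactSupport.isCompact.mul q.hasCompactSupport.isCompact.inv
    refine Continuous.integrable_of_hasCompactSupport ?_ (HasCompactSupport.intro hk fun z hz => ?_)
    · exact continuous_integral_of_locally_compact_support hcc fun _ _ =>
        ⟨tsupport a, a.hasCompactSupport, fun _ _ z hz => by
          rw [image_eq_zero_of_notMem_tsupport hz]; ring⟩
    · rw [← integral_zero G ℝ (μ := haar)]
      congr 1; ext z'
      by_contra h
      have h1 : a z' ≠ 0 := fun h' => h (by simp [h'])
      have h2 : q (z⁻¹ * z') ≠ 0 := fun h' => h (by simp [h'])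
      exact hz ⟨z', subset_tsupport _ h1, (z⁻¹ * z')⁻¹, Set.inv_mem_inv.2 (subset_tsupport _ h2),
        by simp⟩
  have hint3 : Integrable (fun z => a z ^ 2) (haar : Measure G) :=
    Continuous.integrable_of_hasCompactSupport (by fun_prop) ha2c
  have key : ‖inner ℂ (diagVec w α e) (diagVec w α e)‖ ≤ ∫ z, a z ^ 2 ∂(haar : Measure G) := by
    rw [inner_diagVec_self w hα hq]
    -- Cauchy–Schwarz for `⟨α z, α z'⟩`, then `a z * a z' ≤ (a z ^ 2 + a z' ^ 2) / 2`, separates the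
    -- two variables.
    calc _ ≤ ∫ z, (a z ^ 2 + ∫ z', a z' ^ 2 * q (z⁻¹ * z') ∂(haar : Measure G)) / 2
          ∂(haar : Measure G) := by
          refine norm_integral_le_of_norm_le ((hint3.add hint2).div_const 2)
            (ae_of_all _ fun z => ?_)
          rw [← hI1 z, ← integral_add (hint1 z) (hint z), ← integral_div]
          refine norm_integral_le_of_norm_le (((hint1 z).add (hint z)).div_const 2)
            (ae_of_all _ fun z' => ?_)
          have hz := hq0' (z⁻¹ * z')
          have hn := norm_inner_le_norm (𝕜 := ℂ) (α z) (α z')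
          rw [norm_mul, norm_mul, norm_mul, Complex.norm_real, Complex.norm_real,
            Complex.norm_real, Real.norm_of_nonneg hz, Real.norm_eq_abs, Real.norm_eq_abs]
          calc _ ≤ |w z| * |w z'| * q (z⁻¹ * z') * (‖α z‖ * ‖α z'‖) := by gcongr
            _ = a z * a z' * q (z⁻¹ * z') := by rw [ha, ha]; ring
            _ ≤ (a z ^ 2 + a z' ^ 2) / 2 * q (z⁻¹ * z') := by
              gcongr
              nlinarith [sq_nonneg (a z - a z')]
            _ = _ := by ring
      _ = _ := by
          rw [integral_div, integral_add hint3 hint2, hI2]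
          ring
  have e1 : ∀ z, w z ^ 2 * ‖α z‖ ^ 2 = a z ^ 2 := fun z => by
    rw [ha, mul_pow, sq_abs]
  simp only [e1]
  refine le_trans (le_of_eq ?_) key
  rw [inner_self_eq_norm_sq_to_K]
  simp

/-- As `q` shrinks to the identity, the double integral for `‖diagVec w α e‖²` tends to its diagonal
value. The neighbourhood depends only on `w`, `α` and `ε`, so `e` can be chosen after them. -/
theorem le_norm_sq_diagVec (w : C_c(G, ℝ)) {α : G → H} (hα : Continuous α) {ε : ℝ} (hε : 0 < ε) :
    ∃ V ∈ 𝓝 (1 : G), ∀ (e : L2 G) (q : C_c(G, ℝ)),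
      (∀ x, inner ℂ e (leftRegular.toHom x e) = (q x : ℂ)) → 0 ≤ q →
      (∫ x, q x ∂(haar : Measure G) = 1) → (∀ x, q x ≠ 0 → x ∈ V) →
      ∫ z, w z ^ 2 * ‖α z‖ ^ 2 ∂(haar : Measure G) - ε ≤ ‖diagVec w α e‖ ^ 2 := by
  let Θ : G → G → ℂ := fun z z' => (w z * w z' : ℂ) * inner ℂ (α z) (α z')
  have hΘ : Continuous fun p : G × G => Θ p.1 p.2 := by
    have h1 : Continuous fun p : G × G => (w p.1 * w p.2 : ℂ) := by fun_prop
    exact h1.mul ((hα.comp continuous_fst).inner (hα.comp continuous_snd))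
  set K := tsupport w with hK
  have hKc : IsCompact K := w.hasCompactSupport
  -- A pointwise error `δ` on `K` integrates to at most `ε`; the `+ 1` covers `K` of measure zero.
  set δ : ℝ := ε / ((haar : Measure G).real K + 1) with hδ
  have hpos : 0 < (haar : Measure G).real K + 1 := by positivity
  have hδ0 : 0 < δ := div_pos hε hpos
  -- Compactness of `K` makes continuity at `u = 1` uniform in `z`.
  have hnhds : {u : G | ∀ z ∈ K, ‖Θ z (z * u) - Θ z z‖ < δ} ∈ 𝓝 (1 : G) := by
    refine hKc.eventually_forall_of_forall_eventually
      (P := fun u z => ‖Θ z (z * u) - Θ z z‖ < δ) fun z _ => ?_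
    have hc : Continuous fun p : G × G => ‖Θ p.2 (p.2 * p.1) - Θ p.2 p.2‖ := by
      have h1 : Continuous fun p : G × G => Θ p.2 (p.2 * p.1) :=
        hΘ.comp (by fun_prop : Continuous fun p : G × G => (p.2, p.2 * p.1))
      have h2 : Continuous fun p : G × G => Θ p.2 p.2 :=
        hΘ.comp (by fun_prop : Continuous fun p : G × G => (p.2, p.2))
      exact (h1.sub h2).norm
    exact hc.continuousAt.eventually_lt_const (by simpa using hδ0)
  refine ⟨_, hnhds, fun e q hq hq0 hq1 hqV => ?_⟩
  have hq0' : ∀ x, 0 ≤ q x := hq0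
  have hcs : HasCompactSupport fun z => Θ z z := by
    refine HasCompactSupport.intro hKc fun z hz => ?_
    simp [Θ, image_eq_zero_of_notMem_tsupport hz]
  have hΘd : Continuous fun z => Θ z z :=
    hΘ.comp (by fun_prop : Continuous fun z : G => (z, z))
  have hi1 : Integrable (fun z => Θ z z) (haar : Measure G) :=
    hΘd.integrable_of_hasCompactSupport hcs
  have e1 : ∫ z, Θ z z ∂(haar : Measure G) =
      ((∫ z, w z ^ 2 * ‖α z‖ ^ 2 ∂(haar : Measure G) : ℝ) : ℂ) := by
    rw [← integral_complex_ofReal]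
    congr 1; ext z
    simp only [Θ, inner_self_eq_norm_sq_to_K]
    push_cast
    rw [pow_two (w z : ℂ)]
    rfl
  have hJ : ∀ z, ∫ z', (w z * w z' * q (z⁻¹ * z') : ℂ) * inner ℂ (α z) (α z')
      ∂(haar : Measure G) = ∫ u, (q u : ℂ) * Θ z (z * u) ∂(haar : Measure G) := by
    intro z
    rw [← integral_mul_left_eq_self _ z]
    congr 1; ext u
    simp only [Θ, inv_mul_cancel_left]
    ring
  have hdiff : ∀ z, ‖∫ u, (q u : ℂ) * Θ z (z * u) ∂(haar : Measure G) - Θ z z‖ ≤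
      K.indicator (fun _ => δ) z := by
    intro z
    by_cases hz : z ∈ K
    · rw [Set.indicator_of_mem hz]
      have hqi : Integrable (fun u => (q u : ℂ)) (haar : Measure G) := q.integrable.ofReal
      have h1 : Θ z z = ∫ u, (q u : ℂ) * Θ z z ∂(haar : Measure G) := by
        rw [integral_mul_const, integral_complex_ofReal, hq1]
        simp
      have hi : Integrable (fun u => (q u : ℂ) * Θ z (z * u)) (haar : Measure G) := by
        refine Continuous.integrable_of_hasCompactSupport ?_
          (q.hasCompactSupport.comp_left (g := fun r : ℝ => (r : ℂ))
            Complex.ofReal_zero).mul_right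
        have h1 : Continuous fun u : G => Θ z (z * u) :=
          hΘ.comp (by fun_prop : Continuous fun u : G => (z, z * u))
        have h2 : Continuous fun u => (q u : ℂ) := by fun_prop
        exact h2.mul h1
      rw [h1, ← integral_sub hi (hqi.mul_const _)]
      have : δ = ∫ u, q u * δ ∂(haar : Measure G) := by rw [integral_mul_const, hq1, one_mul]
      rw [this]
      refine norm_integral_le_of_norm_le (q.integrable.mul_const δ) (ae_of_all _ fun u => ?_)
      rw [← mul_sub, norm_mul, Complex.norm_real, Real.norm_of_nonneg (hq0' u)]
      by_cases hu : q u = 0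
      · simp [hu]
      · exact mul_le_mul_of_nonneg_left (hqV u hu z hz).le (hq0' u)
    · have : ∀ z', Θ z z' = 0 := fun z' => by
        simp [Θ, image_eq_zero_of_notMem_tsupport hz]
      simp [this, hz]
  have hi2 : Integrable (fun z => ∫ u, (q u : ℂ) * Θ z (z * u) ∂(haar : Measure G))
      (haar : Measure G) := by
    refine Continuous.integrable_of_hasCompactSupport ?_
      (HasCompactSupport.intro hKc fun z hz => ?_)
    · refine continuous_integral_of_locally_compact_support
        (f := fun z u => (q u : ℂ) * Θ z (z * u)) ?_ fun _ _ =>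
        ⟨tsupport q, q.hasCompactSupport, fun _ _ u hu => by
          rw [image_eq_zero_of_notMem_tsupport hu]; simp⟩
      have h1 : Continuous fun p : G × G => Θ p.1 (p.1 * p.2) :=
        hΘ.comp (by fun_prop : Continuous fun p : G × G => (p.1, p.1 * p.2))
      have h2 : Continuous fun p : G × G => (q p.2 : ℂ) := by fun_prop
      exact h2.mul h1
    · have : ∀ z', Θ z z' = 0 := fun z' => by
        simp [Θ, image_eq_zero_of_notMem_tsupport hz]
      simp [this]
  have hfin : ‖inner ℂ (diagVec w α e) (diagVec w α e) -
      ((∫ z, w z ^ 2 * ‖α z‖ ^ 2 ∂(haar : Measure G) : ℝ) : ℂ)‖ ≤ ε := by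
    rw [← e1, inner_diagVec_self w hα hq]
    simp only [hJ]
    rw [← integral_sub hi2 hi1]
    have hKm : MeasurableSet K := (isClosed_tsupport _).measurableSet
    calc _ ≤ ∫ z, K.indicator (fun _ => δ) z ∂(haar : Measure G) :=
          norm_integral_le_of_norm_le
            ((integrable_indicator_iff hKm).2 (integrableOn_const hKc.measure_lt_top.ne))
            (ae_of_all _ hdiff)
      _ = (haar : Measure G).real K * δ := by
          rw [integral_indicator hKm, setIntegral_const, smul_eq_mul]
      _ ≤ ε := by
          rw [hδ, mul_div_assoc', div_le_iff₀ hpos]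
          nlinarith [measureReal_nonneg (μ := (haar : Measure G)) (s := K)]
  rw [inner_self_eq_norm_sq_to_K] at hfin
  have h3 : ‖diagVec w α e‖ ^ 2 - ∫ z, w z ^ 2 * ‖α z‖ ^ 2 ∂(haar : Measure G) ≥ -ε := by
    have := (abs_le.1 ((Complex.abs_re_le_norm _).trans hfin)).1
    simpa [← Complex.ofReal_pow] using this
  linarith

end DiagonalVectors

/-! ### Approximating the representation `λ · ρ` by tensor products -/

section Approximation

open UnitaryRep
open scoped Pointwise

/-- The pull-back of a unitary representation along a continuous homomorphism. -/
noncomputable def UnitaryRep.comp {G G' H : Type*} [Group G] [TopologicalSpace G] [Group G']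
    [TopologicalSpace G'] [NormedAddCommGroup H] [InnerProductSpace ℂ H] (π : UnitaryRep G' H)
    (φ : G →* G') (hφ : Continuous φ) : UnitaryRep G H where
  toHom := π.toHom.comp φ
  continuous_orbit ξ := (π.continuous_orbit ξ).comp hφ

section OneGroup

variable {G : Type*} [Group G] [TopologicalSpace G] [IsTopologicalGroup G]
  [LocallyCompactSpace G] [MeasurableSpace G] [BorelSpace G]

theorem norm_sq_ccL2 (F : C_c(G, ℂ)) :
    ((‖ccL2 F‖ ^ 2 : ℝ) : ℂ) = ∫ x, starRingEnd ℂ (F x) * F x ∂(haar : Measure G) := by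
  rw [← inner_ccL2, inner_self_eq_norm_sq_to_K]
  simp

theorem convCc_starCc_one [T2Space G] (F : C_c(G, ℂ)) :
    convCc (starCc F) F 1 = ((‖ccL2 F‖ ^ 2 : ℝ) : ℂ) := by
  have h := integral_inversion (ccOf (fun x => starRingEnd ℂ (F x) * F x)
    ((Complex.continuous_conj.comp F.continuous).mul F.continuous) F.hasCompactSupport.mul_left)
  simp only [ccOf_apply] at h
  rw [norm_sq_ccL2, ← h, convCc, superpose_apply]
  congr 1; ext x
  rw [starCc_apply, leftCc_apply, mul_one, mul_assoc]

/-- `‖π(F)ξ‖² = ⟨ξ, π(F* ∗ F)ξ⟩`. With `convCc_starCc_one`, a coefficient concentrated at 1 makes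
this nearly a multiple of `‖F‖²`. -/
theorem norm_sq_integrated [T2Space G] {H : Type*} [NormedAddCommGroup H] [InnerProductSpace ℂ H]
    [CompleteSpace H] (π : UnitaryRep G H) (F : C_c(G, ℂ)) (ξ : H) {k : G → ℝ}
    (hk : ∀ u, inner ℂ ξ (π.toHom u ξ) = (k u : ℂ)) :
    ((‖π.integrated F ξ‖ ^ 2 : ℝ) : ℂ) =
      ∫ u, convCc (starCc F) F u * (k u : ℂ) ∂(haar : Measure G) := by
  simp only [← hk]
  rw [← π.inner_integrated, π.integrated_convCc, π.integrated_starCc,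
    ContinuousLinearMap.star_eq_adjoint, mul_apply_eq_comp,
    ContinuousLinearMap.adjoint_inner_right, inner_self_eq_norm_sq_to_K]
  simp

/-- The comparison integral carries a cutoff `θ` because `k` will be pulled back along a
homomorphism and need not have compact support. The hypothesis only concerns points where `k` does
not vanish. -/
theorem norm_integral_mul_sub_le (E : C_c(G, ℂ)) (θ : C_c(G, ℝ)) {k : G → ℝ} (hk : Continuous k)
    (hk0 : ∀ u, 0 ≤ k u) {δ : ℝ} (h : ∀ u, k u ≠ 0 → ‖E u - E 1 * θ u‖ ≤ δ * θ u) :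
    ‖∫ u, E u * (k u : ℂ) ∂(haar : Measure G) -
      E 1 * ((∫ u, θ u * k u ∂(haar : Measure G) : ℝ) : ℂ)‖ ≤
      δ * ∫ u, θ u * k u ∂(haar : Measure G) := by
  have h1 : Integrable (fun u => E u * (k u : ℂ)) (haar : Measure G) :=
    Continuous.integrable_of_hasCompactSupport (by fun_prop) E.hasCompactSupport.mul_right
  have h2 : Integrable (fun u => θ u * k u) (haar : Measure G) :=
    Continuous.integrable_of_hasCompactSupport (by fun_prop) θ.hasCompactSupport.mul_right
  rw [← integral_complex_ofReal, ← integral_const_mul]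
  have h3 : Integrable (fun u => E 1 * ((θ u * k u : ℝ) : ℂ)) (haar : Measure G) := by
    have h : Integrable (fun u => ((θ u * k u : ℝ) : ℂ)) (haar : Measure G) := h2.ofReal
    exact h.const_mul _
  rw [← integral_sub h1 h3, ← integral_const_mul]
  refine norm_integral_le_of_norm_le (h2.const_mul δ) (ae_of_all _ fun u => ?_)
  by_cases hu : k u = 0
  · simp [hu]
  · have e : E u * (k u : ℂ) - E 1 * ((θ u * k u : ℝ) : ℂ) = (E u - E 1 * θ u) * (k u : ℂ) := by
      push_cast; ring
    rw [e, norm_mul, Complex.norm_real, Real.norm_of_nonneg (hk0 u), ← mul_assoc]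
    exact mul_le_mul_of_nonneg_right (h u hu) (hk0 u)

/-- Conjugation by `t` scales Haar measure by a value of the modular function, and `θ` does not
notice the conjugation where `k` lives. This is where the modular function of `G` enters the
approximating vector. -/
theorem integral_mul_conj (θ k : G → ℝ) (t : G)
    (h : ∀ u, k u ≠ 0 → θ (t⁻¹ * u * t) = θ u) :
    ∫ u, θ u * k (t * u * t⁻¹) ∂(haar : Measure G) =
      modularFn t * ∫ u, θ u * k u ∂(haar : Measure G) := by
  have h1 := integral_mul_right_haar_real
    (fun x => θ (t⁻¹ * (t * x) * t) * k (t * x)) t⁻¹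
  have h2 := integral_mul_left_eq_self (μ := (haar : Measure G))
    (fun x => θ (t⁻¹ * x * t) * k x) t
  rw [h2, modularFn_inv, inv_inv] at h1
  have e1 : ∀ u, θ (t⁻¹ * u * t) * k u = θ u * k u := fun u => by
    by_cases hu : k u = 0
    · simp [hu]
    · rw [h u hu]
  rw [integral_congr_ae (ae_of_all _ e1)] at h1
  rw [← h1]
  congr 1; ext u
  rw [show t⁻¹ * (t * (u * t⁻¹)) * t = u by group, mul_assoc t u]

/-- There are normalised positive definite coefficients of the left regular representation with
arbitrarily small support. -/
theorem exists_leftRegular_coefficient_integral_eq_one {V : Set G} (hV : V ∈ 𝓝 (1 : G)) :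
    ∃ (e : L2 G) (q : C_c(G, ℝ)), (∀ x, inner ℂ e (leftRegular.toHom x e) = (q x : ℂ)) ∧ 0 ≤ q ∧
      (∫ x, q x ∂(haar : Measure G) = 1) ∧ ∀ x, q x ≠ 0 → x ∈ V := by
  obtain ⟨b, k, hk0, hk1, hkV, hbk⟩ := exists_leftRegular_coefficient_support_subset hV
  have hk0' : ∀ x, 0 ≤ k x := hk0
  set I : ℝ := ∫ x, k x ∂(haar : Measure G) with hI
  have hIpos : 0 < I :=
    k.continuous.integral_pos_of_hasCompactSupport_nonneg_nonzero k.hasCompactSupport hk0 hk1.ne'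
  refine ⟨(((√I)⁻¹ : ℝ) : ℂ) • b, I⁻¹ • k, fun x => ?_, fun x => ?_, ?_, fun x hx => hkV x ?_⟩
  · rw [map_smul, inner_smul_left, inner_smul_right, hbk, Complex.conj_ofReal, ← mul_assoc,
      ← Complex.ofReal_mul, ← mul_inv, Real.mul_self_sqrt hIpos.le]
    simp
  · exact mul_nonneg (inv_nonneg.2 hIpos.le) (hk0' x)
  · simp only [CompactlySupportedContinuousMap.coe_smul, Pi.smul_apply, smul_eq_mul,
      integral_const_mul]
    exact inv_mul_cancel₀ hIpos.ne'
  · intro h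
    exact hx (by simp [h])

end OneGroup

variable {G : Type*} [Group G] [TopologicalSpace G] [IsTopologicalGroup G]
  [LocallyCompactSpace G] [MeasurableSpace G] [BorelSpace G] [T2Space G]
  {G' : Type*} [Group G'] [TopologicalSpace G'] [IsTopologicalGroup G']
  [LocallyCompactSpace G'] [MeasurableSpace G'] [BorelSpace G']

theorem tensorOp_diagVec {H : Type*} [NormedAddCommGroup H] [InnerProductSpace ℂ H]
    (A : H →L[ℂ] H) (B : L2 G' →L[ℂ] L2 G') (w : C_c(G', ℝ)) {α : G' → H} (hα : Continuous α)
    (e : L2 G') :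
    tensorOp A B (diagVec w α e) = ∫ z, (w z : ℂ) •
      HilbertTensor.of (A (α z) ⊗ₜ[ℂ] B (leftRegular.toHom z e)) ∂(haar : Measure G') := by
  rw [diagVec, ← (tensorOp A B).integral_comp_comm (integrable_diagVec w hα e)]
  simp only [map_smul, tensorOp_tmul]

theorem tensorOp_one_diagVec {H : Type*} [NormedAddCommGroup H] [InnerProductSpace ℂ H]
    (A : H →L[ℂ] H) (w : C_c(G', ℝ)) {α : G' → H} (hα : Continuous α) (e : L2 G') :
    tensorOp A 1 (diagVec w α e) = diagVec w (fun z => A (α z)) e :=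
  tensorOp_diagVec A 1 w hα e

/-- The operator of a unitary representation as a continuous linear map. -/
noncomputable def UnitaryRep.op {G H : Type*} [Group G] [TopologicalSpace G]
    [NormedAddCommGroup H] [InnerProductSpace ℂ H] (π : UnitaryRep G H) (s : G) : H →L[ℂ] H :=
  (π.toHom s).toContinuousLinearEquiv

theorem UnitaryRep.op_apply {G H : Type*} [Group G] [TopologicalSpace G]
    [NormedAddCommGroup H] [InnerProductSpace ℂ H] (π : UnitaryRep G H) (s : G) (ξ : H) :
    π.op s ξ = π.toHom s ξ := rfl

/-- Left invariance of `dz` moves the translation by `s` from the second tensor factor to `w` and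
`α`. The two vectors then differ only in their weights; `c` will be `Δ(t)^{-1/2}`. -/
theorem tensorOp_op_diagVec_sub {H : Type*} [NormedAddCommGroup H] [InnerProductSpace ℂ H]
    (A : H →L[ℂ] H) (w : C_c(G', ℝ)) {α : G' → H} (hα : Continuous α) (e : L2 G') (s : G')
    (c : ℝ) :
    tensorOp A (leftRegular.op s) (diagVec w α e) -
        diagVec w (fun z => (c : ℂ) • A (α (s⁻¹ * z))) e =
      diagVec (leftCc s⁻¹ w - c • w) (fun z => A (α (s⁻¹ * z))) e := by
  have hA : Continuous fun z => A (α (s⁻¹ * z)) := by fun_prop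
  rw [tensorOp_diagVec _ _ _ hα]
  have h1 := integral_mul_left_eq_self (μ := (haar : Measure G')) (fun z => (w z : ℂ) •
    HilbertTensor.of (A (α z) ⊗ₜ[ℂ] leftRegular.op s (leftRegular.toHom z e))) s⁻¹
  rw [← h1, diagVec, diagVec]
  have i1 := integrable_diagVec (leftCc s⁻¹ w) hA e
  have i2 := integrable_diagVec w (hA.const_smul (c : ℂ)) e
  simp only [op_apply, ← toHom_mul_apply, mul_inv_cancel_left]
  refine (integral_sub i1 i2).symm.trans ?_
  congr 1; ext z
  simp only [leftCc_apply, CompactlySupportedContinuousMap.coe_sub, Pi.sub_apply,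
    CompactlySupportedContinuousMap.coe_smul, Pi.smul_apply, smul_eq_mul, Complex.ofReal_sub,
    Complex.ofReal_mul, sub_smul]
  rw [← TensorProduct.smul_tmul', map_smul, smul_smul, mul_comm (w z : ℂ)]

/-- The vectors implementing the approximation of `λ · ρ` by tensor products, along a homomorphism
into an amenable group which is injective enough. -/
theorem exists_approximating_vector
    (hG : ∀ x : G, x ≠ 1 →
      ∃ (G' : Type v) (_ : Group G') (_ : TopologicalSpace G') (_ : IsTopologicalGroup G')
        (_ : LocallyCompactSpace G') (_ : T2Space G'),
        IsAmenable G' ∧ ∃ φ : G →* G', Continuous φ ∧ φ x ≠ 1)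
    (F₁ F₂ : C_c(G, ℂ)) {S : Set G} (hS : IsCompact S) {ε : ℝ} (hε : 0 < ε) :
    ∃ (H : Type v) (_ : NormedAddCommGroup H) (_ : InnerProductSpace ℂ H) (_ : CompleteSpace H)
      (σ τ : UnitaryRep G H) (v : HilbertTensor H H),
      ‖tensorOp (σ.integrated F₁) 1 v‖ ^ 2 ≤ ‖ccL2 F₁‖ ^ 2 + ε ∧
      ‖ccL2 F₂‖ ^ 2 - ε ≤ ‖tensorOp (σ.integrated F₂) 1 v‖ ^ 2 ∧
      ∀ t ∈ S, ‖tensorOp (σ.integrated F₁) (τ.op t) v -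
        tensorOp (σ.integrated (rhoCc t F₁)) 1 v‖ ^ 2 ≤ ε := by
  set E : C_c(G, ℂ) → C_c(G, ℂ) := fun F => convCc (starCc F) F with hEdef
  have hE1 : ∀ F, E F 1 = ((‖ccL2 F‖ ^ 2 : ℝ) : ℂ) := convCc_starCc_one
  obtain ⟨K₀, hK₀, hK₀1⟩ := exists_compact_mem_nhds (1 : G)
  obtain ⟨θ', hθ1', -, hθc, hθ01⟩ := exists_continuous_one_zero_of_isCompact hK₀
    (isClosed_empty (X := G)) (Set.disjoint_empty _)
  obtain ⟨θ, hθ⟩ : ∃ θ : C_c(G, ℝ), ∀ u, θ u = θ' u :=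
    ⟨ccOf θ' θ'.continuous hθc, fun _ => rfl⟩
  have hθ0 : ∀ u, 0 ≤ θ u := fun u => by rw [hθ]; exact (hθ01 u).1
  have hθ1 : ∀ u ∈ K₀, θ u = 1 := fun u hu => by rw [hθ]; exact hθ1' hu
  -- One half of `ε` pays for replacing `E F` by its value at 1, the other for the diagonal
  -- approximation in the lower bound.
  set δ : ℝ := ε / 2 with hδ
  have hδ0 : 0 < δ := half_pos hε
  have hS0 : {u : G | ∀ t ∈ S, t⁻¹ * u * t ∈ K₀} ∈ 𝓝 (1 : G) := by
    refine hS.eventually_forall_of_forall_eventually (P := fun u t => t⁻¹ * u * t ∈ K₀)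
      fun t _ => ?_
    have hc : ContinuousAt (fun p : G × G => p.2⁻¹ * p.1 * p.2) (1, t) := by fun_prop
    exact hc.eventually (by simpa using hK₀1)
  have hEn : ∀ F, {u : G | ‖E F u - E F 1‖ < δ} ∈ 𝓝 (1 : G) := fun F => by
    have hc : Continuous fun u => ‖E F u - E F 1‖ := by fun_prop
    exact hc.continuousAt.eventually_lt_const (by simpa using hδ0)
  -- On `U` both `E F₁` and `E F₂` are within `δ` of their values at 1, and `θ` equals 1 at `u` and
  -- at all `t⁻¹ut` with `t ∈ S`.
  obtain ⟨U, hUsub, hUo, hU1⟩ := mem_nhds_iff.1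
    (inter_mem (inter_mem (hEn F₁) (hEn F₂)) (inter_mem hK₀1 hS0))
  -- Off `M` every integrand in `u` vanishes, including those with `θ(t⁻¹ut)`, `t ∈ S`. So `φ` only
  -- has to be nontrivial on the compact set `M \ U`.
  set M : Set G := tsupport (E F₁) ∪ tsupport (E F₂) ∪ tsupport θ ∪
    (fun p : G × G => p.1 * p.2 * p.1⁻¹) '' (S ×ˢ tsupport θ) with hM
  have hMc : IsCompact M :=
    (((E F₁).hasCompactSupport.isCompact.union (E F₂).hasCompactSupport).union
      θ.hasCompactSupport).union ((hS.prod θ.hasCompactSupport).image (by fun_prop))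
  obtain ⟨G', i1, i2, i3, i4, i5, hG', φ, hφ, hsep⟩ :=
    exists_amenable_hom_of_isCompact hG (hMc.diff hUo) fun h => h.2 hU1
  let _ : MeasurableSpace G' := borel G'
  have _ : BorelSpace G' := ⟨rfl⟩
  set c₁ : ℝ := ‖ccL2 F₁‖ ^ 2 with hc₁
  set c₂ : ℝ := ‖ccL2 F₂‖ ^ 2 with hc₂
  have hc1δ : 0 < c₁ + δ := by positivity
  have hφS : IsCompact (φ '' S) := hS.image hφ
  -- The error in `χ` will be multiplied by `c₁ + δ`, and the translations that occur are by `(φ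
  -- t)⁻¹`.
  obtain ⟨χ, hχ1, hχS⟩ := hG'.exists_almost_invariant hφS.inv (div_pos hε hc1δ)
  have hχc : IsCompact (tsupport χ) := χ.hasCompactSupport
  -- All relevant `z`: the support of `χ` and its translates by `φ t` and `(φ t)⁻¹`, `t ∈ S`.
  set A : Set G' := tsupport χ ∪ φ '' S * tsupport χ ∪ (φ '' S)⁻¹ * tsupport χ with hA
  have hAc : IsCompact A := (hχc.union (hφS.mul hχc)).union (hφS.inv.mul hχc)
  have hAχ : ∀ z, χ z ≠ 0 → z ∈ A := fun z hz => Or.inl (Or.inl (subset_tsupport _ hz))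
  -- Choosing `k` to vanish on this compact set avoiding 1 forces `k(z⁻¹φ(u)z)`, for `z ∈ A` and `u
  -- ∈ M`, to live on `u ∈ U`.
  set P : Set G' := (fun p : G' × G => p.1⁻¹ * φ p.2 * p.1) '' (A ×ˢ (M \ U)) with hP
  have hPc : IsCompact P := (hAc.prod (hMc.diff hUo)).image (by fun_prop)
  have hP1 : 1 ∉ P := by
    rintro ⟨⟨z, u⟩, ⟨_, hu⟩, h⟩
    refine hsep u hu ?_
    have h' : z⁻¹ * φ u * z = 1 := h
    calc φ u = z * (z⁻¹ * φ u * z) * z⁻¹ := by group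
      _ = 1 := by rw [h']; group
  obtain ⟨b, k, hk0, hk1, hkV, hbk⟩ := exists_leftRegular_coefficient_support_subset
    (hPc.isClosed.isOpen_compl.mem_nhds hP1)
  have hk0' : ∀ x, 0 ≤ k x := hk0
  let kz : G' → G → ℝ := fun z u => k (z⁻¹ * φ u * z)
  have hkzc : Continuous fun p : G' × G => kz p.1 p.2 := by fun_prop
  have hkzc' : ∀ z, Continuous (kz z) := fun z => by fun_prop
  have hkz0 : ∀ z u, 0 ≤ kz z u := fun z u => hk0' _
  have hkzU : ∀ z ∈ A, ∀ u, kz z u ≠ 0 → u ∈ M → u ∈ U := fun z hz u hu huM => by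
    by_contra huU
    exact hkV _ hu ⟨(z, u), ⟨hz, huM, huU⟩, rfl⟩
  let σ : UnitaryRep G (L2 G') := leftRegular.comp φ hφ
  have hσ : ∀ u ξ, σ.toHom u ξ = leftRegular.toHom (φ u) ξ := fun _ _ => rfl
  have hin : ∀ z u, inner ℂ (leftRegular.toHom z b) (σ.toHom u (leftRegular.toHom z b)) =
      (kz z u : ℂ) := fun z u => by
    rw [hσ, inner_toHom_left, ← toHom_mul_apply, ← toHom_mul_apply, hbk]
  -- The local mass of the pulled-back coefficient: `‖σ(F)λ(z)b‖²` will be `‖F‖² N z` up to `δ * N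
  -- z`.
  let N : G' → ℝ := fun z => ∫ u, θ u * kz z u ∂(haar : Measure G)
  have hNc : Continuous N := continuous_integral_of_locally_compact_support
    (f := fun z u => θ u * kz z u) ((θ.continuous.comp continuous_snd).mul hkzc) fun _ _ =>
      ⟨tsupport θ, θ.hasCompactSupport, fun _ _ u hu => by
        rw [image_eq_zero_of_notMem_tsupport hu, zero_mul]⟩
  have hN : ∀ z, 0 < N z := fun z => by
    refine (θ.continuous.mul (hkzc' z)).integral_pos_of_hasCompactSupport_nonneg_nonzero
      θ.hasCompactSupport.mul_right (fun u => mul_nonneg (hθ0 u) (hkz0 z u)) (x := 1) ?_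
    rw [hθ1 1 (mem_of_mem_nhds hK₀1), one_mul]
    simpa [kz] using hk1.ne'
  have hnorm : ∀ F, (∀ u ∉ M, E F u = 0) → (∀ u ∈ U, ‖E F u - E F 1‖ ≤ δ) → ∀ z ∈ A,
      |‖σ.integrated F (leftRegular.toHom z b)‖ ^ 2 - ‖ccL2 F‖ ^ 2 * N z| ≤ δ * N z := by
    intro F h1 h2 z hz
    have h3 := norm_integral_mul_sub_le (E F) θ (hkzc' z) (hkz0 z) (δ := δ) fun u hu => by
      by_cases huM : u ∈ M
      · have huU := hkzU z hz u hu huM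
        rw [hθ1 u (hUsub huU).2.1]
        simpa using h2 u huU
      · have hθu : θ u = 0 := image_eq_zero_of_notMem_tsupport fun h => huM (Or.inl (Or.inr h))
        simp [h1 u huM, hθu]
    rw [← norm_sq_integrated σ F _ (hin z), hE1, ← Complex.ofReal_mul, ← Complex.ofReal_sub,
      Complex.norm_real] at h3
    exact h3
  have hn1 := hnorm F₁
    (fun u hu => image_eq_zero_of_notMem_tsupport fun h => hu (Or.inl (Or.inl (Or.inl h))))
    (fun u hu => (hUsub hu).1.1.le)
  have hn2 := hnorm F₂
    (fun u hu => image_eq_zero_of_notMem_tsupport fun h => hu (Or.inl (Or.inl (Or.inr h))))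
    (fun u hu => (hUsub hu).1.2.le)
  have hNt : ∀ t ∈ S, ∀ z ∈ A, N ((φ t)⁻¹ * z) = modularFn t * N z := by
    intro t ht z hz
    have h := integral_mul_conj θ (kz z) t fun u hu => by
      by_cases huM : u ∈ M
      · have huU := hkzU z hz u hu huM
        rw [hθ1 u (hUsub huU).2.1, hθ1 _ ((hUsub huU).2.2 t ht)]
      · rw [image_eq_zero_of_notMem_tsupport (f := θ) (x := u)
          fun h => huM (Or.inl (Or.inr h)), image_eq_zero_of_notMem_tsupport (f := θ)]
        exact fun h => huM (Or.inr ⟨(t, t⁻¹ * u * t), ⟨ht, h⟩, by simp [mul_assoc]⟩)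
    rw [← h]
    change ∫ u, _ ∂_ = _
    congr 1; ext u
    simp [kz, mul_assoc]
  -- Dividing by `√N` makes `w² N = χ²`, which has integral 1, and by `hNt` compensates the modular
  -- factor.
  obtain ⟨w, hw⟩ : ∃ w : C_c(G', ℝ), ∀ z, w z = χ z * (√(N z))⁻¹ :=
    ⟨ccOf (fun z => χ z * (√(N z))⁻¹)
      (χ.continuous.mul ((Real.continuous_sqrt.comp hNc).inv₀ fun z => (Real.sqrt_pos.2 (hN z)).ne'))
      χ.hasCompactSupport.mul_right, fun _ => rfl⟩
  have hw2 : ∀ z, w z ^ 2 = χ z ^ 2 * (N z)⁻¹ := fun z => by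
    rw [hw, mul_pow, inv_pow, Real.sq_sqrt (hN z).le]
  have hb : Continuous fun z => leftRegular.toHom z b := leftRegular.continuous_orbit b
  have hα : ∀ F, Continuous fun z => σ.integrated F (leftRegular.toHom z b) := fun F =>
    (σ.integrated F).continuous.comp hb
  obtain ⟨V₂, hV₂, hlow⟩ := le_norm_sq_diagVec w (hα F₂) hδ0
  obtain ⟨e, q, hq, hq0, hq1, hqV⟩ := exists_leftRegular_coefficient_integral_eq_one hV₂
  have hχi : Integrable (fun z => χ z ^ 2) (haar : Measure G') :=
    Continuous.integrable_of_hasCompactSupport (by fun_prop)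
      (χ.hasCompactSupport.comp_left (g := fun r => r ^ 2) (by norm_num))
  refine ⟨L2 G', inferInstance, inferInstance, inferInstance, σ, σ,
    diagVec w (fun z => leftRegular.toHom z b) e, ?_, ?_, fun t ht => ?_⟩
  · rw [tensorOp_one_diagVec _ _ hb]
    refine (norm_sq_diagVec_le w (hα F₁) hq hq0 hq1).trans ?_
    calc _ ≤ ∫ z, χ z ^ 2 * (c₁ + δ) ∂(haar : Measure G') := by
          refine integral_mono_of_nonneg (ae_of_all _ fun z => by positivity)
            (hχi.mul_const _) (ae_of_all _ fun z => ?_)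
          by_cases hz : χ z = 0
          · simp [hw, hz]
          · have h := (abs_le.1 (hn1 z (hAχ z hz))).2
            have hNz := hN z
            change w z ^ 2 * _ ≤ χ z ^ 2 * (c₁ + δ)
            rw [hw2, mul_assoc]
            refine mul_le_mul_of_nonneg_left ?_ (sq_nonneg _)
            rw [inv_mul_le_iff₀ hNz]
            linarith
      _ = c₁ + δ := by rw [integral_mul_const, hχ1, one_mul]
      _ ≤ c₁ + ε := by linarith
  · rw [tensorOp_one_diagVec _ _ hb]
    refine le_trans ?_ (hlow e q hq hq0 hq1 hqV)
    have h : ∫ z, χ z ^ 2 * (c₂ - δ) ∂(haar : Measure G') ≤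
        ∫ z, w z ^ 2 * ‖σ.integrated F₂ (leftRegular.toHom z b)‖ ^ 2 ∂(haar : Measure G') := by
      refine integral_mono (hχi.mul_const _) ?_ fun z => ?_
      · refine Continuous.integrable_of_hasCompactSupport
          ((w.continuous.pow 2).mul ((hα F₂).norm.pow 2)) ?_
        exact (w.hasCompactSupport.comp_left (g := fun r => r ^ 2) (by norm_num)).mul_right
      · by_cases hz : χ z = 0
        · simp [hw, hz]
        · have h := (abs_le.1 (hn2 z (hAχ z hz))).1
          have hNz := hN z
          change χ z ^ 2 * (c₂ - δ) ≤ w z ^ 2 * _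
          rw [hw2, mul_assoc]
          refine mul_le_mul_of_nonneg_left ?_ (sq_nonneg _)
          rw [le_inv_mul_iff₀ hNz]
          linarith
    rw [integral_mul_const, hχ1, one_mul] at h
    linarith
  · have hs : 0 < √(modularFn t) := Real.sqrt_pos.2 (modularFn_pos t)
    have e1 : ∀ z, σ.integrated (rhoCc t F₁) (leftRegular.toHom z b) =
        (((√(modularFn t))⁻¹ : ℝ) : ℂ) •
          σ.integrated F₁ (leftRegular.toHom ((φ t)⁻¹ * z) b) := fun z => by
      rw [σ.integrated_rhoCc, hσ, ← toHom_mul_apply, map_inv]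
    rw [tensorOp_one_diagVec _ _ hb]
    simp only [e1]
    have e2 := tensorOp_op_diagVec_sub (σ.integrated F₁) w hb e (φ t) (√(modularFn t))⁻¹
    change ‖tensorOp (σ.integrated F₁) (leftRegular.op (φ t)) _ - _‖ ^ 2 ≤ ε
    rw [e2]
    have hα' : Continuous fun z => σ.integrated F₁ (leftRegular.toHom ((φ t)⁻¹ * z) b) :=
      (hα F₁).comp (continuous_const_mul _)
    refine (norm_sq_diagVec_le _ hα' hq hq0 hq1).trans ?_
    have hχti : Integrable (fun z => (χ ((φ t)⁻¹ * z) - χ z) ^ 2) (haar : Measure G') :=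
      Continuous.integrable_of_hasCompactSupport (by fun_prop)
        ((leftCc (φ t)⁻¹ χ - χ).hasCompactSupport.comp_left (g := fun r => r ^ 2) (by norm_num))
    calc _ ≤ ∫ z, (χ ((φ t)⁻¹ * z) - χ z) ^ 2 * (c₁ + δ) ∂(haar : Measure G') := by
          refine integral_mono_of_nonneg (ae_of_all _ fun z => by positivity)
            (hχti.mul_const _) (ae_of_all _ fun z => ?_)
          change ((w ((φ t)⁻¹ * z)) - (√(modularFn t))⁻¹ * w z) ^ 2 * _ ≤ _
          by_cases hz : z ∈ tsupport χ ∪ φ '' S * tsupport χ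
          · have hzA : z ∈ A := Or.inl hz
            have hNz := hN z
            have hΔ := modularFn_pos t
            have e3 : w ((φ t)⁻¹ * z) - (√(modularFn t))⁻¹ * w z =
                (χ ((φ t)⁻¹ * z) - χ z) * ((√(modularFn t))⁻¹ * (√(N z))⁻¹) := by
              rw [hw, hw, hNt t ht z hzA, Real.sqrt_mul hΔ.le, mul_inv]
              ring
            rw [e3, mul_pow, mul_pow, inv_pow, inv_pow, Real.sq_sqrt hΔ.le, Real.sq_sqrt hNz.le,
              mul_assoc]
            -- The norm estimate is available only on `A`; otherwise both values of `χ` vanish, by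
            -- the third piece of `A`.
            by_cases hz' : (φ t)⁻¹ * z ∈ A
            · refine mul_le_mul_of_nonneg_left ?_ (sq_nonneg _)
              have h := (abs_le.1 (hn1 _ hz')).2
              rw [hNt t ht z hzA] at h
              rw [← mul_inv, inv_mul_le_iff₀ (by positivity)]
              linarith
            · have h1 : χ ((φ t)⁻¹ * z) = 0 := by
                by_contra h
                exact hz' (hAχ _ h)
              have h2 : χ z = 0 := by
                by_contra h
                exact hz' (Or.inr ⟨_, Set.inv_mem_inv.2 ⟨t, ht, rfl⟩, z, subset_tsupport _ h, rfl⟩)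
              simp [h1, h2]
          · have h1 : χ ((φ t)⁻¹ * z) = 0 := by
              by_contra h
              exact hz (Or.inr ⟨φ t, ⟨t, ht, rfl⟩, _, subset_tsupport _ h, by simp⟩)
            have h2 : χ z = 0 := by
              by_contra h
              exact hz (Or.inl (subset_tsupport _ h))
            simp [hw, h1, h2]
      _ = (∫ z, (χ ((φ t)⁻¹ * z) - χ z) ^ 2 ∂(haar : Measure G')) * (c₁ + δ) :=
          integral_mul_const _ _
      _ ≤ ε / (c₁ + δ) * (c₁ + δ) :=
          mul_le_mul_of_nonneg_right (hχS _ (Set.inv_mem_inv.2 ⟨t, ht, rfl⟩)) hc1δ.le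
      _ = ε := div_mul_cancel₀ _ hc1δ.ne'

end Approximation

/-! ### The universal representation dominates all tensor products -/

section Universality

open UnitaryRep ContinuousLinearMap

section TensorMap

variable {H K H' K' H'' K'' : Type*} [NormedAddCommGroup H] [InnerProductSpace ℂ H]
  [NormedAddCommGroup K] [InnerProductSpace ℂ K] [NormedAddCommGroup H'] [InnerProductSpace ℂ H']
  [NormedAddCommGroup K'] [InnerProductSpace ℂ K'] [NormedAddCommGroup H'']
  [InnerProductSpace ℂ H''] [NormedAddCommGroup K''] [InnerProductSpace ℂ K'']

/-- The bounded operator `a ⊗ b` between Hilbert space tensor products. -/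
noncomputable def tensorMap (a : H →L[ℂ] H') (b : K →L[ℂ] K') :
    HilbertTensor H K →L[ℂ] HilbertTensor H' K' :=
  ((TensorProduct.mapL a b).completion :
    UniformSpace.Completion (H ⊗[ℂ] K) →L[ℂ] UniformSpace.Completion (H' ⊗[ℂ] K'))

theorem tensorMap_of (a : H →L[ℂ] H') (b : K →L[ℂ] K') (x : H ⊗[ℂ] K) :
    tensorMap a b (HilbertTensor.of x) = HilbertTensor.of (TensorProduct.mapL a b x) :=
  UniformSpace.Completion.map_coe (TensorProduct.mapL a b).uniformContinuous x

theorem tensorMap_tmul (a : H →L[ℂ] H') (b : K →L[ℂ] K') (ξ : H) (η : K) :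
    tensorMap a b (HilbertTensor.of (ξ ⊗ₜ η)) = HilbertTensor.of (a ξ ⊗ₜ b η) :=
  tensorMap_of a b (ξ ⊗ₜ η)

theorem tensorOp_eq_tensorMap (a : H →L[ℂ] H) (b : K →L[ℂ] K) : tensorOp a b = tensorMap a b := rfl

/-- Bounded operators agreeing on elementary tensors are equal. -/
theorem HilbertTensor.clm_ext {E : Type*} [NormedAddCommGroup E] [InnerProductSpace ℂ E]
    {S T : HilbertTensor H K →L[ℂ] E}
    (h : ∀ ξ η, S (HilbertTensor.of (ξ ⊗ₜ η)) = T (HilbertTensor.of (ξ ⊗ₜ η))) : S = T := by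
  ext x
  refine HilbertTensor.denseRange_of.induction_on (p := fun x => S x = T x) x
    (isClosed_eq S.continuous T.continuous) fun t => ?_
  induction t with
  | zero => simp
  | tmul ξ η => exact h ξ η
  | add x y hx hy => rw [map_add, map_add, map_add, hx, hy]

theorem tensorMap_comp (a : H' →L[ℂ] H'') (b : K' →L[ℂ] K'') (a' : H →L[ℂ] H')
    (b' : K →L[ℂ] K') :
    (tensorMap a b).comp (tensorMap a' b') = tensorMap (a.comp a') (b.comp b') :=
  HilbertTensor.clm_ext fun ξ η => by simp [tensorMap_tmul]

theorem norm_tensorMap_le (a : H →L[ℂ] H') (b : K →L[ℂ] K') : ‖tensorMap a b‖ ≤ ‖a‖ * ‖b‖ := by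
  refine ContinuousLinearMap.opNorm_le_bound _ (by positivity) fun x => ?_
  refine HilbertTensor.denseRange_of.induction_on
    (p := fun x => ‖tensorMap a b x‖ ≤ ‖a‖ * ‖b‖ * ‖x‖) x
    (isClosed_le (by fun_prop) (by fun_prop)) fun t => ?_
  rw [tensorMap_of, LinearIsometry.norm_map, LinearIsometry.norm_map]
  exact (ContinuousLinearMap.le_opNorm _ _).trans
    (mul_le_mul_of_nonneg_right (TensorProduct.norm_mapL_le a b) (norm_nonneg _))

end TensorMap

section Embedding

variable {G : Type u} [Group G] [TopologicalSpace G]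

/-- Bessel's inequality, since a summable family has countable support. -/
theorem Orthonormal.countable_inner_ne_zero {E ι : Type*} [NormedAddCommGroup E]
    [InnerProductSpace ℂ E] {b : ι → E} (hb : Orthonormal ℂ b) (x : E) :
    {i | inner ℂ (b i) x ≠ 0}.Countable := by
  refine (hb.inner_products_summable x).countable_support.mono fun i hi => ?_
  simpa using hi

/-- An orthonormal family none of whose members is orthogonal to all of the vectors `x p` has at
most `|J × ℕ|` members. -/
theorem Orthonormal.exists_injective_prod_nat {E ι J : Type*} [NormedAddCommGroup E]
    [InnerProductSpace ℂ E] {b : ι → E} (hb : Orthonormal ℂ b) {x : J → E}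
    (h : ∀ i, ∃ p, inner ℂ (b i) (x p) ≠ 0) : ∃ f : ι → J × ℕ, Function.Injective f := by
  choose p hp using h
  have hc : ∀ j : J, ∃ g : {i | inner ℂ (b i) (x j) ≠ 0} → ℕ, Function.Injective g := fun j =>
    have := (hb.countable_inner_ne_zero (x j)).to_subtype
    exists_injective_nat _
  choose g hg using hc
  refine ⟨fun i => (p i, g (p i) ⟨i, hp i⟩), fun i j hij => ?_⟩
  obtain ⟨h1, h2⟩ := Prod.mk.inj hij
  have key : ∀ (q : J) (hq : inner ℂ (b i) (x q) ≠ 0) (q' : J) (hq' : inner ℂ (b j) (x q') ≠ 0),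
      q = q' → g q ⟨i, hq⟩ = g q' ⟨j, hq'⟩ → i = j := by
    rintro q hq _ hq' rfl h
    exact congrArg Subtype.val (hg q h)
  exact key _ _ _ _ h1 h2

variable {H : Type*} [NormedAddCommGroup H] [InnerProductSpace ℂ H] [CompleteSpace H]

/-- The part of a unitary representation generated by countably many vectors embeds into
`ℓ²(G × ℕ)`. -/
theorem UnitaryRep.exists_partial_isometry (σ : UnitaryRep G H) (ξ : ℕ → H) :
    ∃ W : H →L[ℂ] lp (fun _ : G × ℕ => ℂ) 2, ‖W‖ ≤ 1 ∧
      (∀ g x, adjoint W (W (σ.toHom g x)) = σ.toHom g (adjoint W (W x))) ∧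
      (∀ x, W (adjoint W (W x)) = W x) ∧ ∀ i, adjoint W (W (ξ i)) = ξ i := by
  classical
  set D : Set H := Set.range fun p : G × ℕ => σ.toHom p.1 (ξ p.2) with hD
  set K : Submodule ℂ H := (Submodule.span ℂ D).topologicalClosure with hK
  have hDK : ∀ p : G × ℕ, σ.toHom p.1 (ξ p.2) ∈ K := fun p =>
    Submodule.le_topologicalClosure _ (Submodule.subset_span ⟨p, rfl⟩)
  have hKc : IsClosed (K : Set H) := Submodule.isClosed_topologicalClosure _
  have : CompleteSpace K := hKc.completeSpace_coe
  have hinv : ∀ g, ∀ x ∈ K, σ.toHom g x ∈ K := by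
    intro g
    have h : K ≤ K.comap ((σ.toHom g).toLinearEquiv : H →ₗ[ℂ] H) := by
      refine Submodule.topologicalClosure_minimal _ (Submodule.span_le.2 ?_)
        (hKc.preimage (σ.toHom g).continuous)
      rintro _ ⟨p, rfl⟩
      change σ.toHom g (σ.toHom p.1 (ξ p.2)) ∈ K
      rw [← toHom_mul_apply]
      exact hDK (g * p.1, p.2)
    exact h
  have hmap : ∀ g, K.map ((σ.toHom g).toLinearEquiv : H →ₗ[ℂ] H) = K := by
    intro g
    refine le_antisymm (Submodule.map_le_iff_le_comap.2 (hinv g)) fun x hx => ?_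
    exact ⟨σ.toHom g⁻¹ x, hinv _ x hx, σ.toHom_self_apply_inv g x⟩
  have hcomm : ∀ g x, K.starProjection (σ.toHom g x) = σ.toHom g (K.starProjection x) := by
    intro g x
    have h := Submodule.starProjection_map_apply (σ.toHom g) K (σ.toHom g x)
    rw [LinearIsometryEquiv.symm_apply_apply] at h
    rw [← h]
    congr 2
    exact (hmap g).symm
  obtain ⟨w, b, -⟩ := exists_hilbertBasis ℂ K
  -- A basis vector orthogonal to all generators of `K` would be orthogonal to itself.
  have hne : ∀ i, ∃ p : G × ℕ, inner ℂ ((b i : K) : H) (σ.toHom p.1 (ξ p.2)) ≠ 0 := by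
    intro i
    by_contra! h
    have h' : K ≤ (ℂ ∙ ((b i : K) : H))ᗮ := by
      refine Submodule.topologicalClosure_minimal _ (Submodule.span_le.2 ?_)
        (Submodule.isClosed_orthogonal _)
      rintro _ ⟨p, rfl⟩
      exact Submodule.mem_orthogonal_singleton_iff_inner_right.2 (h p)
    have h0 := Submodule.mem_orthogonal_singleton_iff_inner_right.1 (h' (b i).2)
    rw [inner_self_eq_zero] at h0
    have h1 := b.orthonormal.1 i
    rw [Submodule.coe_eq_zero.1 h0, norm_zero] at h1
    exact zero_ne_one h1
  have hbo : Orthonormal ℂ fun i => ((b i : K) : H) := b.orthonormal.comp_linearIsometry K.subtypeₗᵢ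
  obtain ⟨f₀, hf₀⟩ := hbo.exists_injective_prod_nat hne
  -- Counting yields an index in `(G × ℕ) × ℕ`; a pairing function merges the two copies of `ℕ`.
  let f : w → G × ℕ := fun i => ((f₀ i).1.1, Nat.pair (f₀ i).1.2 (f₀ i).2)
  have hf : Function.Injective f := fun i j hij => hf₀ (by
    obtain ⟨h1, h2⟩ := Prod.mk.inj hij
    obtain ⟨h3, h4⟩ := Nat.pair_eq_pair.1 h2
    exact Prod.ext (Prod.ext h1 h3) h4)
  have ho : Orthonormal ℂ fun i : w =>
      (lp.single 2 (f i) 1 : lp (fun _ : G × ℕ => ℂ) 2) := by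
    refine Orthonormal.comp (v := fun q : G × ℕ => (lp.single 2 q 1 : lp (fun _ : G × ℕ => ℂ) 2))
      ?_ f hf
    rw [orthonormal_iff_ite]
    intro p q
    rw [lp.inner_single_left]
    by_cases hpq : p = q
    · simp [hpq]
    · simp [hpq]
  let R : K →ₗᵢ[ℂ] lp (fun _ : G × ℕ => ℂ) 2 :=
    ho.orthogonalFamily.linearIsometry.comp b.repr.toLinearIsometry
  have hR : ∀ x, adjoint R.toContinuousLinearMap (R x) = x := fun x =>
    DFunLike.congr_fun R.adjoint_comp_self x
  let W : H →L[ℂ] lp (fun _ : G × ℕ => ℂ) 2 :=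
    R.toContinuousLinearMap.comp K.orthogonalProjectionOnto
  have hW : ∀ x, W x = R (K.orthogonalProjectionOnto x) := fun _ => rfl
  -- So `W` is a partial isometry with initial space `K`, and the remaining claims are statements
  -- about the projection onto the invariant subspace `K`.
  have hWW : ∀ x, adjoint W (W x) = K.starProjection x := by
    intro x
    rw [adjoint_comp, Submodule.adjoint_orthogonalProjectionOnto, hW, ContinuousLinearMap.comp_apply,
      hR]
    rfl
  refine ⟨W, ?_, fun g x => ?_, fun x => ?_, fun i => ?_⟩
  · refine opNorm_le_bound _ zero_le_one fun x => ?_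
    rw [hW, LinearIsometry.norm_map, one_mul]
    exact K.norm_orthogonalProjectionOnto_apply_le x
  · rw [hWW, hWW, hcomm]
  · rw [hWW, hW, hW]
    congr 1
    exact Submodule.orthogonalProjectionOnto_mem_subspace_eq_self (K.orthogonalProjectionOnto x)
  · rw [hWW]
    refine Submodule.starProjection_eq_self_iff.2 ?_
    simpa using hDK (1, i)

/-- The representation `1 + W (σ - 1) W*` for a partial isometry `W` whose initial space is
`σ`-invariant. -/
theorem UnitaryRep.exists_transport {E : Type*} [NormedAddCommGroup E] [InnerProductSpace ℂ E]
    [CompleteSpace E] (σ : UnitaryRep G H) (W : H →L[ℂ] E)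
    (h1 : ∀ g x, adjoint W (W (σ.toHom g x)) = σ.toHom g (adjoint W (W x)))
    (h2 : ∀ x, W (adjoint W (W x)) = W x) :
    ∃ π : UnitaryRep G E, ∀ g x, W (σ.toHom g x) = π.toHom g (W x) := by
  have h3 : ∀ y, adjoint W (W (adjoint W y)) = adjoint W y := fun y =>
    ext_inner_left ℂ fun x => by
      rw [adjoint_inner_right, ← adjoint_inner_left W, adjoint_inner_right, h2, adjoint_inner_right]
  let T : G → E → E := fun g y => (y - W (adjoint W y)) + W (σ.toHom g (adjoint W y))
  have hin : ∀ y z, inner ℂ (y - W (adjoint W y)) (W z) = 0 := fun y z => by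
    rw [← adjoint_inner_left, map_sub, h3, sub_self, inner_zero_left]
  have hnW : ∀ g y, ‖W (σ.toHom g (adjoint W y))‖ = ‖W (adjoint W y)‖ := fun g y => by
    have e : ∀ z, inner ℂ (W z) (W z) = inner ℂ (adjoint W (W z)) z := fun z => by
      rw [adjoint_inner_left]
    have h : inner ℂ (W (σ.toHom g (adjoint W y))) (W (σ.toHom g (adjoint W y))) =
        inner ℂ (W (adjoint W y)) (W (adjoint W y)) := by
      rw [e, e, h1, LinearIsometryEquiv.inner_map_map]
    rw [inner_self_eq_norm_sq_to_K, inner_self_eq_norm_sq_to_K] at h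
    have h' : ‖W (σ.toHom g (adjoint W y))‖ ^ 2 = ‖W (adjoint W y)‖ ^ 2 := by exact_mod_cast h
    exact (sq_eq_sq₀ (norm_nonneg _) (norm_nonneg _)).1 h'
  have hT1 : ∀ y, T 1 y = y := fun y => by simp [T]
  -- Pythagoras for the part of `y` orthogonal to the range of `W`, left fixed, and the part in that
  -- range, moved isometrically.
  have hTn : ∀ g y, ‖T g y‖ = ‖y‖ := fun g y => by
    have e1 := norm_add_sq_eq_norm_sq_add_norm_sq_of_inner_eq_zero (𝕜 := ℂ) _ _
      (hin y (σ.toHom g (adjoint W y)))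
    have e2 := norm_add_sq_eq_norm_sq_add_norm_sq_of_inner_eq_zero (𝕜 := ℂ) _ _
      (hin y (adjoint W y))
    rw [sub_add_cancel] at e2
    rw [hnW, ← e2] at e1
    exact (mul_self_inj (norm_nonneg _) (norm_nonneg _)).1 e1
  have hTa : ∀ g y, adjoint W (T g y) = σ.toHom g (adjoint W y) := fun g y => by
    simp only [T, map_add, map_sub, h3, h1, sub_self, zero_add]
  have hTm : ∀ s t y, T (s * t) y = T s (T t y) := fun s t y => by
    have e : T s (T t y) = (T t y - W (adjoint W (T t y))) + W (σ.toHom s (adjoint W (T t y))) := rfl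
    rw [e, hTa, ← toHom_mul_apply]
    simp only [T, add_sub_cancel_right]
  let L : G → (E →ₗᵢ[ℂ] E) := fun g =>
    { toFun := T g
      map_add' := fun x y => by simp only [T, map_add]; abel
      map_smul' := fun c x => by simp only [T, map_smul, smul_add, smul_sub, RingHom.id_apply]
      norm_map' := hTn g }
  let U : G →* (E ≃ₗᵢ[ℂ] E) :=
    { toFun := fun s =>
        { (L s) with
          invFun := L s⁻¹
          left_inv := fun y => by
            change T s⁻¹ (T s y) = y
            rw [← hTm, inv_mul_cancel, hT1]
          right_inv := fun y => by
            change T s (T s⁻¹ y) = y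
            rw [← hTm, mul_inv_cancel, hT1] }
      map_one' := by ext y; exact hT1 y
      map_mul' := fun s t => by ext y; exact hTm s t y }
  refine ⟨⟨U, fun y => ?_⟩, fun g x => ?_⟩
  · change Continuous fun g => (y - W (adjoint W y)) + W (σ.toHom g (adjoint W y))
    exact continuous_const.add (W.continuous.comp (σ.continuous_orbit _))
  · change W (σ.toHom g x) = (W x - W (adjoint W (W x))) + W (σ.toHom g (adjoint W (W x)))
    rw [h2, sub_self, zero_add, ← h1, h2]

theorem UnitaryRep.exists_isometry_directSum {ι : Type*} {H : ι → Type*}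
    [∀ i, NormedAddCommGroup (H i)] [∀ i, InnerProductSpace ℂ (H i)]
    (π : ∀ i, UnitaryRep G (H i)) (i : ι) :
    ∃ J : H i →ₗᵢ[ℂ] lp H 2, ∀ g x, J ((π i).toHom g x) = (directSum π).toHom g (J x) := by
  classical
  let J : H i →ₗᵢ[ℂ] lp H 2 :=
    { (lp.singleContinuousLinearMap ℂ H 2 i : H i →ₗ[ℂ] lp H 2) with
      norm_map' := fun x => lp.norm_single (by norm_num) i x }
  have hJ : ∀ x, J x = lp.single 2 i x := fun _ => rfl
  refine ⟨J, fun g x => ?_⟩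
  ext1
  funext j
  change _ = (π j).toHom g ((J x : lp H 2) j)
  rw [hJ, hJ]
  rcases eq_or_ne j i with rfl | hj
  · simp
  · simp [hj]

/-- The part of a unitary representation generated by countably many vectors embeds into the
universal representation. -/
theorem UnitaryRep.exists_intertwiner_universal (σ : UnitaryRep G H) (ξ : ℕ → H) :
    ∃ W : H →L[ℂ] UniversalSpace G, ‖W‖ ≤ 1 ∧
      (∀ g x, W (σ.toHom g x) = (universal G).toHom g (W x)) ∧
      ∀ i, adjoint W (W (ξ i)) = ξ i := by
  obtain ⟨W, hW1, hWc, hWW, hWξ⟩ := σ.exists_partial_isometry ξ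
  obtain ⟨π, hπ⟩ := σ.exists_transport W hWc hWW
  obtain ⟨J, hJ⟩ : ∃ J : lp (fun _ : G × ℕ => ℂ) 2 →ₗᵢ[ℂ] UniversalSpace G,
      ∀ g x, J (π.toHom g x) = (universal G).toHom g (J x) :=
    exists_isometry_directSum (fun π : UnitaryRep G (lp (fun _ : G × ℕ => ℂ) 2) => π) π
  refine ⟨J.toContinuousLinearMap.comp W, ?_, fun g x => ?_, fun i => ?_⟩
  · refine opNorm_le_bound _ zero_le_one fun x => ?_
    change ‖J (W x)‖ ≤ _
    rw [LinearIsometry.norm_map]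
    exact W.le_of_opNorm_le hW1 x
  · change J (W (σ.toHom g x)) = (universal G).toHom g (J (W x))
    rw [hπ, hJ]
  · rw [adjoint_comp]
    change adjoint W (adjoint J.toContinuousLinearMap (J (W (ξ i)))) = ξ i
    have h : adjoint J.toContinuousLinearMap (J (W (ξ i))) = W (ξ i) :=
      DFunLike.congr_fun J.adjoint_comp_self _
    rw [h, hWξ]

end Embedding

section NormBound

variable {G : Type u} [Group G] [TopologicalSpace G] [IsTopologicalGroup G]
  [LocallyCompactSpace G] [MeasurableSpace G] [BorelSpace G]

/-- For unitary representations the adjoint of an intertwiner is again an intertwiner, and bounded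
operators pass through the integral. -/
theorem UnitaryRep.adjoint_intertwines {H E : Type*} [NormedAddCommGroup H]
    [InnerProductSpace ℂ H] [CompleteSpace H] [NormedAddCommGroup E] [InnerProductSpace ℂ E]
    [CompleteSpace E] {σ : UnitaryRep G H} {π : UnitaryRep G E} {W : H →L[ℂ] E}
    (h : ∀ g x, W (σ.toHom g x) = π.toHom g (W x)) (f : C_c(G, ℂ)) :
    (adjoint W).comp (π.integrated f) = (σ.integrated f).comp (adjoint W) := by
  have h' : ∀ g y, adjoint W (π.toHom g y) = σ.toHom g (adjoint W y) := fun g y =>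
    ext_inner_right ℂ fun x => by
      rw [adjoint_inner_left, inner_toHom_left, inner_toHom_left, adjoint_inner_left, h]
  ext y
  rw [comp_apply, comp_apply, integrated_apply, integrated_apply,
    ← (adjoint W).integral_comp_comm (π.integrable_smul_orbit f y)]
  simp only [map_smul, h']

/-- The norm of `∑ π_u(fᵢ) ⊗ π_u(gᵢ)` dominates that of `∑ σ(fᵢ) ⊗ τ(gᵢ)` for all unitary
representations `σ` and `τ`. -/
theorem norm_sum_tensorOp_le_universal {H K ι : Type*} [NormedAddCommGroup H]
    [InnerProductSpace ℂ H] [CompleteSpace H] [NormedAddCommGroup K] [InnerProductSpace ℂ K]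
    [CompleteSpace K] (σ : UnitaryRep G H) (τ : UnitaryRep G K) (s : Finset ι)
    (f g : ι → C_c(G, ℂ)) :
    ‖∑ i ∈ s, tensorOp (σ.integrated (f i)) (τ.integrated (g i))‖ ≤
      ‖∑ i ∈ s, tensorOp ((universal G).integrated (f i)) ((universal G).integrated (g i))‖ := by
  set D := ∑ i ∈ s, tensorOp (σ.integrated (f i)) (τ.integrated (g i)) with hD
  set Du := ∑ i ∈ s, tensorOp ((universal G).integrated (f i)) ((universal G).integrated (g i))
    with hDu
  refine opNorm_le_bound _ (norm_nonneg _) fun x => ?_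
  refine HilbertTensor.denseRange_of.induction_on (p := fun x => ‖D x‖ ≤ ‖Du‖ * ‖x‖) x
    (isClosed_le (by fun_prop) (by fun_prop)) fun t => ?_
  obtain ⟨S, hS⟩ := TensorProduct.exists_finset t
  obtain ⟨ξ, hξ⟩ : ∃ ξ : ℕ → H × K, ∀ p ∈ S, ∃ i, ξ i = p := by
    rcases S.eq_empty_or_nonempty with rfl | ⟨p₀, hp₀⟩
    · exact ⟨fun _ => 0, by simp⟩
    · obtain ⟨ξ, hξ⟩ := (S.countable_toSet).exists_eq_range ⟨p₀, hp₀⟩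
      exact ⟨ξ, fun p hp => by
        have : p ∈ Set.range ξ := hξ ▸ hp
        exact this⟩
  obtain ⟨W, hW1, hW, hWξ⟩ := σ.exists_intertwiner_universal fun i => (ξ i).1
  obtain ⟨V, hV1, hV, hVξ⟩ := τ.exists_intertwiner_universal fun i => (ξ i).2
  -- Since `W*W` and `V*V` fix the vectors occurring in `t`, this commutation gives `D t = (W* ⊗ V*)
  -- Du (W ⊗ V) t`, with contractions on both sides of `Du`.
  have hcomm : D.comp (tensorMap (adjoint W) (adjoint V)) =
      (tensorMap (adjoint W) (adjoint V)).comp Du := by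
    rw [hD, hDu, finsetSum_comp, comp_finsetSum]
    refine Finset.sum_congr rfl fun i _ => ?_
    rw [tensorOp_eq_tensorMap, tensorOp_eq_tensorMap, tensorMap_comp, tensorMap_comp,
      adjoint_intertwines hW, adjoint_intertwines hV]
  have hfix : tensorMap (adjoint W) (adjoint V) (tensorMap W V (HilbertTensor.of t)) =
      HilbertTensor.of t := by
    rw [hS]
    simp only [_root_.map_sum, tensorMap_tmul]
    refine Finset.sum_congr rfl fun p hp => ?_
    obtain ⟨i, rfl⟩ := hξ p hp
    rw [hWξ, hVξ]
  have hb : ‖tensorMap W V‖ ≤ 1 :=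
    (norm_tensorMap_le _ _).trans (mul_le_one₀ hW1 (norm_nonneg _) hV1)
  have hb' : ‖tensorMap (adjoint W) (adjoint V)‖ ≤ 1 := by
    refine (norm_tensorMap_le _ _).trans ?_
    rw [LinearIsometryEquiv.norm_map, LinearIsometryEquiv.norm_map]
    exact mul_le_one₀ hW1 (norm_nonneg _) hV1
  calc ‖D (HilbertTensor.of t)‖
      = ‖tensorMap (adjoint W) (adjoint V) (Du (tensorMap W V (HilbertTensor.of t)))‖ := by
        conv_lhs => rw [← hfix]
        exact congrArg norm (DFunLike.congr_fun hcomm _)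
    _ ≤ 1 * ‖Du (tensorMap W V (HilbertTensor.of t))‖ := le_of_opNorm_le _ hb' _
    _ = ‖Du (tensorMap W V (HilbertTensor.of t))‖ := one_mul _
    _ ≤ ‖Du‖ * ‖tensorMap W V (HilbertTensor.of t)‖ := le_opNorm _ _
    _ ≤ ‖Du‖ * ‖HilbertTensor.of t‖ :=
        mul_le_mul_of_nonneg_left ((le_of_opNorm_le _ hb _).trans_eq (one_mul _)) (norm_nonneg _)

end NormBound

end Universality

/-! ### The norm inequality for `∑ λ(fᵢ)ρ(gᵢ)` -/

section NormInequality

open UnitaryRep ContinuousLinearMap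

section TensorRep

variable {G : Type*} [Group G] [TopologicalSpace G]
  {H K : Type*} [NormedAddCommGroup H] [InnerProductSpace ℂ H]
  [NormedAddCommGroup K] [InnerProductSpace ℂ K]

/-- The trivial unitary representation. -/
def UnitaryRep.trivial (G H : Type*) [Group G] [TopologicalSpace G] [NormedAddCommGroup H]
    [InnerProductSpace ℂ H] : UnitaryRep G H where
  toHom := 1
  continuous_orbit _ := continuous_const

theorem norm_tensorOp_isometry (U : H ≃ₗᵢ[ℂ] H) (V : K ≃ₗᵢ[ℂ] K) (x : HilbertTensor H K) :
    ‖tensorOp (U.toContinuousLinearEquiv : H →L[ℂ] H) (V.toContinuousLinearEquiv : K →L[ℂ] K) x‖ =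
      ‖x‖ := by
  refine HilbertTensor.denseRange_of.induction_on (p := fun x => ‖tensorOp
    (U.toContinuousLinearEquiv : H →L[ℂ] H) (V.toContinuousLinearEquiv : K →L[ℂ] K) x‖ = ‖x‖) x
    (isClosed_eq (by fun_prop) (by fun_prop)) fun t => ?_
  rw [tensorOp_eq_tensorMap, tensorMap_of, LinearIsometry.norm_map, LinearIsometry.norm_map]
  rw [TensorProduct.mapL_apply]
  exact TensorProduct.norm_map U.toLinearIsometry V.toLinearIsometry t

theorem tensorOp_mul (a a' : H →L[ℂ] H) (b b' : K →L[ℂ] K) :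
    tensorOp a b * tensorOp a' b' = tensorOp (a * a') (b * b') :=
  tensorMap_comp a b a' b'

theorem tensorOp_one_one : tensorOp (1 : H →L[ℂ] H) (1 : K →L[ℂ] K) = 1 :=
  HilbertTensor.clm_ext fun ξ η => tensorOp_tmul 1 1 ξ η

theorem UnitaryRep.op_mul (π : UnitaryRep G H) (s t : G) : π.op (s * t) = π.op s * π.op t := by
  ext x
  exact π.toHom_mul_apply s t x

theorem UnitaryRep.op_one (π : UnitaryRep G H) : π.op 1 = 1 := by
  ext x
  simp [op_apply]

/-- The tensor product of two unitary representations. -/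
noncomputable def UnitaryRep.tensor (σ : UnitaryRep G H) (τ : UnitaryRep G K) :
    UnitaryRep G (HilbertTensor H K) where
  toHom :=
    { toFun := fun s =>
        { (tensorOp (σ.op s) (τ.op s) : HilbertTensor H K →ₗ[ℂ] HilbertTensor H K) with
          invFun := tensorOp (σ.op s⁻¹) (τ.op s⁻¹)
          left_inv := fun x => by
            change (tensorOp (σ.op s⁻¹) (τ.op s⁻¹) * tensorOp (σ.op s) (τ.op s)) x = x
            rw [tensorOp_mul, ← op_mul, ← op_mul, inv_mul_cancel, op_one, op_one, tensorOp_one_one]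
            rfl
          right_inv := fun x => by
            change (tensorOp (σ.op s) (τ.op s) * tensorOp (σ.op s⁻¹) (τ.op s⁻¹)) x = x
            rw [tensorOp_mul, ← op_mul, ← op_mul, mul_inv_cancel, op_one, op_one, tensorOp_one_one]
            rfl
          norm_map' := norm_tensorOp_isometry (σ.toHom s) (τ.toHom s) }
      map_one' := by
        ext x
        change tensorOp (σ.op 1) (τ.op 1) x = x
        rw [op_one, op_one, tensorOp_one_one]
        rfl
      map_mul' := fun s t => by
        ext x
        change tensorOp (σ.op (s * t)) (τ.op (s * t)) x =
          (tensorOp (σ.op s) (τ.op s) * tensorOp (σ.op t) (τ.op t)) x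
        rw [op_mul, op_mul, tensorOp_mul] }
  continuous_orbit := by
    refine continuous_orbit_of_dense _ (Set.range HilbertTensor.of) HilbertTensor.denseRange_of ?_
    rintro _ ⟨t, rfl⟩
    change Continuous fun s => tensorOp (σ.op s) (τ.op s) (HilbertTensor.of t)
    induction t with
    | zero => simpa using continuous_const
    | tmul ξ η =>
      simp only [tensorOp_tmul, op_apply]
      exact HilbertTensor.continuous_of_tmul (σ.continuous_orbit ξ) (τ.continuous_orbit η)
    | add x y hx hy =>
      simp only [map_add]
      exact hx.add hy

theorem UnitaryRep.tensor_toHom (σ : UnitaryRep G H) (τ : UnitaryRep G K) (s : G)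
    (x : HilbertTensor H K) : (σ.tensor τ).toHom s x = tensorOp (σ.op s) (τ.op s) x := rfl

theorem UnitaryRep.op_trivial (s : G) : (UnitaryRep.trivial G H).op s = 1 := rfl

variable (H K) in
/-- The elementary tensor as a bounded bilinear map. -/
noncomputable def HilbertTensor.ofL : H →L[ℂ] K →L[ℂ] HilbertTensor H K :=
  (ContinuousLinearMap.compL ℂ K (H ⊗[ℂ] K) (HilbertTensor H K)
    HilbertTensor.of.toContinuousLinearMap).comp (TensorProduct.mkL ℂ H K)

theorem HilbertTensor.ofL_apply (ξ : H) (η : K) :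
    HilbertTensor.ofL H K ξ η = HilbertTensor.of (ξ ⊗ₜ η) := rfl

theorem tensorOp_add_left (a a' : H →L[ℂ] H) (b : K →L[ℂ] K) :
    tensorOp (a + a') b = tensorOp a b + tensorOp a' b :=
  HilbertTensor.clm_ext fun ξ η => by
    simp [tensorOp_tmul, TensorProduct.add_tmul]

theorem tensorOp_sum_left {ι : Type*} (s : Finset ι) (a : ι → H →L[ℂ] H) (b : K →L[ℂ] K) :
    tensorOp (∑ i ∈ s, a i) b = ∑ i ∈ s, tensorOp (a i) b :=
  let φ : (H →L[ℂ] H) →+ (HilbertTensor H K →L[ℂ] HilbertTensor H K) :=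
    AddMonoidHom.mk' (fun a => tensorOp a b) fun a a' => tensorOp_add_left a a' b
  _root_.map_sum φ a s

end TensorRep

section Integrated

variable {G : Type*} [Group G] [TopologicalSpace G] [IsTopologicalGroup G]
  [LocallyCompactSpace G] [MeasurableSpace G] [BorelSpace G]
  {H K : Type*} [NormedAddCommGroup H] [InnerProductSpace ℂ H]
  [NormedAddCommGroup K] [InnerProductSpace ℂ K]

theorem UnitaryRep.norm_integrated_le (π : UnitaryRep G H) (f : C_c(G, ℂ)) :
    ‖π.integrated f‖ ≤ ∫ x, ‖f x‖ ∂(haar : Measure G) :=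
  LinearMap.mkContinuous_norm_le _ (integral_nonneg fun _ => norm_nonneg _) _

theorem UnitaryRep.integrated_add (π : UnitaryRep G H) (f g : C_c(G, ℂ)) :
    π.integrated (f + g) = π.integrated f + π.integrated g := by
  ext ξ
  rw [_root_.add_apply, integrated_apply, integrated_apply, integrated_apply,
    ← integral_add (π.integrable_smul_orbit f ξ) (π.integrable_smul_orbit g ξ)]
  simp only [CompactlySupportedContinuousMap.coe_add, Pi.add_apply, add_smul]

theorem UnitaryRep.integrated_sum (π : UnitaryRep G H) {ι : Type*} (s : Finset ι)
    (f : ι → C_c(G, ℂ)) : π.integrated (∑ i ∈ s, f i) = ∑ i ∈ s, π.integrated (f i) :=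
  _root_.map_sum (AddMonoidHom.mk' π.integrated π.integrated_add) f s

theorem UnitaryRep.integrated_tensor_trivial [CompleteSpace H] (σ : UnitaryRep G H) (f : C_c(G, ℂ)) :
    (σ.tensor (UnitaryRep.trivial G K)).integrated f = tensorOp (σ.integrated f) 1 := by
  refine HilbertTensor.clm_ext fun ξ η => ?_
  have h := ((HilbertTensor.ofL H K).flip η).integral_comp_comm (σ.integrable_smul_orbit f ξ)
  simp only [map_smul, flip_apply, HilbertTensor.ofL_apply] at h
  rw [integrated_apply, tensorOp_tmul, integrated_apply]
  simp only [tensor_toHom, tensorOp_tmul]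
  exact h

theorem UnitaryRep.integrated_trivial_tensor [CompleteSpace K] (τ : UnitaryRep G K) (f : C_c(G, ℂ)) :
    ((UnitaryRep.trivial G H).tensor τ).integrated f = tensorOp 1 (τ.integrated f) := by
  refine HilbertTensor.clm_ext fun ξ η => ?_
  have h := (HilbertTensor.ofL H K ξ).integral_comp_comm (τ.integrable_smul_orbit f η)
  simp only [map_smul, HilbertTensor.ofL_apply] at h
  rw [integrated_apply, tensorOp_tmul, integrated_apply]
  simp only [tensor_toHom, tensorOp_tmul]
  exact h

theorem ccL2_add (f g : C_c(G, ℂ)) : ccL2 (f + g) = ccL2 f + ccL2 g :=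
  MemLp.toLp_add (memLp_two_cc f) (memLp_two_cc g)

theorem ccL2_sum {ι : Type*} (s : Finset ι) (f : ι → C_c(G, ℂ)) :
    ccL2 (∑ i ∈ s, f i) = ∑ i ∈ s, ccL2 (f i) :=
  _root_.map_sum (AddMonoidHom.mk' (ccL2 (G := G)) ccL2_add) f s

/-- If `τ` acts on `(σ(F) ⊗ 1) v` approximately like right translation of `F`, then so does its
integrated form. -/
theorem norm_tensorOp_sub_le [CompleteSpace H] [CompleteSpace K] (σ : UnitaryRep G H) (τ : UnitaryRep G K) (f g F : C_c(G, ℂ))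
    (v : HilbertTensor H K) {η : ℝ}
    (h : ∀ t ∈ tsupport g, ‖tensorOp (σ.integrated F) (τ.op t) v -
      tensorOp (σ.integrated (rhoCc t F)) 1 v‖ ≤ η) :
    ‖tensorOp (σ.integrated (convCc f (rhoConvCc g F))) 1 v -
      tensorOp (σ.integrated f) (τ.integrated g) (tensorOp (σ.integrated F) 1 v)‖ ≤
      (∫ x, ‖f x‖ ∂(haar : Measure G)) * ((∫ x, ‖g x‖ ∂(haar : Measure G)) * η) := by
  -- With `σ ⊗ 1` and `1 ⊗ τ` as representations on one space, the difference becomes `σ'(f) ∫ g(t)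
  -- (σ'(ρ(t)F) - σ'(F)τ'(t))v dt`, and `h` bounds the integrand.
  set σ' : UnitaryRep G (HilbertTensor H K) := σ.tensor (UnitaryRep.trivial G K) with hσ'
  set τ' : UnitaryRep G (HilbertTensor H K) := (UnitaryRep.trivial G H).tensor τ with hτ'
  have hσ'i : ∀ f, tensorOp (σ.integrated f) 1 = σ'.integrated f := fun f =>
    (σ.integrated_tensor_trivial f).symm
  have e1 : tensorOp (σ.integrated f) (τ.integrated g) (tensorOp (σ.integrated F) 1 v) =
      σ'.integrated f (σ'.integrated F (τ'.integrated g v)) := by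
    rw [← hσ'i, ← hσ'i, hτ', integrated_trivial_tensor, ← mul_apply_eq_comp, ← mul_apply_eq_comp,
      ← mul_apply_eq_comp, tensorOp_mul, tensorOp_mul, tensorOp_mul]
    simp only [one_mul, mul_one]
  have hA : ∀ t, tensorOp (σ.integrated F) (τ.op t) v = σ'.integrated F (τ'.toHom t v) := by
    intro t
    rw [← hσ'i, hτ', tensor_toHom, op_trivial, ← mul_apply_eq_comp, tensorOp_mul, mul_one, one_mul]
  rw [e1, hσ'i, integrated_convCc, mul_apply_eq_comp, ← map_sub]
  refine (le_of_opNorm_le _ (σ'.norm_integrated_le f) _).trans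
    (mul_le_mul_of_nonneg_left ?_ (integral_nonneg fun _ => norm_nonneg _))
  have i1 : Integrable (fun t => g t • σ'.integrated (rhoCc t F) v) (haar : Measure G) := by
    simp only [integrated_rhoCc]
    refine Continuous.integrable_of_hasCompactSupport ?_ g.hasCompactSupport.smul_right
    have h1 : Continuous fun t : G => ((√(modularFn t))⁻¹ : ℝ) :=
      (Real.continuous_sqrt.comp continuous_modularFn).inv₀ fun t =>
        (Real.sqrt_pos.2 (modularFn_pos t)).ne'
    have h2 : Continuous fun t : G => σ'.toHom t⁻¹ v := (σ'.continuous_orbit v).comp continuous_inv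
    exact g.continuous.smul ((Complex.continuous_ofReal.comp h1).smul
      ((σ'.integrated F).continuous.comp h2))
  have i2 : Integrable (fun t => g t • σ'.integrated F (τ'.toHom t v)) (haar : Measure G) := by
    simpa only [map_smul] using
      (σ'.integrated F).integrable_comp (τ'.integrable_smul_orbit g v)
  rw [integrated_rhoConvCc, τ'.integrated_apply,
    ← (σ'.integrated F).integral_comp_comm (τ'.integrable_smul_orbit g v)]
  simp only [map_smul]
  rw [← integral_sub i1 i2, ← integral_mul_const]
  have hg : Integrable (fun t => ‖g t‖) (haar : Measure G) :=
    (g.continuous.integrable_of_hasCompactSupport g.hasCompactSupport).norm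
  refine norm_integral_le_of_norm_le (hg.mul_const η) (ae_of_all _ fun t => ?_)
  rw [← smul_sub, norm_smul]
  by_cases ht : t ∈ tsupport g
  · refine mul_le_mul_of_nonneg_left ?_ (norm_nonneg _)
    rw [norm_sub_rev, ← hA, ← hσ'i]
    exact h t ht
  · simp [image_eq_zero_of_notMem_tsupport ht]

theorem norm_tensorOp_sum_sub_le [CompleteSpace H] [CompleteSpace K] (σ : UnitaryRep G H)
    (τ : UnitaryRep G K) {ι : Type*} (s : Finset ι) (f g : ι → C_c(G, ℂ)) (F : C_c(G, ℂ))
    (v : HilbertTensor H K) {η : ℝ}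
    (h : ∀ i ∈ s, ∀ t ∈ tsupport (g i), ‖tensorOp (σ.integrated F) (τ.op t) v -
      tensorOp (σ.integrated (rhoCc t F)) 1 v‖ ≤ η) :
    ‖tensorOp (σ.integrated (∑ i ∈ s, convCc (f i) (rhoConvCc (g i) F))) 1 v -
      (∑ i ∈ s, tensorOp (σ.integrated (f i)) (τ.integrated (g i)))
        (tensorOp (σ.integrated F) 1 v)‖ ≤
      (∑ i ∈ s, (∫ x, ‖f i x‖ ∂(haar : Measure G)) * ∫ x, ‖g i x‖ ∂(haar : Measure G)) * η := by
  rw [integrated_sum, tensorOp_sum_left, _root_.sum_apply, _root_.sum_apply,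
    ← Finset.sum_sub_distrib, Finset.sum_mul]
  refine (norm_sum_le _ _).trans (Finset.sum_le_sum fun i hi => ?_)
  rw [mul_assoc]
  exact norm_tensorOp_sub_le σ τ (f i) (g i) F v (h i hi)

end Integrated

variable {G : Type u} [Group G] [TopologicalSpace G] [IsTopologicalGroup G]
  [LocallyCompactSpace G] [MeasurableSpace G] [BorelSpace G] [T2Space G]

/-- The vector `v` of `exists_approximating_vector`, taken for `F` and `F₂`, transports the
estimate: `‖F₂‖` is nearly at most `‖(σ(F₂) ⊗ 1)v‖`, which is close to `‖∑ (σ(fᵢ) ⊗ τ(gᵢ))(σ(F) ⊗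
1)v‖`, and this is at most `M` times a quantity barely exceeding `‖F‖`. Then `ε → 0`. -/
theorem norm_ccL2_sum_le
    (hG : ∀ x : G, x ≠ 1 →
      ∃ (G' : Type v) (_ : Group G') (_ : TopologicalSpace G') (_ : IsTopologicalGroup G')
        (_ : LocallyCompactSpace G') (_ : T2Space G'),
        IsAmenable G' ∧ ∃ φ : G →* G', Continuous φ ∧ φ x ≠ 1)
    {ι : Type*} (s : Finset ι) (f g : ι → C_c(G, ℂ)) {M : ℝ}
    (hM : ‖∑ i ∈ s, tensorOp ((universal G).integrated (f i))
      ((universal G).integrated (g i))‖ ≤ M) (F : C_c(G, ℂ)) :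
    ‖ccL2 (∑ i ∈ s, convCc (f i) (rhoConvCc (g i) F))‖ ≤ M * ‖ccL2 F‖ := by
  have hM0 : 0 ≤ M := (norm_nonneg _).trans hM
  set F₂ : C_c(G, ℂ) := ∑ i ∈ s, convCc (f i) (rhoConvCc (g i) F) with hF₂
  set C : ℝ := ∑ i ∈ s, (∫ x, ‖f i x‖ ∂(haar : Measure G)) * ∫ x, ‖g i x‖ ∂(haar : Measure G)
    with hC
  have key : ∀ ε : ℝ, 0 < ε → ‖ccL2 F₂‖ ^ 2 ≤ (M * √(‖ccL2 F‖ ^ 2 + ε) + C * √ε) ^ 2 + ε := by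
    intro ε hε
    have hS : IsCompact (⋃ i ∈ s, tsupport (g i)) :=
      s.isCompact_biUnion fun i _ => (g i).hasCompactSupport
    obtain ⟨H, _, _, _, σ, τ, v, h1, h2, h3⟩ := exists_approximating_vector hG F F₂ hS hε
    have h4 : ‖tensorOp (σ.integrated F₂) 1 v‖ ≤ M * √(‖ccL2 F‖ ^ 2 + ε) + C * √ε := by
      have hDD := (norm_sum_tensorOp_le_universal σ τ s f g).trans hM
      have h5 := norm_tensorOp_sum_sub_le σ τ s f g F v (η := √ε) fun i hi t ht =>
        Real.le_sqrt_of_sq_le (h3 t (Set.mem_biUnion hi ht))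
      have h6 := (le_of_opNorm_le _ hDD (tensorOp (σ.integrated F) 1 v)).trans
          (mul_le_mul_of_nonneg_left (Real.le_sqrt_of_sq_le h1) hM0)
      exact (norm_le_norm_add_norm_sub _ _).trans (add_le_add h6 ((norm_sub_rev _ _).trans_le h5))
    have h5 := pow_le_pow_left₀ (norm_nonneg _) h4 2
    linarith
  have hlim : Tendsto (fun ε : ℝ => (M * √(‖ccL2 F‖ ^ 2 + ε) + C * √ε) ^ 2 + ε) (𝓝[>] 0)
      (𝓝 ((M * √(‖ccL2 F‖ ^ 2 + 0) + C * √0) ^ 2 + 0)) :=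
    (Continuous.tendsto (by fun_prop) 0).mono_left nhdsWithin_le_nhds
  have h := ge_of_tendsto hlim (eventually_mem_nhdsWithin.mono fun ε hε => key ε hε)
  rw [Real.sqrt_zero, mul_zero, add_zero, add_zero, add_zero, Real.sqrt_sq (norm_nonneg _)] at h
  exact (sq_le_sq₀ (norm_nonneg _) (by positivity)).1 h

/-- If homomorphisms into amenable groups separate the points of `G`, then the norm of
`∑ λ(fᵢ) ρ(gᵢ)` is at most that of `∑ π_u(fᵢ) ⊗ π_u(gᵢ)`. -/
theorem norm_sum_leftRegular_rightRegular_le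
    (hG : ∀ x : G, x ≠ 1 →
      ∃ (G' : Type v) (_ : Group G') (_ : TopologicalSpace G') (_ : IsTopologicalGroup G')
        (_ : LocallyCompactSpace G') (_ : T2Space G'),
        IsAmenable G' ∧ ∃ φ : G →* G', Continuous φ ∧ φ x ≠ 1)
    {ι : Type*} (s : Finset ι) (f g : ι → C_c(G, ℂ)) :
    ‖∑ i ∈ s, (leftRegular.integrated (f i)).comp (rightRegular.integrated (g i))‖ ≤
      ‖∑ i ∈ s, tensorOp ((universal G).integrated (f i)) ((universal G).integrated (g i))‖ := by
  refine opNorm_le_bound _ (norm_nonneg _) fun x => ?_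
  refine denseRange_ccL2.induction_on (p := fun x => ‖(∑ i ∈ s,
    (leftRegular.integrated (f i)).comp (rightRegular.integrated (g i))) x‖ ≤ _ * ‖x‖) x
    (isClosed_le (by fun_prop) (by fun_prop)) fun F => ?_
  refine le_trans (le_of_eq ?_) (norm_ccL2_sum_le hG s f g le_rfl F)
  rw [_root_.sum_apply, ccL2_sum]
  simp only [ContinuousLinearMap.comp_apply, rightRegular_integrated_ccL2,
    leftRegular_integrated_ccL2]

end NormInequality

/-! ### Extension to the minimal tensor product -/

section Extension

open UnitaryRep ContinuousLinearMap

section Abstract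

variable {A B : Type*} [NormedRing A] [StarRing A] [NormedStarGroup A] [NormedAlgebra ℂ A]
  [CompleteSpace A] [NormedRing B] [StarRing B] [NormedStarGroup B] [NormedAlgebra ℂ B]
  [CompleteSpace B]

/-- A *-subalgebra of `A × B` on which the second coordinate is dominated by the first one is the
graph of a *-homomorphism on the closure of its image in `A`. -/
theorem exists_starHom_of_graph (S : NonUnitalStarSubalgebra ℂ (A × B))
    (hS : ∀ p ∈ S, ‖p.2‖ ≤ ‖p.1‖) (M : NonUnitalStarSubalgebra ℂ A)
    (hM : ∀ a ∈ M, a ∈ closure (Prod.fst '' (S : Set (A × B)))) :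
    ∃ Φ : M →⋆ₙₐ[ℂ] B, ∀ p ∈ S, ∀ hp : p.1 ∈ M, Φ ⟨p.1, hp⟩ = p.2 := by
  set T := S.topologicalClosure with hT
  have hST : S ≤ T := S.le_topologicalClosure
  have hTc : IsClosed (T : Set (A × B)) := S.isClosed_topologicalClosure
  have hTn : ∀ p ∈ T, ‖p.2‖ ≤ ‖p.1‖ := fun p hp =>
    closure_minimal (t := {p : A × B | ‖p.2‖ ≤ ‖p.1‖}) hS
      (isClosed_le (by fun_prop) (by fun_prop)) hp
  have huniq : ∀ p ∈ T, ∀ q ∈ T, p.1 = q.1 → p.2 = q.2 := fun p hp q hq h => by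
    have := hTn _ (sub_mem hp hq)
    rw [Prod.fst_sub, h, sub_self, norm_zero, norm_le_zero_iff] at this
    exact sub_eq_zero.1 this
  have : CompleteSpace T := hTc.completeSpace_coe
  -- The maximum norm on `A × B` equals the norm of the first coordinate on `T`. Completeness then
  -- makes the image of `T` closed, so it contains all of `M`.
  have hiso : Isometry fun p : T => (p : A × B).1 := by
    refine Isometry.of_dist_eq fun p q => ?_
    rw [Subtype.dist_eq, dist_eq_norm, dist_eq_norm, Prod.norm_def,
      max_eq_left (hTn _ (sub_mem p.2 q.2)), Prod.fst_sub]
  have hex : ∀ a : M, ∃ b : B, ((a : A), b) ∈ T := fun a => by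
    have h : (a : A) ∈ Set.range fun p : T => (p : A × B).1 := by
      refine closure_minimal ?_ hiso.isClosedEmbedding.isClosed_range (hM a a.2)
      rintro _ ⟨p, hp, rfl⟩
      exact ⟨⟨p, hST hp⟩, rfl⟩
    obtain ⟨p, hp⟩ := h
    refine ⟨(p : A × B).2, ?_⟩
    rw [← hp]
    exact p.2
  choose φ hφ using hex
  let Φ : M →⋆ₙₐ[ℂ] B :=
    { toFun := φ
      map_smul' := fun c a => huniq _ (hφ (c • a)) _ (SMulMemClass.smul_mem c (hφ a)) rfl
      map_zero' := huniq _ (hφ 0) _ (zero_mem T) rfl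
      map_add' := fun a b => huniq _ (hφ (a + b)) _ (add_mem (hφ a) (hφ b)) rfl
      map_mul' := fun a b => huniq _ (hφ (a * b)) _ (mul_mem (hφ a) (hφ b)) rfl
      map_star' := fun a => huniq _ (hφ (star a)) _ (star_mem (hφ a)) rfl }
  exact ⟨Φ, fun p hp hp' => huniq _ (hφ ⟨p.1, hp'⟩) _ (hST hp) rfl⟩

/-- The linear span of a self-adjoint multiplicatively closed set is a *-subalgebra. -/
def spanStarSubalgebra {C ι : Type*} [Ring C] [StarRing C] [Algebra ℂ C] [StarModule ℂ C]
    (m : ι → C) (hmul : ∀ i j, ∃ k, m i * m j = m k) (hstar : ∀ i, ∃ k, star (m i) = m k) :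
    NonUnitalStarSubalgebra ℂ C where
  carrier := Submodule.span ℂ (Set.range m)
  zero_mem' := zero_mem (Submodule.span ℂ (Set.range m))
  add_mem' ha hb := add_mem (S := Submodule ℂ C) ha hb
  smul_mem' c _ ha := Submodule.smul_mem _ c ha
  mul_mem' {a b} ha hb := by
    change a * b ∈ Submodule.span ℂ (Set.range m)
    refine Submodule.span_induction₂ (p := fun a b _ _ => a * b ∈ Submodule.span ℂ (Set.range m))
      ?_ ?_ ?_ ?_ ?_ ?_ ?_ ha hb
    · rintro _ _ ⟨i, rfl⟩ ⟨j, rfl⟩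
      obtain ⟨k, hk⟩ := hmul i j
      rw [hk]
      exact Submodule.subset_span ⟨k, rfl⟩
    · intro y _
      simp
    · intro y _
      simp
    · intro x y z _ _ _ h1 h2
      rw [add_mul]
      exact add_mem h1 h2
    · intro x y z _ _ _ h1 h2
      rw [mul_add]
      exact add_mem h1 h2
    · intro c x y _ _ h
      rw [smul_mul_assoc]
      exact Submodule.smul_mem _ c h
    · intro c x y _ _ h
      rw [mul_smul_comm]
      exact Submodule.smul_mem _ c h
  star_mem' {a} ha := by
    change star a ∈ Submodule.span ℂ (Set.range m)
    refine Submodule.span_induction (p := fun a _ => star a ∈ Submodule.span ℂ (Set.range m))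
      ?_ ?_ ?_ ?_ ha
    · rintro _ ⟨i, rfl⟩
      obtain ⟨k, hk⟩ := hstar i
      rw [hk]
      exact Submodule.subset_span ⟨k, rfl⟩
    · simp
    · intro x y _ _ h1 h2
      rw [star_add]
      exact add_mem h1 h2
    · intro c x _ h
      rw [star_smul]
      exact Submodule.smul_mem _ _ h

end Abstract

section TensorOp

variable {H K : Type*} [NormedAddCommGroup H] [InnerProductSpace ℂ H]
  [NormedAddCommGroup K] [InnerProductSpace ℂ K]

theorem tensorOp_smul_left (c : ℂ) (a : H →L[ℂ] H) (b : K →L[ℂ] K) :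
    tensorOp (c • a) b = c • tensorOp a b :=
  HilbertTensor.clm_ext fun ξ η => by
    rw [_root_.smul_apply, tensorOp_tmul, tensorOp_tmul, _root_.smul_apply,
      ← TensorProduct.smul_tmul', map_smul]

theorem tensorOp_smul_right (c : ℂ) (a : H →L[ℂ] H) (b : K →L[ℂ] K) :
    tensorOp a (c • b) = c • tensorOp a b :=
  HilbertTensor.clm_ext fun ξ η => by
    rw [_root_.smul_apply, tensorOp_tmul, tensorOp_tmul, _root_.smul_apply,
      TensorProduct.tmul_smul, map_smul]

theorem tensorOp_add_right (a : H →L[ℂ] H) (b b' : K →L[ℂ] K) :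
    tensorOp a (b + b') = tensorOp a b + tensorOp a b' :=
  HilbertTensor.clm_ext fun ξ η => by
    simp [tensorOp_tmul, TensorProduct.tmul_add]

theorem continuous_tensorOp :
    Continuous fun p : (H →L[ℂ] H) × (K →L[ℂ] K) => tensorOp p.1 p.2 :=
  IsBoundedBilinearMap.continuous (𝕜 := ℂ)
    { add_left := tensorOp_add_left
      smul_left := tensorOp_smul_left
      add_right := tensorOp_add_right
      smul_right := tensorOp_smul_right
      bound := ⟨1, one_pos, fun a b => by
        rw [one_mul]
        exact norm_tensorMap_le a b⟩ }

theorem star_tensorOp [CompleteSpace H] [CompleteSpace K] (a : H →L[ℂ] H) (b : K →L[ℂ] K) :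
    star (tensorOp a b) = tensorOp (star a) (star b) := by
  refine HilbertTensor.clm_ext fun ξ η => ?_
  rw [star_eq_adjoint, star_eq_adjoint, star_eq_adjoint, tensorOp_tmul]
  have h : (innerSL ℂ (HilbertTensor.of (ξ ⊗ₜ[ℂ] η))).comp (tensorOp a b) =
      innerSL ℂ (HilbertTensor.of (adjoint a ξ ⊗ₜ[ℂ] adjoint b η)) :=
    HilbertTensor.clm_ext fun x y => by
      rw [ContinuousLinearMap.comp_apply, tensorOp_tmul, innerSL_apply_apply, innerSL_apply_apply,
        HilbertTensor.inner_of_tmul, HilbertTensor.inner_of_tmul, adjoint_inner_left,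
        adjoint_inner_left]
  refine ext_inner_right ℂ fun v => ?_
  rw [adjoint_inner_left]
  exact DFunLike.congr_fun h v

end TensorOp

section Group

variable {G : Type*} [Group G] [TopologicalSpace G] [IsTopologicalGroup G]
  [LocallyCompactSpace G] [MeasurableSpace G] [BorelSpace G]

theorem UnitaryRep.integrated_smul {H : Type*} [NormedAddCommGroup H] [InnerProductSpace ℂ H]
    (π : UnitaryRep G H) (c : ℂ) (f : C_c(G, ℂ)) : π.integrated (c • f) = c • π.integrated f := by
  ext ξ
  rw [_root_.smul_apply, integrated_apply, integrated_apply, ← integral_smul]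
  simp only [CompactlySupportedContinuousMap.coe_smul, Pi.smul_apply, smul_assoc]

theorem UnitaryRep.integrated_zero {H : Type*} [NormedAddCommGroup H] [InnerProductSpace ℂ H]
    (π : UnitaryRep G H) : π.integrated (0 : C_c(G, ℂ)) = 0 := by
  simpa using π.integrated_smul 0 0

theorem UnitaryRep.integrated_intertwines {H E : Type*} [NormedAddCommGroup H]
    [InnerProductSpace ℂ H] [CompleteSpace H] [NormedAddCommGroup E] [InnerProductSpace ℂ E]
    [CompleteSpace E] {σ : UnitaryRep G H} {π : UnitaryRep G E} {W : H →L[ℂ] E}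
    (h : ∀ g x, W (σ.toHom g x) = π.toHom g (W x)) (f : C_c(G, ℂ)) (x : H) :
    W (σ.integrated f x) = π.integrated f (W x) := by
  rw [integrated_apply, integrated_apply, ← W.integral_comp_comm (σ.integrable_smul_orbit f x)]
  simp only [map_smul, h]

theorem leftRegular_rightRegular_commute (s t : G) (ξ : L2 G) :
    leftRegular.toHom s (rightRegular.toHom t ξ) = rightRegular.toHom t (leftRegular.toHom s ξ) := by
  refine denseRange_ccL2.induction_on (p := fun ξ => leftRegular.toHom s (rightRegular.toHom t ξ) =
    rightRegular.toHom t (leftRegular.toHom s ξ)) ξ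
    (isClosed_eq (by fun_prop) (by fun_prop)) fun F => ?_
  rw [rightRegular_ccL2, leftRegular_ccL2, leftRegular_ccL2, rightRegular_ccL2]
  congr 1
  ext x
  simp [leftCc_apply, rhoCc_apply, mul_assoc]

/-- Each operator `λ(s)` commutes with `ρ`, hence with `ρ(g)`; then `ρ(g)` commutes with `λ`, hence
with `λ(f)`. -/
theorem integrated_leftRegular_mul_rightRegular (f g : C_c(G, ℂ)) :
    rightRegular.integrated g * leftRegular.integrated f =
      leftRegular.integrated f * rightRegular.integrated g := by
  ext1 ξ
  refine integrated_intertwines (σ := leftRegular) (π := leftRegular)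
    (W := rightRegular.integrated g) (fun s x => ?_) f ξ
  exact (integrated_intertwines (σ := rightRegular) (π := rightRegular) (W := leftRegular.op s)
    (fun t y => leftRegular_rightRegular_commute s t y) g x).symm

/-- The integrated form of a unitary representation maps `C_c(G)` onto a *-subalgebra. -/
theorem UnitaryRep.adjoin_range_integrated_subset [T2Space G] {H : Type*} [NormedAddCommGroup H]
    [InnerProductSpace ℂ H] [CompleteSpace H] (π : UnitaryRep G H) {a : H →L[ℂ] H}
    (ha : a ∈ NonUnitalStarAlgebra.adjoin ℂ (Set.range fun f : C_c(G, ℂ) => π.integrated f)) :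
    a ∈ Set.range fun f : C_c(G, ℂ) => π.integrated f := by
  let R : NonUnitalStarSubalgebra ℂ (H →L[ℂ] H) :=
    { carrier := Set.range fun f : C_c(G, ℂ) => π.integrated f
      zero_mem' := ⟨0, π.integrated_zero⟩
      add_mem' := by
        rintro _ _ ⟨f, rfl⟩ ⟨g, rfl⟩
        exact ⟨f + g, π.integrated_add f g⟩
      smul_mem' := by
        rintro c _ ⟨f, rfl⟩
        exact ⟨c • f, π.integrated_smul c f⟩
      mul_mem' := by
        rintro _ _ ⟨f, rfl⟩ ⟨g, rfl⟩
        exact ⟨convCc f g, π.integrated_convCc f g⟩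
      star_mem' := by
        rintro _ ⟨f, rfl⟩
        exact ⟨starCc f, π.integrated_starCc f⟩ }
  exact NonUnitalStarAlgebra.adjoin_le (S := R) (fun _ h => h) ha

end Group

variable {G : Type u} [Group G] [TopologicalSpace G] [IsTopologicalGroup G]
  [LocallyCompactSpace G] [MeasurableSpace G] [BorelSpace G]

theorem groupCStar_subset_closure [T2Space G] {a : UniversalSpace G →L[ℂ] UniversalSpace G}
    (ha : a ∈ groupCStar G) :
    a ∈ closure (Set.range fun f : C_c(G, ℂ) => (universal G).integrated f) :=
  closure_mono (fun _ h => (universal G).adjoin_range_integrated_subset h) ha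

variable (G) in
/-- The pairs `(π_u(f) ⊗ π_u(g), λ(f) ρ(g))`. -/
noncomputable def factorizationPair (p : C_c(G, ℂ) × C_c(G, ℂ)) :
    (HilbertTensor (UniversalSpace G) (UniversalSpace G) →L[ℂ]
      HilbertTensor (UniversalSpace G) (UniversalSpace G)) × (L2 G →L[ℂ] L2 G) :=
  (tensorOp ((universal G).integrated p.1) ((universal G).integrated p.2),
    leftRegular.integrated p.1 * rightRegular.integrated p.2)

theorem factorizationPair_mul (p q : C_c(G, ℂ) × C_c(G, ℂ)) :
    factorizationPair G p * factorizationPair G q =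
      factorizationPair G (convCc p.1 q.1, convCc p.2 q.2) := by
  refine Prod.ext ?_ ?_
  · change tensorOp _ _ * tensorOp _ _ = tensorOp _ _
    rw [tensorOp_mul, integrated_convCc, integrated_convCc]
  · change leftRegular.integrated p.1 * rightRegular.integrated p.2 *
      (leftRegular.integrated q.1 * rightRegular.integrated q.2) =
      leftRegular.integrated (convCc p.1 q.1) * rightRegular.integrated (convCc p.2 q.2)
    rw [integrated_convCc, integrated_convCc, mul_assoc, mul_assoc,
      ← mul_assoc (rightRegular.integrated p.2), integrated_leftRegular_mul_rightRegular, mul_assoc]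

variable [T2Space G]

theorem star_factorizationPair (p : C_c(G, ℂ) × C_c(G, ℂ)) :
    star (factorizationPair G p) = factorizationPair G (starCc p.1, starCc p.2) := by
  refine Prod.ext ?_ ?_
  · change star (tensorOp _ _) = tensorOp _ _
    rw [star_tensorOp, integrated_starCc, integrated_starCc]
  · change star (leftRegular.integrated p.1 * rightRegular.integrated p.2) =
      leftRegular.integrated (starCc p.1) * rightRegular.integrated (starCc p.2)
    rw [star_mul, integrated_starCc, integrated_starCc, ← integrated_starCc, ← integrated_starCc,
      integrated_leftRegular_mul_rightRegular]

/-- The coefficients of a linear combination are absorbed into the first functions `fᵢ`, reducing to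
the inequality for plain sums. -/
theorem norm_snd_le_of_mem_span
    (hG : ∀ x : G, x ≠ 1 →
      ∃ (G' : Type v) (_ : Group G') (_ : TopologicalSpace G') (_ : IsTopologicalGroup G')
        (_ : LocallyCompactSpace G') (_ : T2Space G'),
        IsAmenable G' ∧ ∃ φ : G →* G', Continuous φ ∧ φ x ≠ 1)
    {p : (HilbertTensor (UniversalSpace G) (UniversalSpace G) →L[ℂ]
      HilbertTensor (UniversalSpace G) (UniversalSpace G)) × (L2 G →L[ℂ] L2 G)}
    (hp : p ∈ Submodule.span ℂ (Set.range (factorizationPair G))) : ‖p.2‖ ≤ ‖p.1‖ := by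
  obtain ⟨c, rfl⟩ := Finsupp.mem_span_range_iff_exists_finsupp.1 hp
  rw [Finsupp.sum, Prod.fst_sum, Prod.snd_sum]
  have h := norm_sum_leftRegular_rightRegular_le hG c.support (fun i => c i • i.1) fun i => i.2
  simp only [integrated_smul, tensorOp_smul_left, smul_comp] at h
  exact h

/-- A locally compact group whose points are separated by continuous homomorphisms into amenable
groups has the factorization property. -/
theorem hasFactorizationProperty_of_separating
    (hG : ∀ x : G, x ≠ 1 →
      ∃ (G' : Type v) (_ : Group G') (_ : TopologicalSpace G') (_ : IsTopologicalGroup G')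
        (_ : LocallyCompactSpace G') (_ : T2Space G'),
        IsAmenable G' ∧ ∃ φ : G →* G', Continuous φ ∧ φ x ≠ 1) :
    HasFactorizationProperty G := by
  let S := spanStarSubalgebra (factorizationPair G) (fun p q => ⟨_, factorizationPair_mul p q⟩)
    fun p => ⟨_, star_factorizationPair p⟩
  let F := (S.map (NonUnitalStarAlgHom.fst ℂ _ _)).topologicalClosure
  have hF : ∀ f g : C_c(G, ℂ), factorizationPair G (f, g) ∈ S := fun f g =>
    Submodule.subset_span ⟨(f, g), rfl⟩
  -- Joint norm continuity of `⊗` reduces generators `a ⊗ b` to `π_u(f) ⊗ π_u(g)`.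
  have hM : minTensor (groupCStar G) (groupCStar G) ≤ F := by
    refine NonUnitalStarSubalgebra.topologicalClosure_minimal _
      (NonUnitalStarAlgebra.adjoin_le ?_) (NonUnitalStarSubalgebra.isClosed_topologicalClosure _)
    rintro _ ⟨a, ha, b, hb, rfl⟩
    refine map_mem_closure₂ (f := tensorOp) continuous_tensorOp (groupCStar_subset_closure ha)
      (groupCStar_subset_closure hb) ?_
    rintro _ ⟨f, rfl⟩ _ ⟨g, rfl⟩
    exact ⟨_, hF f g, rfl⟩
  obtain ⟨Φ, hΦ⟩ := exists_starHom_of_graph S (fun p hp => norm_snd_le_of_mem_span hG hp)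
    (minTensor (groupCStar G) (groupCStar G)) fun a ha => hM ha
  exact ⟨Φ, fun f g => hΦ _ (hF f g) (elemTensor (toGroupCStar f) (toGroupCStar g)).2⟩

end Extension

/-! ### Residual amenable embeddability as a separation property -/

section Separation

variable {G : Type u} [Group G] [TopologicalSpace G] [IsTopologicalGroup G]

/-- Compose the embedding of `G ⧸ N` with the quotient map in one direction. In the other take `N =
ker φ`, closed because `G'` is Hausdorff, and the injective map induced by `φ`. -/
theorem residuallyAmenablyEmbeddable_iff :
    ResiduallyAmenablyEmbeddable.{u, v} G ↔ ∀ x : G, x ≠ 1 →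
      ∃ (G' : Type v) (_ : Group G') (_ : TopologicalSpace G') (_ : IsTopologicalGroup G')
        (_ : LocallyCompactSpace G') (_ : T2Space G'),
        IsAmenable G' ∧ ∃ φ : G →* G', Continuous φ ∧ φ x ≠ 1 := by
  refine ⟨fun h x hx => ?_, fun h x hx => ?_⟩
  · obtain ⟨N, _, hN, hxN, G', i1, i2, i3, i4, i5, hG', ι, hι, hinj⟩ := h x hx
    refine ⟨G', i1, i2, i3, i4, i5, hG', ι.comp (QuotientGroup.mk' N),
      hι.comp continuous_quotient_mk', fun h1 => hxN ?_⟩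
    have h2 : ι (QuotientGroup.mk' N x) = ι 1 := h1.trans (map_one ι).symm
    exact (QuotientGroup.eq_one_iff x).1 (hinj h2)
  · obtain ⟨G', i1, i2, i3, i4, i5, hG', φ, hφ, hx'⟩ := h x hx
    refine ⟨φ.ker, inferInstance, ?_, hx', G', i1, i2, i3, i4, i5, hG', QuotientGroup.kerLift φ,
      ?_, QuotientGroup.kerLift_injective φ⟩
    · exact isClosed_singleton.preimage hφ
    · exact hφ.quotient_lift _

/-- The quotient `G ⧸ N` is itself an amenable locally compact group, Hausdorff because `N` is
closed, and embeds by the identity. -/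
theorem ResiduallyAmenable.residuallyAmenablyEmbeddable [LocallyCompactSpace G]
    (h : ResiduallyAmenable G) : ResiduallyAmenablyEmbeddable.{u, u} G := by
  intro x hx
  obtain ⟨N, _, hN, hxN, hA⟩ := h x hx
  have : IsClosed (N : Set G) := hN
  exact ⟨N, inferInstance, hN, hxN, G ⧸ N, inferInstance, inferInstance, inferInstance,
    inferInstance, inferInstance, hA, MonoidHom.id _, continuous_id, Function.injective_id⟩

end Separation

end FactorizationProof

theorem mainTheorem3 (G : Type u) [Group G] [TopologicalSpace G] [IsTopologicalGroup G]
    [LocallyCompactSpace G] [T2Space G] [MeasurableSpace G] [BorelSpace G] :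
    (ResiduallyAmenablyEmbeddable.{u, v} G → HasFactorizationProperty G) ∧
    (ResiduallyAmenablyEmbeddable.{u, v} G ↔
      ∀ x : G, x ≠ 1 →
        ∃ (G' : Type v) (_ : Group G') (_ : TopologicalSpace G') (_ : IsTopologicalGroup G')
          (_ : LocallyCompactSpace G') (_ : T2Space G'),
          IsAmenable G' ∧ ∃ φ : G →* G', Continuous φ ∧ φ x ≠ 1) ∧
    (ResiduallyAmenable G → HasFactorizationProperty G) :=
  ⟨fun h => hasFactorizationProperty_of_separating (residuallyAmenablyEmbeddable_iff.1 h),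
    residuallyAmenablyEmbeddable_iff, fun h => hasFactorizationProperty_of_separating
      (residuallyAmenablyEmbeddable_iff.1 h.residuallyAmenablyEmbeddable)⟩
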